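/- All graphs are finite, simple and undirected. A matching cut of a graph $G$ is a (possibly empty) set of edges $M$ in which no two distinct edges share an end-vertex and such that $M=E_G(A,B)$ for some partition $\{A,B\}$ of $V(G)$ into two nonempty sets. The problems Enum MC, Enum Minimal MC and Enum Maximal MC ask, for an input graph $G$, to list all, all inclusion-minimal, and all inclusion-maximal matching cuts of $G$, respectively; write $\mathrm{Sol}(G)$ for the set of solutions. For a parameter $\kappa$, a *fully-polynomial enumeration kernel* is a pair of algorithms $\mathcal A,\mathcal A'$ such that (i) for every instance $x$, $\mathcal A$ computes in time polynomial in $|x|+\kappa(x)$ an instance $y$ of the same problem with $|y|+\kappa(y)\le f(\kappa(x))$ for a computable function $f$; and (ii) given $x$, $y$ and any $s\in\mathrm{Sol}(y)$, $\mathcal A'$ lists without repetition, in time polynomial in $|x|+|y|+\kappa(x)+\kappa(y)$, a nonempty set $S_s\subseteq\mathrm{Sol}(x)$, where the sets $S_s$ for distinct $s\in\mathrm{Sol}(y)$ are pairwise disjoint and $\bigcup_{s\in\mathrm{Sol}(y)}S_s=\mathrm{Sol}(x)$. A *polynomial-delay enumeration kernel* is defined in the same way, except that $\mathcal A'$ lists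 $S_s$ with delay polynomial in $|x|+|y|+\kappa(x)+\kappa(y)$, that is, the times before the first output, between consecutive outputs, and after the last output are bounded in this way. Two vertices $u,v$ of $G$ are true twins if $N_G[u]=N_G[v]$. The true-twin quotient graph $\mathcal G$ of $G$ has the classes of true twins of $G$ as its nodes, two distinct classes being adjacent if and only if the vertices of one are adjacent in $G$ to the vertices of the other. The twin-cover number of $G$ is the minimum size of a set $X\subseteq V(G)$ such that every edge of $G$ has an end-vertex in $X$ or joins two true twins. **Theorem.** Let $\kappa(G)$ be the vertex cover number of the true-twin quotient graph of $G$. Parameterized by $k=\kappa(G)$, Enum Minimal MC admits a fully-polynomial enumeration kernel, and Enum MC and Enum Maximal MC admit polynomial-delay enumeration kernels. In each of these kernels the graph $H$ computed from $G$ has $\mathcal O(k^2)$ vertices, that is, $|V(H)|\le c\,(k^2+1)$ for a constant $c$ independent of $G$. The same statements hold with $\kappa(G)$ the twin-cover number of $G$. -/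

import Mathlib

namespace MCKernel

/-! ## Machine model: structured programs of a random access machine

Programs have finitely many variables and finitely many arrays, all holding natural numbers, with
addition and truncated subtraction (no multiplication) as unit-cost arithmetic and with
indirect addressing. With these instructions unit-cost time is polynomially equivalent
to Turing machine time. -/

/-- Words over the alphabet `{0,1}`. -/
abbrev Word := List Bool

/-- Expressions: constants, variables, array cells `a[e]`, addition, truncated subtraction. -/
inductive Expr where
  | const (c : ℕ)
  | var (i : ℕ)
  | get (a : ℕ) (e : Expr)
  | add (e₁ e₂ : Expr)
  | sub (e₁ e₂ : Expr)

/-- Programs. `write e` appends one bit (`1` iff `e ≠ 0`) to the output buffer, `emit` outputs the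
word in the buffer and clears the buffer; `ite` and `loop` test whether `e ≠ 0`. -/
inductive Prog where
  | skip
  | assign (i : ℕ) (e : Expr)
  | store (a : ℕ) (idx e : Expr)
  | write (e : Expr)
  | emit
  | seq (P Q : Prog)
  | ite (e : Expr) (P Q : Prog)
  | loop (e : Expr) (P : Prog)

/-- Memory contents: the variables, the arrays and the output buffer. -/
structure State where
  var : ℕ → ℕ
  arr : ℕ → ℕ → ℕ
  buf : Word

/-- Value of an expression. -/
def Expr.eval (σ : State) : Expr → ℕ
  | .const c => c
  | .var i => σ.var i
  | .get a e => σ.arr a (e.eval σ)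
  | .add e₁ e₂ => e₁.eval σ + e₂.eval σ
  | .sub e₁ e₂ => e₁.eval σ - e₂.eval σ

/-- The trace of a run has exactly one entry per computation step:
`some w` for a step that outputs the word `w`, and `none` for any other step. -/
abbrev Trace := List (Option Word)

/-- `Exec P σ t τ`: started in the state `σ`, the program `P` terminates in the state `τ`, and its
run has the trace `t`. An elementary instruction and each test of a condition take one step. -/
inductive Exec : Prog → State → Trace → State → Prop
  | skip (σ : State) : Exec .skip σ [none] σ
  | assign (i : ℕ) (e : Expr) (σ : State) :
      Exec (.assign i e) σ [none] { σ with var := Function.update σ.var i (e.eval σ) }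
  | store (a : ℕ) (idx e : Expr) (σ : State) :
      Exec (.store a idx e) σ [none]
        { σ with arr := Function.update σ.arr a
                          (Function.update (σ.arr a) (idx.eval σ) (e.eval σ)) }
  | write (e : Expr) (σ : State) :
      Exec (.write e) σ [none] { σ with buf := σ.buf ++ [decide (e.eval σ ≠ 0)] }
  | emit (σ : State) : Exec .emit σ [some σ.buf] { σ with buf := [] }
  | seq {P Q : Prog} {σ τ ρ : State} {t u : Trace} :
      Exec P σ t τ → Exec Q τ u ρ → Exec (.seq P Q) σ (t ++ u) ρ
  | ite_true {e : Expr} {P Q : Prog} {σ τ : State} {t : Trace} :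
      e.eval σ ≠ 0 → Exec P σ t τ → Exec (.ite e P Q) σ (none :: t) τ
  | ite_false {e : Expr} {P Q : Prog} {σ τ : State} {t : Trace} :
      e.eval σ = 0 → Exec Q σ t τ → Exec (.ite e P Q) σ (none :: t) τ
  | loop_true {e : Expr} {P : Prog} {σ τ ρ : State} {t u : Trace} :
      e.eval σ ≠ 0 → Exec P σ t τ → Exec (.loop e P) τ u ρ →
        Exec (.loop e P) σ (none :: (t ++ u)) ρ
  | loop_false {e : Expr} {P : Prog} {σ : State} :
      e.eval σ = 0 → Exec (.loop e P) σ [none] σ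

/-- Initial state on the input words `ws`: the bits of the `i`-th word stand in array `i` and its
length in variable `i`; everything else is `0`. -/
def initState (ws : List Word) : State where
  var i := (ws.getD i []).length
  arr i j := ((ws.getD i []).getD j false).toNat
  buf := []

/-- On the input words `ws` the program `P` halts after a run with trace `t`. -/
def Run (P : Prog) (ws : List Word) (t : Trace) : Prop :=
  ∃ τ, Exec P (initState ws) t τ

/-- The words output during a run, in order. -/
def outputs (t : Trace) : List Word := t.reduceOption

/-- The run takes at most `d` steps in total. -/
def TimeAtMost (t : Trace) (d : ℕ) : Prop := t.length ≤ d

/-- All delays of the run are at most `d`: every block of consecutive steps without output has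
length at most `d`. This covers the time before the first output, between two consecutive
outputs, and after the last output. -/
def DelayAtMost (t : Trace) (d : ℕ) : Prop :=
  ∀ b : Trace, b <:+: t → (∀ o ∈ b, o = none) → b.length ≤ d

/-! ## Parameterized enumeration problems and enumeration kernels -/

/-- A parameterized enumeration problem: instances, given by words via an injective code,
a finite set of solution words for every instance, and a parameter. -/
structure ParamEnumProblem where
  Inst : Type
  code : Inst → Word
  code_injective : Function.Injective code
  Sol : Inst → Set Word
  finite_sol : ∀ x, (Sol x).Finite
  κ : Inst → ℕ

/-- The input size `|x|`. -/
def ParamEnumProblem.size (Pr : ParamEnumProblem) (x : Pr.Inst) : ℕ := (Pr.code x).length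

/-- `A` is a kernelization algorithm that maps each instance `x` to the instance `g x`: it runs
in time polynomial in `|x| + κ(x)`, and `|g x| + κ(g x) ≤ f(κ(x))` for a computable `f`. -/
structure IsKernelization (Pr : ParamEnumProblem) (A : Prog) (g : Pr.Inst → Pr.Inst) : Prop where
  polynomial_time : ∃ p : Polynomial ℕ, ∀ x, ∃ t : Trace,
    Run A [Pr.code x] t ∧ outputs t = [Pr.code (g x)] ∧
      TimeAtMost t (p.eval (Pr.size x + Pr.κ x))
  bounded : ∃ f : ℕ → ℕ, Computable f ∧ ∀ x, Pr.size (g x) + Pr.κ (g x) ≤ f (Pr.κ x)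

/-- `A'` is a solution-lifting algorithm for `g`. On input `x`, `y = g x` and `s ∈ Sol(y)`
it lists, without repetitions, a nonempty set `S_s`, and the sets `S_s`, for `s ∈ Sol(y)`, form a
partition of `Sol(x)`. `Bound t d` says which resource of the run is bounded by
a polynomial in `|x| + |y| + κ(x) + κ(y)`. -/
def IsLifting (Bound : Trace → ℕ → Prop) (Pr : ParamEnumProblem) (A' : Prog)
    (g : Pr.Inst → Pr.Inst) : Prop :=
  ∃ (q : Polynomial ℕ) (T : Pr.Inst → Word → Trace), ∀ x,
    (∀ s ∈ Pr.Sol (g x),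
      Run A' [Pr.code x, Pr.code (g x), s] (T x s) ∧
      Bound (T x s) (q.eval (Pr.size x + Pr.size (g x) + Pr.κ x + Pr.κ (g x))) ∧
      (outputs (T x s)).Nodup ∧ outputs (T x s) ≠ []) ∧
    (Pr.Sol (g x)).PairwiseDisjoint (fun s => {w | w ∈ outputs (T x s)}) ∧
    (⋃ s ∈ Pr.Sol (g x), {w | w ∈ outputs (T x s)}) = Pr.Sol x

/-- `Pr` has a fully-polynomial enumeration kernel in which the instance computed from `x`
has `measure` at most `b (κ x)`. -/
def HasFullyPolynomialKernel (Pr : ParamEnumProblem) (measure : Pr.Inst → ℕ) (b : ℕ → ℕ) : Prop :=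
  ∃ (A A' : Prog) (g : Pr.Inst → Pr.Inst),
    IsKernelization Pr A g ∧ IsLifting TimeAtMost Pr A' g ∧ ∀ x, measure (g x) ≤ b (Pr.κ x)

/-- `Pr` has a polynomial-delay enumeration kernel in which the instance computed from `x`
has `measure` at most `b (κ x)`. -/
def HasPolynomialDelayKernel (Pr : ParamEnumProblem) (measure : Pr.Inst → ℕ) (b : ℕ → ℕ) : Prop :=
  ∃ (A A' : Prog) (g : Pr.Inst → Pr.Inst),
    IsKernelization Pr A g ∧ IsLifting DelayAtMost Pr A' g ∧ ∀ x, measure (g x) ≤ b (Pr.κ x)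

/-! ## Matching cuts -/

/-- `M` is a matching cut of `G`: `M = E(A,B)` for a partition of the vertex set into two
nonempty parts `A` and `B = Aᶜ`, and no two distinct edges of `M` share an end-vertex. -/
def IsMatchingCut {V : Type*} (G : SimpleGraph V) (M : Set (Sym2 V)) : Prop :=
  (∃ A : Set V, A.Nonempty ∧ Aᶜ.Nonempty ∧
    M = {e | ∃ a ∈ A, ∃ b ∈ Aᶜ, G.Adj a b ∧ e = s(a, b)}) ∧
  ∀ e ∈ M, ∀ e' ∈ M, ∀ v : V, v ∈ e → v ∈ e' → e = e'

/-- Finite simple graphs; the vertices are numbered `0, …, n - 1`. -/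
structure FinGraph where
  n : ℕ
  graph : SimpleGraph (Fin n)

open Classical in
/-- The `n × n` matrix of a relation, row by row, as a word of length `n * n`. -/
noncomputable def matrixWord {n : ℕ} (R : Fin n → Fin n → Prop) : Word :=
  List.ofFn fun t : Fin (n * n) => decide (R t.divNat t.modNat)

/-- A graph is encoded by its adjacency matrix. -/
noncomputable def FinGraph.code (G : FinGraph) : Word := matrixWord G.graph.Adj

/-- A set of edges is encoded by the adjacency matrix of the graph that it forms. -/
noncomputable def edgesCode {n : ℕ} (M : Set (Sym2 (Fin n))) : Word :=
  matrixWord fun i j => s(i, j) ∈ M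

theorem length_matrixWord {n : ℕ} (R : Fin n → Fin n → Prop) :
    (matrixWord R).length = n * n := by
  simp [matrixWord]

theorem matrixWord_injective {n : ℕ} {R S : Fin n → Fin n → Prop}
    (h : matrixWord R = matrixWord S) : R = S := by
  have h' := List.ofFn_injective h
  funext i j
  have hij := congrFun h' (finProdFinEquiv (i, j))
  have h1 : (finProdFinEquiv (i, j)).divNat = i :=
    congrArg Prod.fst (finProdFinEquiv.symm_apply_apply (i, j))
  have h2 : (finProdFinEquiv (i, j)).modNat = j :=
    congrArg Prod.snd (finProdFinEquiv.symm_apply_apply (i, j))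
  rw [h1, h2] at hij
  simpa using hij

theorem FinGraph.code_injective : Function.Injective FinGraph.code := by
  rintro ⟨n, G⟩ ⟨m, H⟩ h
  have hl := congrArg List.length h
  simp only [FinGraph.code, length_matrixWord] at hl
  obtain rfl : n = m := Nat.mul_self_inj.mp hl
  have hA := matrixWord_injective h
  obtain rfl : G = H := SimpleGraph.ext hA
  rfl

/-- The problem of enumerating the edge sets `M` of a graph `G` with property `P G M`, where the
input is the graph, parameterized by `κ`. -/
noncomputable def enumEdgeSets
    (P : (G : FinGraph) → Set (Sym2 (Fin G.n)) → Prop) (κ : FinGraph → ℕ) :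
    ParamEnumProblem where
  Inst := FinGraph
  code := FinGraph.code
  code_injective := FinGraph.code_injective
  Sol G := edgesCode '' {M | P G M}
  finite_sol _ := Set.toFinite _
  κ := κ

/-- Enumeration of all matching cuts. -/
noncomputable def enumMC (κ : FinGraph → ℕ) : ParamEnumProblem :=
  enumEdgeSets (fun G M => IsMatchingCut G.graph M) κ

/-- Enumeration of all inclusion-minimal matching cuts. -/
noncomputable def enumMinimalMC (κ : FinGraph → ℕ) : ParamEnumProblem :=
  enumEdgeSets (fun G M => Minimal (IsMatchingCut G.graph) M) κ

/-- Enumeration of all inclusion-maximal matching cuts. -/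
noncomputable def enumMaximalMC (κ : FinGraph → ℕ) : ParamEnumProblem :=
  enumEdgeSets (fun G M => Maximal (IsMatchingCut G.graph) M) κ

/-! ## The parameters -/

/-- `u` and `v` are true twins (or equal): `N[u] = N[v]`. -/
def TrueTwins {V : Type*} (G : SimpleGraph V) (u v : V) : Prop :=
  insert u (G.neighborSet u) = insert v (G.neighborSet v)

/-- The partition of the vertex set into the classes of true twins. -/
def trueTwinSetoid {V : Type*} (G : SimpleGraph V) : Setoid V where
  r := TrueTwins G
  iseqv := ⟨fun _ => rfl, fun h => Eq.symm h, fun h h' => Eq.trans h h'⟩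

/-- The true-twin quotient graph: its nodes are the classes of true twins, and two distinct classes
are adjacent iff the vertices of the one are adjacent to the vertices of the other. -/
def trueTwinQuotient {V : Type*} (G : SimpleGraph V) :
    SimpleGraph (Quotient (trueTwinSetoid G)) where
  Adj X Y := X ≠ Y ∧ ∀ u v : V, Quotient.mk _ u = X → Quotient.mk _ v = Y → G.Adj u v
  symm := ⟨fun _ _ h => ⟨h.1.symm, fun u v hu hv => (h.2 v u hv hu).symm⟩⟩
  loopless := ⟨fun _ h => h.1 rfl⟩

/-- The vertex cover number of the true-twin quotient graph. -/
noncomputable def quotientVertexCoverNum (G : FinGraph) : ℕ :=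
  (trueTwinQuotient G.graph).vertexCoverNum.toNat

/-- `X` is a twin-cover: each edge has an end-vertex in `X` or joins true twins. -/
def IsTwinCover {V : Type*} (G : SimpleGraph V) (X : Finset V) : Prop :=
  ∀ u v : V, G.Adj u v → u ∈ X ∨ v ∈ X ∨ TrueTwins G u v

/-- The twin-cover number: the minimum size of a twin-cover. -/
noncomputable def twinCoverNum (G : FinGraph) : ℕ :=
  sInf {k | ∃ X : Finset (Fin G.n), IsTwinCover G.graph X ∧ X.card = k}

end MCKernel

/-! A matching cut leaves every triangle on one side. The same holds for two vertices with three
common neighbors: if they were separated, each common neighbor would send a cut edge to one of the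
two, and two of these edges would meet. Hence some vertices can be deleted without any change to the
matching cuts as sets of edges (`mc_delete`): a vertex with three further true twins (`crowded_mc`),
and the whole twin class of a vertex of degree at least two that has neighbors outside the class,
any two of them with three common neighbors outside the class (`forced_mc`). Processing the vertices
one by one gives `pruned`.

What may still be numerous are leaves and complete components. The `core` keeps the smallest leaf at
each vertex and at most two complete components. A leaf can be put on either side of a cut at will,
so a matching is a cut as soon as its free edges, those not at hung leaves, are the free edges of
some cut (`cm_iff_free`). Moving each leaf edge to the surviving leaf at the same vertex (`proj`)
therefore maps solutions to solutions of the core. The fiber over a solution `N` is a product of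
independent choices: which leaf to use at a vertex where `N` uses one, and which deleted two-vertex
components to cut (any of them for all cuts, none for minimal, every one for maximal cuts); see
`Sol.proj`, `Lifts.sol`, `lifts_build`, `Lifts.exists_build`. Such a product is listed with
polynomial delay in lexicographic order (`enumeration_loop`). A minimal `N` containing a leaf edge
consists of that edge alone, so at most one vertex offers a choice, and the whole fiber is listed in
polynomial time.

For the size (`card_core_le`), let `Y` be a vertex cover of the quotient with `k` classes. At most
three vertices of each class survive. So there are at most `3k` vertices in cover classes, at most
`6` others in complete components, and at most `3k` further leaves, one for each vertex in a cover
class. Any other vertex `v` was not forced, so two of its neighbors in cover classes lack three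
common neighbors that are not twins of `v`; at most five vertices are charged to the same pair of
classes. A twin-cover projects to a vertex cover of the quotient, so the same kernel serves both
parameters.

The vertex sets and options are defined by first-order formulas over the vertices. Such formulas
compile to nested loops over the numbers below `n` (`Fm.comp_sat`), whose running time is polynomial
(`BProg.runs`). -/

namespace MCKernel

/-! ## Bounded programs

Programs whose only loops are `for` loops with the bound stored in variable `3`. -/

/-- Assignment of a value to a variable. -/
def State.setv (σ : State) (i v : ℕ) : State := { σ with var := Function.update σ.var i v }

/-- Assignment of a value to an array cell. -/
def State.seta (σ : State) (a i v : ℕ) : State :=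
  { σ with arr := Function.update σ.arr a (Function.update (σ.arr a) i v) }

@[simp] theorem State.setv_arr (σ : State) (i v : ℕ) : (σ.setv i v).arr = σ.arr := rfl
@[simp] theorem State.setv_buf (σ : State) (i v : ℕ) : (σ.setv i v).buf = σ.buf := rfl
@[simp] theorem State.setv_self (σ : State) (i v : ℕ) : (σ.setv i v).var i = v := by
  simp [State.setv]
theorem State.setv_var (σ : State) (i v j : ℕ) :
    (σ.setv i v).var j = if j = i then v else σ.var j := by
  simp [State.setv, Function.update_apply]
theorem State.setv_ne (σ : State) {i j : ℕ} (v : ℕ) (h : j ≠ i) :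
    (σ.setv i v).var j = σ.var j := by
  simp [State.setv_var, h]
@[simp] theorem State.seta_var (σ : State) (a i v : ℕ) : (σ.seta a i v).var = σ.var := rfl
@[simp] theorem State.seta_buf (σ : State) (a i v : ℕ) : (σ.seta a i v).buf = σ.buf := rfl
theorem State.seta_arr (σ : State) (a i v b j : ℕ) :
    (σ.seta a i v).arr b j = if b = a ∧ j = i then v else σ.arr b j := by
  by_cases hb : b = a
  · subst hb
    simp [State.seta, Function.update_apply]
  · simp [State.seta, hb]
theorem State.seta_arr_ne (σ : State) {a b : ℕ} (i v : ℕ) (h : b ≠ a) :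
    (σ.seta a i v).arr b = σ.arr b := by
  simp [State.seta, h]

/-- Programs with `for` loops: `iter i P` runs `P` with the variable `i` ranging over the
numbers below variable `3`. -/
inductive BProg where
  | skip
  | assign (i : ℕ) (e : Expr)
  | store (a : ℕ) (idx e : Expr)
  | write (e : Expr)
  | seq (P Q : BProg)
  | ite (e : Expr) (P Q : BProg)
  | iter (i : ℕ) (P : BProg)

/-- Translation into programs of the machine. -/
def BProg.toProg : BProg → Prog
  | .skip => .skip
  | .assign i e => .assign i e
  | .store a idx e => .store a idx e
  | .write e => .write e
  | .seq P Q => .seq P.toProg Q.toProg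
  | .ite e P Q => .ite e P.toProg Q.toProg
  | .iter i P => .seq (.assign i (.const 0))
      (.loop (.sub (.var 3) (.var i)) (.seq P.toProg (.assign i (.add (.var i) (.const 1)))))

/-- The state after `k` rounds of a `for` loop. -/
def loopRun (f : State → State) (i : ℕ) : ℕ → State → State
  | 0, σ => σ.setv i 0
  | k + 1, σ => (f (loopRun f i k σ)).setv i (k + 1)

/-- Choice between two states according to a test. -/
def branch : ℕ → State → State → State
  | 0, _, τ => τ
  | _ + 1, σ, _ => σ

theorem branch_eq (c : ℕ) (σ τ : State) : branch c σ τ = if c = 0 then τ else σ := by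
  cases c <;> simp [branch]

/-- The final state of a bounded program. -/
def BProg.run : BProg → State → State
  | .skip, σ => σ
  | .assign i e, σ => σ.setv i (e.eval σ)
  | .store a idx e, σ => σ.seta a (idx.eval σ) (e.eval σ)
  | .write e, σ => { σ with buf := σ.buf ++ [decide (e.eval σ ≠ 0)] }
  | .seq P Q, σ => Q.run (P.run σ)
  | .ite e P Q, σ => branch (e.eval σ) (P.run σ) (Q.run σ)
  | .iter i P, σ => loopRun P.run i (σ.var 3) σ

/-- Does the program assign the variable `j`? -/
def BProg.sets : BProg → ℕ → Bool
  | .skip, _ => false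
  | .assign i _, j => i == j
  | .store _ _ _, _ => false
  | .write _, _ => false
  | .seq P Q, j => P.sets j || Q.sets j
  | .ite _ P Q, j => P.sets j || Q.sets j
  | .iter i P, j => i == j || P.sets j

/-- No loop body assigns the loop variable or the loop bound. -/
def BProg.wf : BProg → Bool
  | .seq P Q => P.wf && Q.wf
  | .ite _ P Q => P.wf && Q.wf
  | .iter i P => P.wf && !P.sets i && !P.sets 3 && !(i == 3)
  | _ => true

open Polynomial in
/-- A polynomial bound on the running time in terms of the loop bound. -/
noncomputable def BProg.cost : BProg → Polynomial ℕ
  | .seq P Q => P.cost + Q.cost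
  | .ite _ P Q => P.cost + Q.cost + 1
  | .iter _ P => X * (P.cost + 2) + 2
  | _ => 1

theorem loopRun_var {f : State → State} {i j : ℕ} (hij : i ≠ j)
    (hf : ∀ σ, (f σ).var j = σ.var j) (k : ℕ) (σ : State) :
    (loopRun f i k σ).var j = σ.var j := by
  induction k with
  | zero => exact σ.setv_ne _ hij.symm
  | succ k ih => rw [loopRun, State.setv_ne _ _ hij.symm, hf, ih]

theorem loopRun_self (f : State → State) (i k : ℕ) (σ : State) :
    (loopRun f i k σ).var i = k := by
  cases k <;> simp [loopRun]

theorem BProg.run_var (P : BProg) {j : ℕ} (h : P.sets j = false) (σ : State) :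
    (P.run σ).var j = σ.var j := by
  induction P generalizing σ with
  | skip => rfl
  | assign i e =>
    have : i ≠ j := by simpa [BProg.sets] using h
    exact σ.setv_ne _ this.symm
  | store a idx e => rfl
  | write e => rfl
  | seq P Q ihP ihQ =>
    simp only [BProg.sets, Bool.or_eq_false_iff] at h
    rw [BProg.run, ihQ h.2, ihP h.1]
  | ite e P Q ihP ihQ =>
    simp only [BProg.sets, Bool.or_eq_false_iff] at h
    rw [BProg.run, branch_eq]
    split
    · exact ihQ h.2 σ
    · exact ihP h.1 σ
  | iter i P ih =>
    simp only [BProg.sets, Bool.or_eq_false_iff, beq_eq_false_iff_ne] at h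
    exact loopRun_var h.1 (ih h.2) _ _

/-! ### Silent runs with a bound on the number of steps -/

/-- A trace without output. -/
def Silent (t : Trace) : Prop := ∀ o ∈ t, o = none

/-- `P` runs silently from `σ` to `τ` within `d` steps. -/
def Runs (P : Prog) (σ τ : State) (d : ℕ) : Prop :=
  ∃ t, Exec P σ t τ ∧ Silent t ∧ t.length ≤ d

theorem Runs.mono {P : Prog} {σ τ : State} {d d' : ℕ} (h : Runs P σ τ d) (hd : d ≤ d') :
    Runs P σ τ d' := by
  obtain ⟨t, h1, h2, h3⟩ := h
  exact ⟨t, h1, h2, h3.trans hd⟩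

theorem Runs.seq {P Q : Prog} {σ τ ρ : State} {d d' : ℕ} (h : Runs P σ τ d)
    (h' : Runs Q τ ρ d') : Runs (.seq P Q) σ ρ (d + d') := by
  obtain ⟨t, h1, h2, h3⟩ := h
  obtain ⟨u, h4, h5, h6⟩ := h'
  refine ⟨t ++ u, .seq h1 h4, fun o ho => ?_, by simp; omega⟩
  rcases List.mem_append.1 ho with ho | ho
  exacts [h2 o ho, h5 o ho]

theorem Runs.assign (i : ℕ) (e : Expr) (σ : State) :
    Runs (.assign i e) σ (σ.setv i (e.eval σ)) 1 :=
  ⟨_, .assign i e σ, by simp [Silent], by simp⟩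

theorem Runs.loop_false {e : Expr} {P : Prog} {σ : State} (h : e.eval σ = 0) :
    Runs (.loop e P) σ σ 1 :=
  ⟨_, .loop_false h, by simp [Silent], by simp⟩

theorem Runs.loop_true {e : Expr} {P : Prog} {σ τ ρ : State} {d d' : ℕ} (he : e.eval σ ≠ 0)
    (h : Runs P σ τ d) (h' : Runs (.loop e P) τ ρ d') : Runs (.loop e P) σ ρ (d + d' + 1) := by
  obtain ⟨t, h1, h2, h3⟩ := h
  obtain ⟨u, h4, h5, h6⟩ := h'
  refine ⟨none :: (t ++ u), .loop_true he h1 h4, fun o ho => ?_, by simp; omega⟩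
  rcases List.mem_cons.1 ho with ho | ho
  · exact ho
  rcases List.mem_append.1 ho with ho | ho
  exacts [h2 o ho, h5 o ho]

theorem Runs.ite {e : Expr} {P Q : Prog} {σ τ : State} {d : ℕ}
    (h : Runs (if e.eval σ = 0 then Q else P) σ τ d) : Runs (.ite e P Q) σ τ (d + 1) := by
  obtain ⟨t, h1, h2, h3⟩ := h
  refine ⟨none :: t, ?_, by simpa [Silent] using h2, by simpa using h3⟩
  split_ifs at h1 with he
  · exact .ite_false he h1
  · exact .ite_true he h1

/-- No loop body touches its counter or variable `3`, so each loop makes exactly `σ.var 3` rounds,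
and all cost polynomials may be evaluated at the same initial bound. -/
theorem BProg.runs (P : BProg) (hwf : P.wf = true) (h3 : P.sets 3 = false) (σ : State) :
    Runs P.toProg σ (P.run σ) (P.cost.eval (σ.var 3)) := by
  induction P generalizing σ with
  | skip => exact ⟨_, .skip σ, by simp [Silent], by simp [BProg.cost]⟩
  | assign i e => exact (Runs.assign i e σ).mono (by simp [BProg.cost])
  | store a idx e => exact ⟨_, .store a idx e σ, by simp [Silent], by simp [BProg.cost]⟩
  | write e => exact ⟨_, .write e σ, by simp [Silent], by simp [BProg.cost]⟩
  | seq P Q ihP ihQ =>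
    simp only [BProg.sets, Bool.or_eq_false_iff] at h3
    simp only [BProg.wf, Bool.and_eq_true] at hwf
    have h1 := ihP hwf.1 h3.1 σ
    have h2 := ihQ hwf.2 h3.2 (P.run σ)
    rw [P.run_var h3.1] at h2
    simpa [BProg.cost, BProg.toProg, BProg.run] using h1.seq h2
  | ite e P Q ihP ihQ =>
    simp only [BProg.sets, Bool.or_eq_false_iff] at h3
    simp only [BProg.wf, Bool.and_eq_true] at hwf
    have h1 := ihP hwf.1 h3.1 σ
    have h2 := ihQ hwf.2 h3.2 σ
    simp only [BProg.cost, Polynomial.eval_add, Polynomial.eval_one, BProg.run, branch_eq]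
    refine Runs.ite ?_
    split_ifs
    · exact h2.mono (by omega)
    · exact h1.mono (by omega)
  | iter i P ih =>
    simp only [BProg.wf, Bool.and_eq_true, Bool.not_eq_true', beq_eq_false_iff_ne] at hwf
    obtain ⟨⟨⟨hP, hi⟩, hP3⟩, hi3⟩ := hwf
    set n := σ.var 3 with hn
    have hv3 : ∀ k, (loopRun P.run i k σ).var 3 = n :=
      fun k => loopRun_var hi3 (P.run_var hP3) k σ
    -- Induction on the number `j` of rounds still to come; a round costs its body, one assignment
    -- and one test.
    have key : ∀ j k, j + k = n →
        Runs (.loop (.sub (.var 3) (.var i))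
          (.seq P.toProg (.assign i (.add (.var i) (.const 1)))))
          (loopRun P.run i k σ) (loopRun P.run i n σ) (j * (P.cost.eval n + 2) + 1) := by
      intro j
      induction j with
      | zero =>
        intro k hk
        obtain rfl : k = n := by omega
        simpa using Runs.loop_false (by simp [Expr.eval, hv3, loopRun_self])
      | succ j ihj =>
        intro k hk
        have h1 := ih hP hP3 (loopRun P.run i k σ)
        rw [hv3] at h1
        have h2 := h1.seq (Runs.assign i (.add (.var i) (.const 1)) _)
        have h4 : (Expr.add (.var i) (.const 1)).eval (P.run (loopRun P.run i k σ)) = k + 1 := by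
          simp [Expr.eval, P.run_var hi, loopRun_self]
        rw [h4] at h2
        have h5 := ihj (k + 1) (by omega)
        refine (Runs.loop_true ?_ h2 h5).mono (by ring_nf; omega)
        simp [Expr.eval, hv3, loopRun_self]; omega
    have := (Runs.assign i (.const 0) σ).seq (key n 0 (by omega))
    simp only [BProg.toProg, BProg.run, BProg.cost]
    refine this.mono ?_
    simp; omega

/-- The invariant is required after the counter has been advanced, since the counter is itself part
of the state. -/
theorem loopRun_induction {f : State → State} {i : ℕ} {σ : State} (Inv : ℕ → State → Prop)
    (h0 : Inv 0 (σ.setv i 0)) (n : ℕ)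
    (hs : ∀ k ρ, k < n → ρ.var i = k → Inv k ρ → Inv (k + 1) ((f ρ).setv i (k + 1))) :
    Inv n (loopRun f i n σ) := by
  suffices ∀ k ≤ n, Inv k (loopRun f i k σ) from this n le_rfl
  intro k
  induction k with
  | zero => intro; exact h0
  | succ k ih => intro hk; exact hs k _ (by omega) (loopRun_self ..) (ih (by omega))

/-! ## Bounded first-order formulas -/

/-- First-order formulas; the quantifiers range over the numbers below variable `3`. -/
inductive Fm where
  | atom (e : Expr)
  | not (φ : Fm)
  | and (φ ψ : Fm)
  | or (φ ψ : Fm)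
  | ex (i : ℕ) (φ : Fm)

/-- Truth of a formula. -/
def Fm.sat : Fm → State → Prop
  | .atom e, σ => e.eval σ ≠ 0
  | .not φ, σ => ¬ φ.sat σ
  | .and φ ψ, σ => φ.sat σ ∧ ψ.sat σ
  | .or φ ψ, σ => φ.sat σ ∨ ψ.sat σ
  | .ex i φ, σ => ∃ k < σ.var 3, φ.sat (σ.setv i k)

/-- The variables of the expression are in `l`, and its arrays satisfy `ok`. -/
def Expr.wf (ok : ℕ → Bool) (l : List ℕ) : Expr → Bool
  | .const _ => true
  | .var i => l.contains i
  | .get a e => ok a && e.wf ok l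
  | .add e f => e.wf ok l && f.wf ok l
  | .sub e f => e.wf ok l && f.wf ok l

/-- The free variables of the formula are in `l`, its bound variables are at least `d`, with nested
quantifiers using increasing variables, and its arrays satisfy `ok`. -/
def Fm.wf (ok : ℕ → Bool) : List ℕ → ℕ → Fm → Bool
  | l, _, .atom e => e.wf ok l
  | l, d, .not φ => φ.wf ok l d
  | l, d, .and φ ψ => φ.wf ok l d && ψ.wf ok l d
  | l, d, .or φ ψ => φ.wf ok l d && ψ.wf ok l d
  | l, d, .ex i φ => Nat.ble d i && φ.wf ok (i :: l) (i + 2)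

/-- Evaluation of a formula, with result in variable `4`; for an existential quantifier the
result is the successor of the least witness. -/
def Fm.comp : Fm → BProg
  | .atom e => .assign 4 e
  | .not φ => .seq φ.comp (.assign 4 (.sub (.const 1) (.var 4)))
  | .and φ ψ => .seq φ.comp (.ite (.var 4) ψ.comp .skip)
  | .or φ ψ => .seq φ.comp (.ite (.var 4) .skip ψ.comp)
  | .ex i φ => .seq (.assign (i + 1) (.const 0))
      (.seq (.iter i (.seq φ.comp (.ite (.var 4)
          (.ite (.var (i + 1)) .skip (.assign (i + 1) (.add (.var i) (.const 1)))) .skip)))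
        (.assign 4 (.var (i + 1))))

/-- The states agree up to variable `4` and the variables from `d` on. -/
structure Agree (d : ℕ) (σ τ : State) : Prop where
  var : ∀ i < d, i ≠ 4 → τ.var i = σ.var i
  arr : τ.arr = σ.arr
  buf : τ.buf = σ.buf

theorem Expr.eval_congr {ok : ℕ → Bool} {l : List ℕ} {e : Expr} (h : e.wf ok l = true)
    {σ τ : State} (hv : ∀ i ∈ l, τ.var i = σ.var i)
    (ha : ∀ a, ok a = true → τ.arr a = σ.arr a) : e.eval τ = e.eval σ := by
  induction e with
  | const c => rfl
  | var i => exact hv i (by simpa [Expr.wf] using h)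
  | get a e ih =>
    simp only [Expr.wf, Bool.and_eq_true] at h
    simp only [Expr.eval, ih h.2, ha a h.1]
  | add e f ihe ihf =>
    simp only [Expr.wf, Bool.and_eq_true] at h
    simp only [Expr.eval, ihe h.1, ihf h.2]
  | sub e f ihe ihf =>
    simp only [Expr.wf, Bool.and_eq_true] at h
    simp only [Expr.eval, ihe h.1, ihf h.2]

/-- Lets a formula keep its truth value across code that changes only scratch variables or arrays
that the formula does not read. -/
theorem Fm.sat_congr {ok : ℕ → Bool} {l : List ℕ} {d : ℕ} {φ : Fm} (h : φ.wf ok l d = true)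
    {σ τ : State} (h3 : τ.var 3 = σ.var 3) (hv : ∀ i ∈ l, τ.var i = σ.var i)
    (ha : ∀ a, ok a = true → τ.arr a = σ.arr a) : φ.sat τ ↔ φ.sat σ := by
  induction φ generalizing l d σ τ with
  | atom e => simp only [Fm.sat, Expr.eval_congr h hv ha]
  | not φ ih => simp only [Fm.sat, ih h h3 hv ha]
  | and φ ψ ih1 ih2 =>
    simp only [Fm.wf, Bool.and_eq_true] at h
    simp only [Fm.sat, ih1 h.1 h3 hv ha, ih2 h.2 h3 hv ha]
  | or φ ψ ih1 ih2 =>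
    simp only [Fm.wf, Bool.and_eq_true] at h
    simp only [Fm.sat, ih1 h.1 h3 hv ha, ih2 h.2 h3 hv ha]
  | ex i φ ih =>
    simp only [Fm.wf, Bool.and_eq_true] at h
    simp only [Fm.sat, h3]
    refine exists_congr fun k => and_congr_right fun _ => ?_
    refine ih h.2 ?_ (fun j hj => ?_) ha
    · simp only [State.setv_var, h3]
    · simp only [State.setv_var]
      split_ifs with hji
      · rfl
      · exact hv j ((List.mem_cons.1 hj).resolve_left hji)

theorem Fm.comp_sets (φ : Fm) {ok : ℕ → Bool} {l : List ℕ} {d : ℕ} (h : φ.wf ok l d = true)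
    {j : ℕ} (hj : j < d) (h4 : j ≠ 4) : φ.comp.sets j = false := by
  induction φ generalizing l d with
  | atom e => simp [Fm.comp, BProg.sets, h4.symm]
  | not φ ih => simp [Fm.comp, BProg.sets, h4.symm, ih h hj]
  | and φ ψ ih1 ih2 =>
    simp only [Fm.wf, Bool.and_eq_true] at h
    simp [Fm.comp, BProg.sets, ih1 h.1 hj, ih2 h.2 hj]
  | or φ ψ ih1 ih2 =>
    simp only [Fm.wf, Bool.and_eq_true] at h
    simp [Fm.comp, BProg.sets, ih1 h.1 hj, ih2 h.2 hj]
  | ex i φ ih =>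
    simp only [Fm.wf, Bool.and_eq_true, Nat.ble_eq] at h
    have := ih h.2 (by omega)
    simp [Fm.comp, BProg.sets, h4.symm, this]
    omega

/-- Evaluation writes only to variable `4` and to the variables reserved for the quantifiers, so
formulas can be evaluated inside larger programs. -/
theorem Fm.comp_agree (φ : Fm) {ok : ℕ → Bool} {l : List ℕ} {d : ℕ} (h : φ.wf ok l d = true)
    (σ : State) : Agree d σ (φ.comp.run σ) := by
  refine ⟨fun i hi h4 => φ.comp.run_var (φ.comp_sets h hi h4) σ, ?_, ?_⟩
  · clear h
    induction φ generalizing σ with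
    | atom e => rfl
    | not φ ih => exact ih σ
    | and φ ψ ih1 ih2 =>
      simp only [Fm.comp, BProg.run, branch_eq]
      split_ifs <;> simp [ih1, ih2]
    | or φ ψ ih1 ih2 =>
      simp only [Fm.comp, BProg.run, branch_eq]
      split_ifs <;> simp [ih1, ih2]
    | ex i φ ih =>
      simp only [Fm.comp, BProg.run, branch_eq, State.setv_arr]
      refine loopRun_induction (σ := σ.setv (i + 1) 0) (fun _ ρ => ρ.arr = σ.arr) rfl _
        fun k ρ _ _ hρ => ?_
      split_ifs <;> simp [ih, hρ]
  · clear h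
    induction φ generalizing σ with
    | atom e => rfl
    | not φ ih => exact ih σ
    | and φ ψ ih1 ih2 =>
      simp only [Fm.comp, BProg.run, branch_eq]
      split_ifs <;> simp [ih1, ih2]
    | or φ ψ ih1 ih2 =>
      simp only [Fm.comp, BProg.run, branch_eq]
      split_ifs <;> simp [ih1, ih2]
    | ex i φ ih =>
      simp only [Fm.comp, BProg.run, branch_eq, State.setv_buf]
      refine loopRun_induction (σ := σ.setv (i + 1) 0) (fun _ ρ => ρ.buf = σ.buf) rfl _
        fun k ρ _ _ hρ => ?_
      split_ifs <;> simp [ih, hρ]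

/-- `r` is the successor of the least number below `n` with property `p`, or `0` if there is no such
number. -/
def IsSearch (p : ℕ → Prop) (n r : ℕ) : Prop :=
  (r = 0 ∧ ∀ k < n, ¬ p k) ∨ ∃ k < n, r = k + 1 ∧ p k ∧ ∀ j < k, ¬ p j

theorem IsSearch.ne_zero_iff {p : ℕ → Prop} {n r : ℕ} (h : IsSearch p n r) :
    r ≠ 0 ↔ ∃ k < n, p k := by
  rcases h with ⟨rfl, h⟩ | ⟨k, hk, rfl, hp, -⟩
  · simpa using h
  · simpa using ⟨k, hk, hp⟩

/-- Correctness of the body is a hypothesis, so that the lemma serves both inside the induction of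
`Fm.comp_sat` and afterwards in `Fm.comp_search`. The witness is the least one because variable `i +
1` is written only while it is zero. -/
theorem Fm.ex_search {φ : Fm} {ok : ℕ → Bool} {l : List ℕ} {d i : ℕ}
    (h : (Fm.ex i φ).wf ok l d = true) (hd : 5 ≤ d) (hl : ∀ i ∈ l, i < d ∧ i ≠ 4)
    (hφ : ∀ σ, (φ.comp.run σ).var 4 ≠ 0 ↔ φ.sat σ) (σ : State) :
    IsSearch (fun k => φ.sat (σ.setv i k)) (σ.var 3) (((Fm.ex i φ).comp.run σ).var 4) := by
  simp only [Fm.wf, Bool.and_eq_true, Nat.ble_eq] at h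
  simp only [Fm.comp, BProg.run, Expr.eval, State.setv_self]
  have e3 : (σ.setv (i + 1) 0).var 3 = σ.var 3 := σ.setv_ne _ (by omega)
  rw [e3]
  refine (loopRun_induction (fun k ρ => ρ.arr = σ.arr ∧ (∀ j < i, j ≠ 4 → ρ.var j = σ.var j) ∧
    IsSearch (fun k => φ.sat (σ.setv i k)) k (ρ.var (i + 1))) ?_ _ ?_).2.2
  · refine ⟨rfl, fun j hj _ => ?_, ?_⟩
    · rw [State.setv_ne _ _ (by omega), State.setv_ne _ _ (by omega)]
    · rw [State.setv_ne _ _ (by omega), State.setv_self]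
      exact Or.inl ⟨rfl, by omega⟩
  rintro k ρ hk hρi ⟨ha, hv, hs⟩
  have hag := φ.comp_agree h.2 ρ
  have hsat : φ.sat ρ ↔ φ.sat (σ.setv i k) := by
    refine Fm.sat_congr h.2 ?_ (fun j hj => ?_) (fun a _ => congrFun ha a)
    · rw [State.setv_ne _ _ (by omega)]
      exact hv 3 (by omega) (by omega)
    · rw [State.setv_var]
      split_ifs with hji
      · rw [hji, hρi]
      · have := hl j ((List.mem_cons.1 hj).resolve_left hji)
        exact hv j (by omega) this.2
  have hi := hag.var i (by omega) (by omega)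
  have hi1 := hag.var (i + 1) (by omega) (by omega)
  have hR := (hφ ρ).trans hsat
  rw [branch_eq, branch_eq]
  split_ifs with h1 h2
  · refine ⟨by simp [hag.arr, ha], fun j hj h4 => ?_, ?_⟩
    · rw [State.setv_ne _ _ (by omega), hag.var j (by omega) h4, hv j hj h4]
    · rw [State.setv_ne _ _ (by omega), hi1]
      rcases hs with ⟨hs, hs'⟩ | ⟨m, hm, hs, hs'⟩
      · refine Or.inl ⟨hs, fun j hj => ?_⟩
        rcases Nat.lt_succ_iff_lt_or_eq.1 hj with hj | rfl
        · exact hs' j hj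
        · exact fun hc => hR.2 hc h1
      · exact Or.inr ⟨m, by omega, hs, hs'⟩
  · refine ⟨by simp [hag.arr, ha], fun j hj h4 => ?_, ?_⟩
    · rw [State.setv_ne _ _ (by omega), State.setv_ne _ _ (by omega), hag.var j (by omega) h4,
        hv j hj h4]
    · rw [State.setv_ne _ _ (by omega), State.setv_self, hi, hρi]
      rcases hs with ⟨hs, hs'⟩ | ⟨m, hm, hs, hs'⟩
      · exact Or.inr ⟨k, by omega, rfl, hR.1 h1, hs'⟩
      · rw [hi1, hs] at h2
        omega
  · refine ⟨by simp [hag.arr, ha], fun j hj h4 => ?_, ?_⟩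
    · rw [State.setv_ne _ _ (by omega), hag.var j (by omega) h4, hv j hj h4]
    · rw [State.setv_ne _ _ (by omega), hi1]
      rcases hs with ⟨hs, -⟩ | ⟨m, hm, hs, hs'⟩
      · exact absurd (hi1.trans hs) h2
      · exact Or.inr ⟨m, by omega, hs, hs'⟩

theorem Fm.comp_sat (φ : Fm) {ok : ℕ → Bool} {l : List ℕ} {d : ℕ} (h : φ.wf ok l d = true)
    (hd : 5 ≤ d) (hl : ∀ i ∈ l, i < d ∧ i ≠ 4) (σ : State) :
    (φ.comp.run σ).var 4 ≠ 0 ↔ φ.sat σ := by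
  induction φ generalizing l d σ with
  | atom e => simp [Fm.comp, BProg.run, Fm.sat]
  | not φ ih =>
    have := ih h hd hl σ
    simp only [Fm.comp, BProg.run, Fm.sat, State.setv_self, Expr.eval, ← this]
    omega
  | and φ ψ ih1 ih2 =>
    simp only [Fm.wf, Bool.and_eq_true] at h
    have h1 := ih1 h.1 hd hl σ
    have hag := φ.comp_agree h.1 σ
    have h2 : ψ.sat (φ.comp.run σ) ↔ ψ.sat σ :=
      Fm.sat_congr h.2 (hag.var 3 (by omega) (by omega))
        (fun i hi => hag.var i (hl i hi).1 (hl i hi).2) (fun a _ => congrFun hag.arr a)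
    simp only [Fm.comp, BProg.run, Fm.sat, Expr.eval, ← h1]
    rw [branch_eq]
    split_ifs with hc
    · simp [hc]
    · simp [hc, ih2 h.2 hd hl, h2]
  | or φ ψ ih1 ih2 =>
    simp only [Fm.wf, Bool.and_eq_true] at h
    have h1 := ih1 h.1 hd hl σ
    have hag := φ.comp_agree h.1 σ
    have h2 : ψ.sat (φ.comp.run σ) ↔ ψ.sat σ :=
      Fm.sat_congr h.2 (hag.var 3 (by omega) (by omega))
        (fun i hi => hag.var i (hl i hi).1 (hl i hi).2) (fun a _ => congrFun hag.arr a)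
    simp only [Fm.comp, BProg.run, Fm.sat, Expr.eval, ← h1]
    rw [branch_eq]
    split_ifs with hc
    · simp [hc, ih2 h.2 hd hl, h2]
    · simp [hc]
  | ex i φ ih =>
    have h' := h
    simp only [Fm.wf, Bool.and_eq_true, Nat.ble_eq] at h'
    refine (Fm.ex_search h hd hl (ih h'.2 (by omega) fun j hj => ?_) σ).ne_zero_iff
    rcases List.mem_cons.1 hj with rfl | hj
    · omega
    · have := hl j hj
      omega

theorem Fm.comp_search (φ : Fm) {ok : ℕ → Bool} {l : List ℕ} {d i : ℕ}
    (h : (Fm.ex i φ).wf ok l d = true) (hd : 5 ≤ d) (hl : ∀ i ∈ l, i < d ∧ i ≠ 4) (σ : State) :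
    IsSearch (fun k => φ.sat (σ.setv i k)) (σ.var 3) (((Fm.ex i φ).comp.run σ).var 4) := by
  have h' := h
  simp only [Fm.wf, Bool.and_eq_true, Nat.ble_eq] at h'
  refine Fm.ex_search h hd hl (φ.comp_sat h'.2 (by omega) fun j hj => ?_) σ
  rcases List.mem_cons.1 hj with rfl | hj
  · omega
  · have := hl j hj
    omega

/-! ## Matching cuts of induced subgraphs

Throughout, `G` is a graph on `ℕ` and `S` a finite set of vertices; we work with the subgraph of `G`
induced by `S`. -/

/-- The edges of `G[S]` between `A` and its complement. -/
def Cut (G : SimpleGraph ℕ) (S : Finset ℕ) (A : Set ℕ) : Set (Sym2 ℕ) :=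
  {e | ∃ a ∈ S, ∃ b ∈ S, a ∈ A ∧ b ∉ A ∧ G.Adj a b ∧ e = s(a, b)}

/-- No two distinct edges share an end-vertex. -/
def Mat (M : Set (Sym2 ℕ)) : Prop := ∀ v a b, s(v, a) ∈ M → s(v, b) ∈ M → a = b

/-- The edges of `G[S]`. -/
def Edges (G : SimpleGraph ℕ) (S : Finset ℕ) : Set (Sym2 ℕ) :=
  {e | ∃ a ∈ S, ∃ b ∈ S, G.Adj a b ∧ e = s(a, b)}

/-- Both `A` and its complement meet `S`. -/
def Splits (S : Finset ℕ) (A : Set ℕ) : Prop := (∃ a ∈ S, a ∈ A) ∧ ∃ b ∈ S, b ∉ A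

/-- `M` is a matching cut of `G[S]`. -/
def MC (G : SimpleGraph ℕ) (S : Finset ℕ) (M : Set (Sym2 ℕ)) : Prop :=
  (∃ A, Splits S A ∧ M = Cut G S A) ∧ Mat M

/-- `M` is a matching cut of `G[S]`, where one side of the cut may be empty. -/
def CM (G : SimpleGraph ℕ) (S : Finset ℕ) (M : Set (Sym2 ℕ)) : Prop :=
  (∃ A, M = Cut G S A) ∧ Mat M

/-- `G[S]` is disconnected. -/
def Disc (G : SimpleGraph ℕ) (S : Finset ℕ) : Prop := ∃ A, Splits S A ∧ Cut G S A = ∅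

theorem mem_cut {G : SimpleGraph ℕ} {S : Finset ℕ} {A : Set ℕ} {a b : ℕ} :
    s(a, b) ∈ Cut G S A ↔ a ∈ S ∧ b ∈ S ∧ G.Adj a b ∧ ¬ (a ∈ A ↔ b ∈ A) := by
  constructor
  · rintro ⟨x, hx, y, hy, hxA, hyA, hxy, h⟩
    rcases Sym2.eq_iff.1 h with ⟨rfl, rfl⟩ | ⟨rfl, rfl⟩
    · exact ⟨hx, hy, hxy, by tauto⟩
    · exact ⟨hy, hx, hxy.symm, by tauto⟩
  · rintro ⟨ha, hb, hab, h⟩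
    by_cases haA : a ∈ A
    · exact ⟨a, ha, b, hb, haA, by tauto, hab, rfl⟩
    · exact ⟨b, hb, a, ha, by tauto, haA, hab.symm, Sym2.eq_swap⟩

theorem mem_edges {G : SimpleGraph ℕ} {S : Finset ℕ} {a b : ℕ} :
    s(a, b) ∈ Edges G S ↔ a ∈ S ∧ b ∈ S ∧ G.Adj a b := by
  constructor
  · rintro ⟨x, hx, y, hy, hxy, h⟩
    rcases Sym2.eq_iff.1 h with ⟨rfl, rfl⟩ | ⟨rfl, rfl⟩
    · exact ⟨hx, hy, hxy⟩
    · exact ⟨hy, hx, hxy.symm⟩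
  · rintro ⟨ha, hb, hab⟩
    exact ⟨a, ha, b, hb, hab, rfl⟩

theorem sym2_ext {M N : Set (Sym2 ℕ)} (h : ∀ a b, s(a, b) ∈ M ↔ s(a, b) ∈ N) : M = N := by
  ext e
  induction e with
  | _ a b => exact h a b

theorem cut_subset_edges (G : SimpleGraph ℕ) (S : Finset ℕ) (A : Set ℕ) :
    Cut G S A ⊆ Edges G S := by
  rintro _ ⟨a, ha, b, hb, -, -, h, rfl⟩
  exact ⟨a, ha, b, hb, h, rfl⟩

theorem Mat.mono {M N : Set (Sym2 ℕ)} (h : Mat M) (hN : N ⊆ M) : Mat N :=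
  fun v a b ha hb => h v a b (hN ha) (hN hb)

theorem not_splits_cut {G : SimpleGraph ℕ} {S : Finset ℕ} {A : Set ℕ} (h : ¬ Splits S A) :
    Cut G S A = ∅ := by
  refine Set.eq_empty_of_forall_notMem ?_
  rintro _ ⟨a, ha, b, hb, haA, hbA, -, -⟩
  exact h ⟨⟨a, ha, haA⟩, b, hb, hbA⟩

/-- A cut with an empty side is empty, so nonemptiness of the sides matters only for the empty edge
set. All other arguments can then ignore it and work with `CM`. -/
theorem mc_iff {G : SimpleGraph ℕ} {S : Finset ℕ} {M : Set (Sym2 ℕ)} :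
    MC G S M ↔ CM G S M ∧ (M = ∅ → Disc G S) := by
  constructor
  · rintro ⟨⟨A, hA, rfl⟩, hM⟩
    exact ⟨⟨⟨A, rfl⟩, hM⟩, fun h => ⟨A, hA, h⟩⟩
  · rintro ⟨⟨⟨A, rfl⟩, hM⟩, h⟩
    by_cases hA : Splits S A
    · exact ⟨⟨A, hA, rfl⟩, hM⟩
    · have h0 := not_splits_cut (G := G) hA
      obtain ⟨B, hB, hB'⟩ := h h0
      exact ⟨⟨B, hB, by rw [h0, hB']⟩, hM⟩

theorem cm_empty (G : SimpleGraph ℕ) (S : Finset ℕ) : CM G S ∅ :=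
  ⟨⟨∅, sym2_ext fun a b => by simp [mem_cut]⟩, fun v a b h => absurd h (Set.notMem_empty _)⟩

/-- If `ab` is cut, then `c` is separated from `a` or from `b`, and there are two cut edges at that
vertex. -/
theorem triangle_mono {G : SimpleGraph ℕ} {S : Finset ℕ} {A : Set ℕ} (h : Mat (Cut G S A))
    {a b c : ℕ} (ha : a ∈ S) (hb : b ∈ S) (hc : c ∈ S) (hab : G.Adj a b) (hbc : G.Adj b c)
    (hac : G.Adj a c) : a ∈ A ↔ b ∈ A := by
  by_contra hne
  have h1 : s(a, b) ∈ Cut G S A := mem_cut.2 ⟨ha, hb, hab, hne⟩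
  by_cases hcA : c ∈ A ↔ a ∈ A
  · have h2 : s(b, c) ∈ Cut G S A := mem_cut.2 ⟨hb, hc, hbc, by tauto⟩
    rw [Sym2.eq_swap] at h1
    exact hac.ne (h b a c h1 h2)
  · have h2 : s(a, c) ∈ Cut G S A := mem_cut.2 ⟨ha, hc, hac, by tauto⟩
    exact hbc.ne (h a b c h1 h2)

/-- If `x` and `y` were separated, each common neighbor would be joined by a cut edge to one of
them. Among three such edges two meet in `x` or in `y`. -/
theorem common_mono {G : SimpleGraph ℕ} {S : Finset ℕ} {A : Set ℕ} (h : Mat (Cut G S A))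
    {x y a b c : ℕ} (hx : x ∈ S) (hy : y ∈ S) (ha : a ∈ S) (hb : b ∈ S) (hc : c ∈ S)
    (hab : a ≠ b) (hac : a ≠ c) (hbc : b ≠ c) (hxa : G.Adj x a) (hya : G.Adj y a)
    (hxb : G.Adj x b) (hyb : G.Adj y b) (hxc : G.Adj x c) (hyc : G.Adj y c) :
    x ∈ A ↔ y ∈ A := by
  by_contra hne
  have key : ∀ z ∈ S, G.Adj x z → G.Adj y z → s(x, z) ∈ Cut G S A ∨ s(y, z) ∈ Cut G S A := by
    intro z hz h1 h2
    by_cases hz' : z ∈ A ↔ x ∈ A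
    · exact Or.inr (mem_cut.2 ⟨hy, hz, h2, by tauto⟩)
    · exact Or.inl (mem_cut.2 ⟨hx, hz, h1, by tauto⟩)
  rcases key a ha hxa hya with h1 | h1 <;> rcases key b hb hxb hyb with h2 | h2 <;>
    rcases key c hc hxc hyc with h3 | h3
  all_goals first
    | exact hab (h _ _ _ h1 h2)
    | exact hac (h _ _ _ h1 h3)
    | exact hbc (h _ _ _ h2 h3)

/-- Deleting a set of vertices such that every matching cut is trivial around it. -/
theorem mc_delete {G : SimpleGraph ℕ} {S C : Finset ℕ}
    (h1 : ∀ A, Mat (Cut G S A) → ∀ u ∈ C, ∀ w ∈ S, G.Adj u w → (u ∈ A ↔ w ∈ A))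
    (h2 : ∀ A, Mat (Cut G (S \ C) A) → ∀ u ∈ C, ∀ w ∈ S \ C, G.Adj u w →
      ∀ u' ∈ C, ∀ w' ∈ S \ C, G.Adj u' w' → (w ∈ A ↔ w' ∈ A))
    (h3 : ∀ u ∈ C, ∃ w ∈ S \ C, G.Adj u w) (M : Set (Sym2 ℕ)) :
    MC G S M ↔ MC G (S \ C) M := by
  constructor
  · rintro ⟨⟨A, ⟨⟨a, ha, haA⟩, b, hb, hbA⟩, rfl⟩, hM⟩
    -- Every deleted vertex is on the side of a surviving neighbor, so both sides stay nonempty.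
    have key : ∀ u ∈ S, ∃ w ∈ S \ C, (u ∈ A ↔ w ∈ A) := by
      intro u hu
      by_cases huC : u ∈ C
      · obtain ⟨w, hw, huw⟩ := h3 u huC
        exact ⟨w, hw, h1 A hM u huC w (Finset.mem_sdiff.1 hw).1 huw⟩
      · exact ⟨u, Finset.mem_sdiff.2 ⟨hu, huC⟩, Iff.rfl⟩
    refine ⟨⟨A, ⟨?_, ?_⟩, sym2_ext fun x y => ?_⟩, hM⟩
    · obtain ⟨w, hw, h⟩ := key a ha
      exact ⟨w, hw, h.1 haA⟩
    · obtain ⟨w, hw, h⟩ := key b hb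
      exact ⟨w, hw, fun hc => hbA (h.2 hc)⟩
    · rw [mem_cut, mem_cut]
      constructor
      · rintro ⟨hx, hy, hxy, hne⟩
        refine ⟨Finset.mem_sdiff.2 ⟨hx, fun hc => hne ?_⟩,
          Finset.mem_sdiff.2 ⟨hy, fun hc => hne ?_⟩, hxy, hne⟩
        · exact h1 A hM x hc y hy hxy
        · exact (h1 A hM y hc x hx hxy.symm).symm
      · rintro ⟨hx, hy, hxy, hne⟩
        exact ⟨(Finset.mem_sdiff.1 hx).1, (Finset.mem_sdiff.1 hy).1, hxy, hne⟩
  · rintro ⟨⟨A, ⟨⟨a, ha, haA⟩, b, hb, hbA⟩, rfl⟩, hM⟩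
    -- All of `C` joins the common side of its surviving neighbors, which is well defined by `h2`.
    let B : Set ℕ := {u | (u ∉ C ∧ u ∈ A) ∨ (u ∈ C ∧ ∃ u' ∈ C, ∃ w ∈ S \ C, G.Adj u' w ∧ w ∈ A)}
    have hout : ∀ u, u ∉ C → (u ∈ B ↔ u ∈ A) := fun u hu => by simp [B, hu]
    have hin : ∀ u ∈ C, ∀ w ∈ S \ C, G.Adj u w → (u ∈ B ↔ w ∈ A) := by
      intro u hu w hw huw
      constructor
      · rintro (⟨h, -⟩ | ⟨-, u', hu', w', hw', h', hA⟩)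
        · exact absurd hu h
        · exact (h2 A hM u hu w hw huw u' hu' w' hw' h').2 hA
      · exact fun h => Or.inr ⟨hu, u, hu, w, hw, huw, h⟩
    have hC : ∀ u ∈ C, ∀ v ∈ C, (u ∈ B ↔ v ∈ B) := fun u hu v hv => by simp [B, hu, hv]
    have hcut : Cut G (S \ C) A = Cut G S B := by
      refine sym2_ext fun x y => ?_
      rw [mem_cut, mem_cut]
      by_cases hx : x ∈ C <;> by_cases hy : y ∈ C
      · simp [hx, hC x hx y hy]
      · simp only [Finset.mem_sdiff, hx, not_true, and_false, false_and, false_iff]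
        rintro ⟨-, hyS, hxy, hne⟩
        have hy' : y ∈ S \ C := Finset.mem_sdiff.2 ⟨hyS, hy⟩
        exact hne ((hin x hx y hy' hxy).trans (hout y hy).symm)
      · simp only [Finset.mem_sdiff, hy, not_true, and_false, false_and, false_iff]
        rintro ⟨hxS, -, hxy, hne⟩
        have hx' : x ∈ S \ C := Finset.mem_sdiff.2 ⟨hxS, hx⟩
        exact hne ((hout x hx).trans (hin y hy x hx' hxy.symm).symm)
      · simp [Finset.mem_sdiff, hx, hy, hout]
    have ha' := Finset.mem_sdiff.1 ha
    have hb' := Finset.mem_sdiff.1 hb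
    exact ⟨⟨B, ⟨⟨a, ha'.1, (hout a ha'.2).2 haA⟩, b, hb'.1, fun h => hbA ((hout b hb'.2).1 h)⟩,
      hcut⟩, hM⟩

/-! ## Deletion of vertices that no matching cut separates from their neighbors -/

/-- `u` and `v` are true twins in `G[S]`, or equal. -/
def Twin (G : SimpleGraph ℕ) (S : Finset ℕ) (u v : ℕ) : Prop :=
  (u = v ∨ G.Adj u v) ∧ ∀ w ∈ S, w ≠ u → w ≠ v → (G.Adj u w ↔ G.Adj v w)

/-- The vertex `v` has three further true twins in `G[S]`. -/
def Crowded (G : SimpleGraph ℕ) (S : Finset ℕ) (v : ℕ) : Prop :=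
  ∃ a ∈ S, ∃ b ∈ S, ∃ c ∈ S, (a ≠ b ∧ a ≠ c ∧ b ≠ c) ∧ (v ≠ a ∧ v ≠ b ∧ v ≠ c) ∧
    Twin G S v a ∧ Twin G S v b ∧ Twin G S v c

/-- The vertex `w` is a neighbor of `v` but not a true twin. -/
def Outer (G : SimpleGraph ℕ) (S : Finset ℕ) (v w : ℕ) : Prop := G.Adj v w ∧ ¬ Twin G S v w

/-- Some three common neighbors of `x` and `y` are not true twins of `v`. -/
def Linked (G : SimpleGraph ℕ) (S : Finset ℕ) (v x y : ℕ) : Prop :=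
  ∃ a ∈ S, ∃ b ∈ S, ∃ c ∈ S, (a ≠ b ∧ a ≠ c ∧ b ≠ c) ∧
    (G.Adj x a ∧ G.Adj y a ∧ ¬ Twin G S v a) ∧ (G.Adj x b ∧ G.Adj y b ∧ ¬ Twin G S v b) ∧
    (G.Adj x c ∧ G.Adj y c ∧ ¬ Twin G S v c)

/-- In every matching cut, the class of true twins of `v` and its neighborhood lie on one side,
already due to the other vertices. -/
def Forced (G : SimpleGraph ℕ) (S : Finset ℕ) (v : ℕ) : Prop :=
  (∃ w ∈ S, Outer G S v w) ∧ (∃ a ∈ S, ∃ b ∈ S, a ≠ b ∧ G.Adj v a ∧ G.Adj v b) ∧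
    ∀ x ∈ S, ∀ y ∈ S, x ≠ y → Outer G S v x → Outer G S v y → Linked G S v x y

open Classical in
/-- The vertices deleted when `v` is processed. -/
noncomputable def removed (G : SimpleGraph ℕ) (S : Finset ℕ) (v : ℕ) : Finset ℕ :=
  S.filter fun u => v ∈ S ∧ ((u = v ∧ Crowded G S v) ∨ (Twin G S v u ∧ Forced G S v))

/-- The remaining vertices after processing the vertices below `k`. -/
noncomputable def pruned (G : SimpleGraph ℕ) (n : ℕ) : ℕ → Finset ℕ
  | 0 => Finset.range n
  | k + 1 => pruned G n k \ removed G (pruned G n k) k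

/-! ### True twins, and invariance of the matching cuts under the deletions -/

theorem Twin.refl (G : SimpleGraph ℕ) (S : Finset ℕ) (v : ℕ) : Twin G S v v :=
  ⟨Or.inl rfl, fun _ _ _ _ => Iff.rfl⟩

theorem Twin.symm {G : SimpleGraph ℕ} {S : Finset ℕ} {u v : ℕ} (h : Twin G S u v) :
    Twin G S v u :=
  ⟨h.1.imp Eq.symm SimpleGraph.Adj.symm, fun w hw h1 h2 => (h.2 w hw h2 h1).symm⟩

theorem Twin.mono {G : SimpleGraph ℕ} {S S' : Finset ℕ} {u v : ℕ} (h : Twin G S u v)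
    (hS : S' ⊆ S) : Twin G S' u v :=
  ⟨h.1, fun w hw => h.2 w (hS hw)⟩

theorem Twin.adj {G : SimpleGraph ℕ} {S : Finset ℕ} {u v w : ℕ} (h : Twin G S u v) (hw : w ∈ S)
    (hwv : w ≠ v) (ha : G.Adj u w) : G.Adj v w :=
  (h.2 w hw ha.ne' hwv).1 ha

theorem Twin.trans {G : SimpleGraph ℕ} {S : Finset ℕ} {u v w : ℕ} (hv : v ∈ S) (hw : w ∈ S)
    (h : Twin G S u v) (h' : Twin G S v w) : Twin G S u w := by
  by_cases huv : u = v
  · exact huv ▸ h'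
  by_cases hvw : v = w
  · exact hvw ▸ h
  by_cases huw : u = w
  · exact huw ▸ Twin.refl G S u
  have h1 : G.Adj u v := h.1.resolve_left huv
  have h2 : G.Adj v w := h'.1.resolve_left hvw
  have h3 : G.Adj u w := (h.2 w hw (Ne.symm huw) (Ne.symm hvw)).2 h2
  refine ⟨Or.inr h3, fun x hx hxu hxw => ?_⟩
  by_cases hxv : x = v
  · subst hxv
    exact iff_of_true h1 h2.symm
  · exact (h.2 x hx hxu hxv).trans (h'.2 x hx hxv hxw)

/-- Before the deletion, triangles with the twins tie `v` to all its neighbors. Afterwards these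
neighbors are tied to `a` by triangles with `b`, except for `b` itself, where the triangle on all
three twins is needed. -/
theorem crowded_mc {G : SimpleGraph ℕ} {S : Finset ℕ} {v : ℕ} (h : Crowded G S v)
    (hv : v ∈ S) (M : Set (Sym2 ℕ)) : MC G S M ↔ MC G (S \ {v}) M := by
  obtain ⟨a, ha, b, hb, c, hc, ⟨hab, hac, hbc⟩, ⟨hva, hvb, hvc⟩, ta, tb, tc⟩ := h
  have va := ta.1.resolve_left hva
  have vb := tb.1.resolve_left hvb
  have vc := tc.1.resolve_left hvc
  have ab : G.Adj a b := ta.adj hb (Ne.symm hab) vb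
  have ac : G.Adj a c := ta.adj hc (Ne.symm hac) vc
  have bc : G.Adj b c := tb.adj hc (Ne.symm hbc) vc
  have hS : ∀ w ∈ S, w ≠ v → w ∈ S \ {v} := fun w hw hne => by simp [hw, hne]
  refine mc_delete ?_ ?_ ?_ M
  · simp only [Finset.mem_singleton, forall_eq]
    intro A hA w hw hvw
    by_cases hwa : w = a
    · subst hwa
      exact triangle_mono hA hv hw hb va ab vb
    · exact triangle_mono hA hv hw ha hvw (ta.adj hw hwa hvw).symm va
  · simp only [Finset.mem_singleton, forall_eq]
    intro A hA
    have key : ∀ w ∈ S \ {v}, G.Adj v w → (w ∈ A ↔ a ∈ A) := by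
      intro w hw hvw
      have hw' := Finset.mem_sdiff.1 hw
      by_cases hwa : w = a
      · rw [hwa]
      have haw := (ta.adj hw'.1 hwa hvw)
      by_cases hwb : w = b
      · subst hwb
        exact triangle_mono hA hw (hS a ha (Ne.symm hva)) (hS c hc (Ne.symm hvc)) ab.symm ac bc
      · exact triangle_mono hA hw (hS a ha (Ne.symm hva)) (hS b hb (Ne.symm hvb)) haw.symm ab
          (tb.adj hw'.1 hwb hvw).symm
    exact fun w hw hvw w' hw' hvw' => (key w hw hvw).trans (key w' hw' hvw').symm
  · simp only [Finset.mem_singleton, forall_eq]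
    exact ⟨a, hS a ha (Ne.symm hva), va⟩

-- If the class has a second member, each edge at the class lies in a triangle. A lone `v` has all
-- its neighbors on one side and at least two of them, so it must join them. The linking neighbors
-- are not twins of `v`, hence survive, and they keep the outer neighbors together after the
-- deletion.
open Classical in
theorem forced_mc {G : SimpleGraph ℕ} {S : Finset ℕ} {v : ℕ} (h : Forced G S v)
    (hv : v ∈ S) (M : Set (Sym2 ℕ)) :
    MC G S M ↔ MC G (S \ S.filter fun u => Twin G S v u) M := by
  obtain ⟨⟨w0, hw0, hvw0, htw0⟩, ⟨p, hp, q, hq, hpq, hvp, hvq⟩, hxy⟩ := h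
  have hmem : ∀ w, w ∈ S \ S.filter (fun u => Twin G S v u) ↔ w ∈ S ∧ ¬ Twin G S v w := by
    intro w
    simp only [Finset.mem_sdiff, Finset.mem_filter]
    tauto
  have hout : ∀ u, Twin G S v u → ∀ w ∈ S, ¬ Twin G S v w → G.Adj u w → G.Adj v w := by
    intro u hu w hw htw huw
    refine hu.symm.adj hw ?_ huw
    rintro rfl
    exact htw (Twin.refl G S w)
  have hin : ∀ u, Twin G S v u → ∀ w ∈ S, ¬ Twin G S v w → G.Adj v w → G.Adj u w := by
    intro u hu w hw htw huw
    refine hu.adj hw ?_ huw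
    rintro rfl
    exact htw hu
  refine mc_delete ?_ ?_ ?_ M
  · intro A hA u hu w hw huw
    have hu' := Finset.mem_filter.1 hu
    by_cases hex : ∃ u' ∈ S, u' ≠ u ∧ Twin G S v u'
    · by_cases htw : Twin G S v w
      · exact triangle_mono hA hu'.1 hw hw0 huw (hin w htw w0 hw0 htw0 hvw0)
          (hin u hu'.2 w0 hw0 htw0 hvw0)
      · obtain ⟨u', hu'S, hne, htu'⟩ := hex
        have huu' : Twin G S u u' := Twin.trans hv hu'S hu'.2.symm htu'
        refine triangle_mono hA hu'.1 hw hu'S huw ?_ (huu'.1.resolve_left (Ne.symm hne))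
        exact (hin u' htu' w hw htw (hout u hu'.2 w hw htw huw)).symm
    -- Here `v` is alone in its class, so all its neighbors are outer and lie on one side.
    · push Not at hex
      obtain rfl : v = u := by
        by_contra hne
        exact hex v hv hne (Twin.refl G S v)
      have hnt : ∀ z ∈ S, G.Adj v z → ¬ Twin G S v z := fun z hz hvz => hex z hz hvz.ne'
      have hsame : ∀ x ∈ S, ∀ y ∈ S, G.Adj v x → G.Adj v y → (x ∈ A ↔ y ∈ A) := by
        intro x hx y hy hvx hvy
        by_cases hne : x = y
        · rw [hne]
        obtain ⟨a, ha, b, hb, c, hc, ⟨h1, h2, h3⟩, ⟨h4, h5, -⟩, ⟨h6, h7, -⟩, h8, h9, -⟩ :=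
          hxy x hx y hy hne ⟨hvx, hnt x hx hvx⟩ ⟨hvy, hnt y hy hvy⟩
        exact common_mono hA hx hy ha hb hc h1 h2 h3 h4 h5 h6 h7 h8 h9
      by_contra hne
      have hvp' : s(v, p) ∈ Cut G S A :=
        mem_cut.2 ⟨hv, hp, hvp, fun h => hne (h.trans (hsame p hp w hw hvp huw))⟩
      have hvq' : s(v, q) ∈ Cut G S A :=
        mem_cut.2 ⟨hv, hq, hvq, fun h => hne (h.trans (hsame q hq w hw hvq huw))⟩
      exact hpq (hA v p q hvp' hvq')
  · intro A hA u hu x hx hux u' hu' y hy huy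
    have hx' := (hmem x).1 hx
    have hy' := (hmem y).1 hy
    have hvx := hout u (Finset.mem_filter.1 hu).2 x hx'.1 hx'.2 hux
    have hvy := hout u' (Finset.mem_filter.1 hu').2 y hy'.1 hy'.2 huy
    by_cases hne : x = y
    · rw [hne]
    obtain ⟨a, ha, b, hb, c, hc, ⟨h1, h2, h3⟩, ⟨h4, h5, ta⟩, ⟨h6, h7, tb⟩, h8, h9, tc⟩ :=
      hxy x hx'.1 y hy'.1 hne ⟨hvx, hx'.2⟩ ⟨hvy, hy'.2⟩
    exact common_mono hA hx hy ((hmem a).2 ⟨ha, ta⟩) ((hmem b).2 ⟨hb, tb⟩) ((hmem c).2 ⟨hc, tc⟩)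
      h1 h2 h3 h4 h5 h6 h7 h8 h9
  · intro u hu
    exact ⟨w0, (hmem w0).2 ⟨hw0, htw0⟩, hin u (Finset.mem_filter.1 hu).2 w0 hw0 htw0 hvw0⟩

/-- A forced vertex takes its whole class along, so crowding matters only when `v` is not forced. -/
theorem removed_mc (G : SimpleGraph ℕ) (S : Finset ℕ) (v : ℕ) (M : Set (Sym2 ℕ)) :
    MC G S M ↔ MC G (S \ removed G S v) M := by
  classical
  by_cases hv : v ∈ S
  · by_cases hf : Forced G S v
    · convert forced_mc hf hv M using 3
      ext u
      simp only [removed, Finset.mem_filter]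
      constructor
      · rintro ⟨hu, -, ⟨rfl, -⟩ | ⟨h, -⟩⟩
        exacts [⟨hu, Twin.refl G S u⟩, ⟨hu, h⟩]
      · exact fun h => ⟨h.1, hv, Or.inr ⟨h.2, hf⟩⟩
    · by_cases hc : Crowded G S v
      · convert crowded_mc hc hv M using 3
        ext u
        simp only [removed, Finset.mem_filter, Finset.mem_singleton]
        constructor
        · rintro ⟨hu, -, ⟨rfl, -⟩ | ⟨-, h⟩⟩
          exacts [rfl, absurd h hf]
        · rintro rfl
          exact ⟨hv, hv, Or.inl ⟨rfl, hc⟩⟩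
      · have : removed G S v = ∅ := by simp [removed, hf, hc]
        rw [this, Finset.sdiff_empty]
  · have : removed G S v = ∅ := by simp [removed, hv]
    rw [this, Finset.sdiff_empty]

/-- Twins and common neighbors are judged in the current set at every step. This is why crowding
stops deleting as soon as three twins are left. -/
theorem pruned_mc (G : SimpleGraph ℕ) (n k : ℕ) (M : Set (Sym2 ℕ)) :
    MC G (Finset.range n) M ↔ MC G (pruned G n k) M := by
  induction k with
  | zero => rfl
  | succ k ih => exact ih.trans (removed_mc G _ k M)

theorem pruned_anti (G : SimpleGraph ℕ) (n : ℕ) : Antitone (pruned G n) :=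
  antitone_nat_of_succ_le fun _ => Finset.sdiff_subset

theorem pruned_subset (G : SimpleGraph ℕ) (n k : ℕ) : pruned G n k ⊆ Finset.range n :=
  pruned_anti G n (Nat.zero_le k)

/-! ## Leaves and small components -/

/-- `x` is the only neighbor of `v`. -/
def Leaf (G : SimpleGraph ℕ) (S : Finset ℕ) (v x : ℕ) : Prop :=
  G.Adj v x ∧ ∀ y ∈ S, G.Adj v y → y = x

/-- `v` is a leaf hung on `x`; in a component with two vertices, the larger vertex is hung on the
smaller one. -/
def Hang (G : SimpleGraph ℕ) (S : Finset ℕ) (v x : ℕ) : Prop :=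
  (v ∈ S ∧ x ∈ S) ∧ Leaf G S v x ∧ (Leaf G S x v → x < v)

/-- The component of `v` is a complete graph. -/
def Closed (G : SimpleGraph ℕ) (S : Finset ℕ) (v : ℕ) : Prop :=
  ∀ w ∈ S, G.Adj v w → Twin G S v w

/-- The component of `v` is a complete graph, and two other complete components have smaller
vertices. -/
def Superfluous (G : SimpleGraph ℕ) (S : Finset ℕ) (v : ℕ) : Prop :=
  Closed G S v ∧ ∃ u ∈ S, ∃ w ∈ S, (Closed G S u ∧ Closed G S w) ∧ (u ≠ w ∧ ¬ G.Adj u w) ∧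
    (u < v ∧ w < v) ∧ ∀ y ∈ S, G.Adj v y → u < y ∧ w < y

/-- `v` is a leaf at a vertex with a smaller leaf. -/
def Extra (G : SimpleGraph ℕ) (S : Finset ℕ) (v : ℕ) : Prop :=
  ∃ x ∈ S, Leaf G S v x ∧ ∃ p ∈ S, p < v ∧ Leaf G S p x

open Classical in
/-- The vertices that remain after deleting superfluous components and leaves. -/
noncomputable def core (G : SimpleGraph ℕ) (S : Finset ℕ) : Finset ℕ :=
  S.filter fun v => ¬ (Superfluous G S v ∨ Extra G S v)

section Core

variable {G : SimpleGraph ℕ} {S : Finset ℕ}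

theorem mem_core {v : ℕ} : v ∈ core G S ↔ v ∈ S ∧ ¬ Superfluous G S v ∧ ¬ Extra G S v := by
  simp [core, not_or]

theorem core_subset : core G S ⊆ S := fun _ h => (mem_core.1 h).1

theorem Closed.adj {v w : ℕ} (h : Closed G S v) (hv : v ∈ S) (hw : w ∈ S) (hvw : G.Adj v w) :
    Closed G S w := by
  intro z hz hwz
  have h1 := h w hw hvw
  by_cases hzv : z = v
  · exact hzv ▸ h1.symm
  · exact Twin.trans hv hz h1.symm (h z hz (h1.symm.adj hz hzv hwz))

/-- The definition compares with all neighbors of `v` precisely to make this a property of the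
component, so that complete components are deleted as a whole. -/
theorem Superfluous.adj {v w : ℕ} (h : Superfluous G S v) (hv : v ∈ S) (hw : w ∈ S)
    (hvw : G.Adj v w) : Superfluous G S w := by
  obtain ⟨h1, a, ha, b, hb, h2, h3, h4, h5⟩ := h
  refine ⟨h1.adj hv hw hvw, a, ha, b, hb, h2, h3, h5 w hw hvw, fun y hy hwy => ?_⟩
  by_cases hyv : y = v
  · exact hyv ▸ h4
  · exact h5 y hy ((h1 w hw hvw).symm.adj hy hyv hwy)

/-- An extra leaf and its smaller rival have a common neighbor but are not adjacent, which is
impossible in a complete component. -/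
theorem Closed.not_extra {v : ℕ} (h : Closed G S v) : ¬ Extra G S v := by
  rintro ⟨x, hx, hvx, p, hp, hpv, hpx⟩
  have h1 := (h x hx hvx.1).symm.adj hp hpv.ne hpx.1.symm
  exact hpx.1.ne (hvx.2 p hp h1)

theorem disc_of_closed {S' : Finset ℕ} (hS : S' ⊆ S) {u w : ℕ} (hu : u ∈ S') (hw : w ∈ S')
    (hc : Closed G S u) (hne : u ≠ w) (hadj : ¬ G.Adj u w) : Disc G S' := by
  refine ⟨{y | y = u ∨ G.Adj u y}, ⟨⟨u, hu, Or.inl rfl⟩, w, hw, ?_⟩, sym2_ext fun a b => ?_⟩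
  · rintro (h | h)
    exacts [hne h.symm, hadj h]
  · simp only [mem_cut, Set.mem_empty_iff_false, iff_false]
    rintro ⟨ha, hb, hab, h⟩
    have key : ∀ a ∈ S, ∀ b ∈ S, G.Adj a b → (a = u ∨ G.Adj u a) → (b = u ∨ G.Adj u b) := by
      rintro a ha b hb hab (rfl | hua)
      · exact Or.inr hab
      · by_cases hbu : b = u
        · exact Or.inl hbu
        · exact Or.inr ((hc a ha hua).symm.adj hb hbu hab)
    exact h ⟨key a (hS ha) b (hS hb) hab, key b (hS hb) a (hS ha) hab.symm⟩

/-- Take the smallest vertex `u` of all complete components and the smallest vertex `w` of those not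
containing `u`. Two distinct complete components with vertices below `w` would both be that of `u`,
so neither `u` nor `w` is superfluous. -/
theorem Superfluous.exists_closed {v : ℕ} (h : Superfluous G S v) :
    ∃ u ∈ core G S, ∃ w ∈ core G S, Closed G S u ∧ u ≠ w ∧ ¬ G.Adj u w := by
  classical
  obtain ⟨-, a, ha, b, hb, ⟨hac, hbc⟩, ⟨hab, hadj⟩, -, -⟩ := h
  have hadj' : ∀ u ∈ S, Closed G S u → ∀ x ∈ S, ∀ y ∈ S, (x = u ∨ G.Adj u x) →
      (y = u ∨ G.Adj u y) → x ≠ y → G.Adj x y := by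
    rintro u hu hc x hx y hy (rfl | h1) (rfl | h2) hne
    · exact absurd rfl hne
    · exact h2
    · exact h1.symm
    · exact (hc x hx h1).adj hy hne.symm h2
  have hex : ∃ u, u ∈ S ∧ Closed G S u := ⟨a, ha, hac⟩
  obtain ⟨hu, huc⟩ := Nat.find_spec hex
  have humin : ∀ z ∈ S, Closed G S z → Nat.find hex ≤ z :=
    fun z hz hzc => Nat.find_min' hex ⟨hz, hzc⟩
  set u := Nat.find hex with hudef
  have hex' : ∃ w, w ∈ S ∧ Closed G S w ∧ ¬ (w = u ∨ G.Adj u w) := by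
    by_contra hno
    push Not at hno
    exact hadj (hadj' u hu huc a ha b hb (hno a ha hac) (hno b hb hbc) hab)
  obtain ⟨hw, hwc, hwu⟩ := Nat.find_spec hex'
  have hwmin : ∀ z ∈ S, Closed G S z → z < Nat.find hex' → (z = u ∨ G.Adj u z) := by
    intro z hz hzc hlt
    by_contra hcon
    exact Nat.find_min hex' hlt ⟨hz, hzc, hcon⟩
  set w := Nat.find hex' with hwdef
  refine ⟨u, mem_core.2 ⟨hu, ?_, huc.not_extra⟩, w, mem_core.2 ⟨hw, ?_, hwc.not_extra⟩, huc,
    fun h => hwu (Or.inl h.symm), fun h => hwu (Or.inr h)⟩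
  · rintro ⟨-, a', ha', -, -, ⟨h1, -⟩, -, ⟨h2, -⟩, -⟩
    exact absurd (humin a' ha' h1) (by omega)
  · rintro ⟨-, a', ha', b', hb', ⟨h1, h2⟩, ⟨h3, h4⟩, ⟨h5, h6⟩, -⟩
    exact h4 (hadj' u hu huc a' ha' b' hb' (hwmin a' ha' h1 h5) (hwmin b' hb' h2 h6) h3)

theorem Superfluous.disc {v : ℕ} (h : Superfluous G S v) : Disc G (core G S) ∧ Disc G S := by
  obtain ⟨u, hu, w, hw, h1, h2, h3⟩ := h.exists_closed
  exact ⟨disc_of_closed core_subset hu hw h1 h2 h3,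
    disc_of_closed subset_rfl (core_subset hu) (core_subset hw) h1 h2 h3⟩

/-! ### Hung leaves and the vertices that carry them -/

theorem Hang.adj {v x : ℕ} (h : Hang G S v x) : G.Adj v x := h.2.1.1

theorem Hang.unique {v x y : ℕ} (h : Hang G S v x) (h' : Hang G S v y) : x = y :=
  h'.2.1.2 x h.1.2 h.adj

theorem Hang.eq_of_adj {v x y : ℕ} (h : Hang G S v x) (hy : y ∈ S) (hvy : G.Adj v y) : y = x :=
  h.2.1.2 y hy hvy

/-- The only danger is a two-vertex component, where the comparison of the two numbers breaks the
symmetry. -/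
theorem Hang.not_hang {v x : ℕ} (h : Hang G S v x) (y : ℕ) : ¬ Hang G S x y := by
  intro h'
  obtain rfl : v = y := h'.2.1.2 v h.1.1 h.adj.symm
  exact absurd (h.2.2 h'.2.1) (h'.2.2 h.2.1).not_gt

/-- The vertex `x` carries two leaves. So it is not in a complete component and is not a leaf
itself, and nothing can delete it. -/
theorem Extra.hang {v : ℕ} (h : Extra G S v) (hv : v ∈ S) : ∃ x ∈ core G S, Hang G S v x := by
  obtain ⟨x, hx, hvx, p, hp, hpv, hpx⟩ := h
  have hxp : ¬ Leaf G S x v := fun h => hpv.ne (h.2 p hp hpx.1.symm)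
  refine ⟨x, mem_core.2 ⟨hx, fun hs => ?_, ?_⟩, ⟨hv, hx⟩, hvx, fun h => absurd h hxp⟩
  · have := (hs.1 v hv hvx.1.symm).adj hp hpv.ne hpx.1.symm
    exact hpx.1.ne (hvx.2 p hp this)
  · rintro ⟨y, hy, hxy, -⟩
    have h1 := hxy.2 v hv hvx.1.symm
    exact hxp (h1 ▸ hxy)

/-- An extra leaf is itself hung, which a vertex carrying a leaf is not; so `x` can only have been
deleted with its component. -/
theorem Hang.superfluous {v x : ℕ} (h : Hang G S v x) (hx : x ∉ core G S) :
    Superfluous G S x := by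
  by_contra hs
  refine hx (mem_core.2 ⟨h.1.2, hs, fun he => ?_⟩)
  obtain ⟨y, -, hy⟩ := he.hang h.1.2
  exact h.not_hang y hy

/-- The component is complete and contains a leaf, so it consists of a single edge. These are the
deleted components that a matching cut may still cut. -/
theorem Hang.leaf_of_notMem {v x : ℕ} (h : Hang G S v x) (hx : x ∉ core G S) :
    Leaf G S x v := by
  refine ⟨h.adj.symm, fun y hy hxy => ?_⟩
  by_contra hne
  exact hxy.ne' (h.eq_of_adj hy (((h.superfluous hx).1 v h.1.1 h.adj.symm).adj hy hne hxy))

theorem Hang.mem_core {v x : ℕ} (h : Hang G S v x) (hv : v ∈ core G S) : x ∈ core G S := by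
  by_contra hx
  exact (MCKernel.mem_core.1 hv).2.1 ((h.superfluous hx).adj h.1.2 h.1.1 h.adj.symm)

/-- Of two leaves at `x` the larger one is extra. -/
theorem Hang.core_unique {p q x : ℕ} (hp : p ∈ core G S) (hq : q ∈ core G S)
    (h : Hang G S p x) (h' : Hang G S q x) : p = q := by
  rcases lt_trichotomy p q with hlt | rfl | hlt
  · exact absurd ⟨x, h.1.2, h'.2.1, p, h.1.1, hlt, h.2.1⟩ (MCKernel.mem_core.1 hq).2.2
  · rfl
  · exact absurd ⟨x, h.1.2, h.2.1, q, h'.1.1, hlt, h'.2.1⟩ (MCKernel.mem_core.1 hp).2.2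

/-- The smallest leaf at `x` is not extra, and it is not superfluous since `x` is not. -/
theorem Hang.exists_core {v x : ℕ} (h : Hang G S v x) (hx : x ∈ core G S) :
    ∃ p ∈ core G S, Hang G S p x := by
  classical
  have hex : ∃ p, p ∈ S ∧ Leaf G S p x := ⟨v, h.1.1, h.2.1⟩
  obtain ⟨hp, hpx⟩ := Nat.find_spec hex
  have hmin : ∀ q < Nat.find hex, q ∈ S → ¬ Leaf G S q x :=
    fun q hq hqS hqx => Nat.find_min hex hq ⟨hqS, hqx⟩
  set p := Nat.find hex
  refine ⟨p, MCKernel.mem_core.2 ⟨hp, fun hs => ?_, ?_⟩, ⟨hp, h.1.2⟩, hpx, fun hl => ?_⟩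
  · exact (MCKernel.mem_core.1 hx).2.1 (hs.adj hp h.1.2 hpx.1)
  · rintro ⟨y, hy, hpy, q, hq, hqp, hqy⟩
    obtain rfl : y = x := hpx.2 y hy hpy.1
    exact hmin q hqp hq hqy
  · obtain rfl : v = p := hl.2 v h.1.1 h.adj.symm
    exact h.2.2 hl

/-! ### Matching cuts in terms of their free edges -/

/-- The edges of `M` that are not incident with hung leaves. -/
def Free (G : SimpleGraph ℕ) (S : Finset ℕ) (M : Set (Sym2 ℕ)) : Set (Sym2 ℕ) :=
  {e ∈ M | ∀ v ∈ e, ∀ x, ¬ Hang G S v x}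

theorem mem_free {M : Set (Sym2 ℕ)} {a b : ℕ} : s(a, b) ∈ Free G S M ↔
    s(a, b) ∈ M ∧ (∀ x, ¬ Hang G S a x) ∧ ∀ x, ¬ Hang G S b x := by
  simp [Free]

theorem free_subset (M : Set (Sym2 ℕ)) : Free G S M ⊆ M := fun _ h => h.1

theorem free_mono {M N : Set (Sym2 ℕ)} (h : M ⊆ N) : Free G S M ⊆ Free G S N :=
  fun _ he => ⟨h he.1, he.2⟩

theorem Hang.not_free {M : Set (Sym2 ℕ)} {v x : ℕ} (h : Hang G S v x) : s(x, v) ∉ Free G S M :=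
  fun he => (mem_free.1 he).2.2 x h

theorem Hang.eq_of_edge {v x v' x' : ℕ} (h : Hang G S v x) (h' : Hang G S v' x')
    (he : s(x, v) = s(x', v')) : x = x' ∧ v = v' := by
  rcases Sym2.eq_iff.1 he with h1 | ⟨rfl, rfl⟩
  · exact h1
  · exact absurd h' (h.not_hang v)

/-- An edge of `G[S]` is free or joins a leaf to the vertex that it is hung on. -/
theorem free_or_hang {M : Set (Sym2 ℕ)} (hM : M ⊆ Edges G S) {e : Sym2 ℕ} (he : e ∈ M) :
    e ∈ Free G S M ∨ ∃ x v, Hang G S v x ∧ e = s(x, v) := by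
  induction e with
  | _ a b =>
    obtain ⟨ha, hb, hab⟩ := mem_edges.1 (hM he)
    by_cases h1 : ∃ x, Hang G S a x
    · obtain ⟨x, hx⟩ := h1
      obtain rfl := hx.eq_of_adj hb hab
      exact Or.inr ⟨b, a, hx, Sym2.eq_swap⟩
    by_cases h2 : ∃ x, Hang G S b x
    · obtain ⟨x, hx⟩ := h2
      obtain rfl := hx.eq_of_adj ha hab.symm
      exact Or.inr ⟨a, b, hx, rfl⟩
    push Not at h1 h2
    exact Or.inl (mem_free.2 ⟨he, h1, h2⟩)

/-- A hung leaf has only one edge, so an edge to it can meet another edge only at the vertex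
carrying the leaf: either a second leaf edge or a free edge. -/
theorem mat_iff {M : Set (Sym2 ℕ)} (hM : M ⊆ Edges G S) : Mat M ↔ Mat (Free G S M) ∧
    (∀ x v w, Hang G S v x → Hang G S w x → s(x, v) ∈ M → s(x, w) ∈ M → v = w) ∧
    ∀ x v a, Hang G S v x → s(x, v) ∈ M → s(x, a) ∉ Free G S M := by
  constructor
  · refine fun h => ⟨h.mono (free_subset M), fun x v w _ _ h1 h2 => h x v w h1 h2, ?_⟩
    intro x v a hv h1 h2
    obtain rfl := h x v a h1 h2.1
    exact hv.not_free h2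
  · rintro ⟨h1, h2, h3⟩ z a b ha hb
    rcases free_or_hang hM ha with fa | ⟨x, v, hv, ea⟩ <;>
      rcases free_or_hang hM hb with fb | ⟨y, w, hw, eb⟩
    · exact h1 z a b fa fb
    · rcases Sym2.eq_iff.1 eb with ⟨rfl, rfl⟩ | ⟨rfl, rfl⟩
      · exact absurd fa (h3 _ _ _ hw hb)
      · exact absurd hw ((mem_free.1 fa).2.1 _)
    · rcases Sym2.eq_iff.1 ea with ⟨rfl, rfl⟩ | ⟨rfl, rfl⟩
      · exact absurd fb (h3 _ _ _ hv ha)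
      · exact absurd hv ((mem_free.1 fb).2.1 _)
    · rcases Sym2.eq_iff.1 ea with ⟨rfl, rfl⟩ | ⟨rfl, rfl⟩ <;>
        rcases Sym2.eq_iff.1 eb with ⟨rfl, rfl⟩ | ⟨rfl, rfl⟩
      · exact h2 _ _ _ hv hw ha hb
      · exact absurd hw (hv.not_hang _)
      · exact absurd hv (hw.not_hang _)
      · exact hv.unique hw

/-- The side of a hung leaf influences only its own edge, so leaf edges can be switched in and out
of a cut independently of everything else. -/
theorem cm_iff_free {S' : Finset ℕ} (hS : S' ⊆ S) {M : Set (Sym2 ℕ)} : CM G S' M ↔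
      Mat M ∧ M ⊆ Edges G S' ∧ ∃ A, Free G S M = Free G S (Cut G S' A) := by
  constructor
  · rintro ⟨⟨A, rfl⟩, hM⟩
    exact ⟨hM, cut_subset_edges G S' A, A, rfl⟩
  · rintro ⟨hM, hE, A, hA⟩
    -- Free vertices keep their side; a hung leaf goes opposite to its carrier exactly when its edge
    -- belongs to `M`.
    let B : Set ℕ := {u | ((∀ x, ¬ Hang G S u x) ∧ u ∈ A) ∨
      ∃ x, Hang G S u x ∧ ¬ (x ∈ A ↔ s(x, u) ∈ M)}
    have hB : ∀ u, (∀ x, ¬ Hang G S u x) → (u ∈ B ↔ u ∈ A) := fun u hu => by simp [B, hu]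
    have hB' : ∀ u x, Hang G S u x → (u ∈ B ↔ ¬ (x ∈ B ↔ s(x, u) ∈ M)) := by
      intro u x hux
      rw [hB x hux.not_hang]
      constructor
      · rintro (⟨h, -⟩ | ⟨y, hy, h⟩)
        · exact absurd hux (h x)
        · exact hux.unique hy ▸ h
      · exact fun h => Or.inr ⟨x, hux, h⟩
    refine ⟨⟨B, sym2_ext fun a b => ?_⟩, hM⟩
    have key : ∀ u x, u ∈ S' → x ∈ S' → Hang G S u x → (s(x, u) ∈ M ↔ s(x, u) ∈ Cut G S' B) := by
      intro u x hu hx hux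
      have := hB' u x hux
      simp only [mem_cut, hu, hx, hux.adj.symm, true_and]
      tauto
    by_cases hab : s(a, b) ∈ Edges G S'
    · obtain ⟨ha, hb, hadj⟩ := mem_edges.1 hab
      by_cases h1 : ∃ x, Hang G S a x
      · obtain ⟨x, hx⟩ := h1
        obtain rfl := hx.eq_of_adj (hS hb) hadj
        rw [Sym2.eq_swap]
        exact key a b ha hb hx
      by_cases h2 : ∃ x, Hang G S b x
      · obtain ⟨x, hx⟩ := h2
        obtain rfl := hx.eq_of_adj (hS ha) hadj.symm
        exact key b a hb ha hx
      push Not at h1 h2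
      have := Set.ext_iff.1 hA s(a, b)
      simp only [mem_free, mem_cut, h1, h2, not_false_eq_true, implies_true, and_true] at this
      rw [this, mem_cut, hB a h1, hB b h2]
    · exact iff_of_false (fun h => hab (hE h)) fun h => hab (cut_subset_edges G S' B h)

theorem free_cut (S' : Finset ℕ) (A : Set ℕ) [DecidablePred fun v => ∀ x, ¬ Hang G S v x] :
    Free G S (Cut G S' A) = Cut G (S'.filter fun v => ∀ x, ¬ Hang G S v x) A := by
  refine sym2_ext fun a b => ?_
  simp only [mem_free, mem_cut, Finset.mem_filter]
  tauto

/-- A free edge of the cut with a deleted end would lie in a superfluous complete component. That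
component has at least three vertices, as otherwise one end would be hung on the other, and its
triangles are not cut. -/
theorem free_cut_core {A : Set ℕ} (h : Mat (Free G S (Cut G S A))) :
    Free G S (Cut G (core G S) A) = Free G S (Cut G S A) := by
  classical
  have key : ∀ a b, s(a, b) ∈ Free G S (Cut G S A) → a ∈ core G S := by
    intro a b hab
    obtain ⟨hc, ha, hb⟩ := mem_free.1 hab
    obtain ⟨haS, hbS, hadj, hne⟩ := mem_cut.1 hc
    by_contra hcore
    have hs : Superfluous G S a := by
      by_contra hs
      refine hcore (mem_core.2 ⟨haS, hs, fun he => ?_⟩)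
      obtain ⟨x, -, hx⟩ := he.hang haS
      exact ha x hx
    have htw := hs.1 b hbS hadj
    have hz : ∃ z ∈ S, G.Adj a z ∧ G.Adj b z := by
      by_contra hno
      push Not at hno
      have h1 : Leaf G S a b := by
        refine ⟨hadj, fun y hy hay => ?_⟩
        by_contra hyb
        exact hno y hy hay (htw.adj hy hyb hay)
      have h2 : Leaf G S b a := by
        refine ⟨hadj.symm, fun y hy hay => ?_⟩
        by_contra hyb
        exact hno y hy (htw.symm.adj hy hyb hay) hay
      rcases lt_or_gt_of_ne hadj.ne with hlt | hlt
      · exact hb a ⟨⟨hbS, haS⟩, h2, fun _ => hlt⟩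
      · exact ha b ⟨⟨haS, hbS⟩, h1, fun _ => hlt⟩
    obtain ⟨z, hzS, haz, hbz⟩ := hz
    have hzh : ∀ x, ¬ Hang G S z x := fun x hx =>
      hadj.ne ((hx.eq_of_adj haS haz.symm).trans (hx.eq_of_adj hbS hbz.symm).symm)
    rw [free_cut] at h
    exact hne (triangle_mono h (by simpa using ⟨haS, ha⟩) (by simpa using ⟨hbS, hb⟩)
      (by simpa using ⟨hzS, hzh⟩) hadj hbz haz)
  refine sym2_ext fun a b => ⟨fun h => ?_, fun h => ?_⟩
  · obtain ⟨h1, h2, h3⟩ := mem_free.1 h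
    obtain ⟨ha, hb, h4⟩ := mem_cut.1 h1
    exact mem_free.2 ⟨mem_cut.2 ⟨core_subset ha, core_subset hb, h4⟩, h2, h3⟩
  · have ha := key a b h
    have hb := key b a (Sym2.eq_swap ▸ h)
    obtain ⟨h1, h2⟩ := mem_free.1 h
    obtain ⟨-, -, h4⟩ := mem_cut.1 h1
    exact mem_free.2 ⟨mem_cut.2 ⟨ha, hb, h4⟩, h2⟩

/-- A free vertex outside the core is superfluous and hence so is its component. Putting all deleted
vertices on one side therefore creates no free cut edge. -/
theorem free_cut_inter (A : Set ℕ) :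
    Free G S (Cut G S (A ∩ core G S)) = Free G S (Cut G (core G S) A) := by
  refine sym2_ext fun a b => ?_
  simp only [mem_free, mem_cut]
  have key : ∀ a b, a ∈ S → b ∈ S → G.Adj a b → (∀ x, ¬ Hang G S a x) → a ∉ core G S →
      b ∉ core G S := by
    intro a b ha hb hab hfree hcore hb'
    have hs : Superfluous G S a := by
      by_contra hs
      refine hcore (mem_core.2 ⟨ha, hs, fun he => ?_⟩)
      obtain ⟨x, -, hx⟩ := he.hang ha
      exact hfree x hx
    exact (mem_core.1 hb').2.1 (hs.adj ha hb hab)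
  constructor
  · rintro ⟨⟨ha, hb, hab, hne⟩, h1, h2⟩
    by_cases hac : a ∈ core G S
    · have hbc : b ∈ core G S := by
        by_contra hbc
        exact key b a hb ha hab.symm h2 hbc hac
      exact ⟨⟨hac, hbc, hab, by simpa [hac, hbc] using hne⟩, h1, h2⟩
    · have hbc := key a b ha hb hab h1 hac
      simp [hac, hbc] at hne
  · rintro ⟨⟨ha, hb, hab, hne⟩, h1, h2⟩
    exact ⟨⟨core_subset ha, core_subset hb, hab, by simpa [ha, hb] using hne⟩, h1, h2⟩

/-- A matching with the same free edges as a cut of the core is a cut. -/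
theorem cm_of_core {M N : Set (Sym2 ℕ)} (hE : M ⊆ Edges G S) (hM : Mat M)
    (hN : CM G (core G S) N) (h : Free G S M = Free G S N) : CM G S M := by
  obtain ⟨-, -, A, hA⟩ := (cm_iff_free core_subset).1 hN
  exact (cm_iff_free subset_rfl).2
    ⟨hM, hE, A ∩ core G S, by rw [h, hA, free_cut_inter]⟩

/-- If a component is deleted, both graphs are disconnected by `Superfluous.disc`. If only leaves
are deleted, each is on the side of its carrier in an empty cut. -/
theorem disc_core : Disc G (core G S) ↔ Disc G S := by
  constructor
  · rintro ⟨A, ⟨⟨a, ha, haA⟩, b, hb, hbA⟩, hA⟩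
    let B : Set ℕ := {u | (u ∈ core G S ∧ u ∈ A) ∨
      (u ∉ core G S ∧ ∃ x ∈ core G S, Hang G S u x ∧ x ∈ A)}
    have hB : ∀ u ∈ core G S, (u ∈ B ↔ u ∈ A) := fun u hu => by simp [B, hu]
    have key : ∀ a ∈ S, ∀ b ∈ S, G.Adj a b → a ∉ core G S → (a ∈ B ↔ b ∈ B) := by
      intro a ha b hb hab hac
      by_cases hs : Superfluous G S a
      · have h0 : ∀ u ∈ S, Superfluous G S u → u ∉ B := by
          rintro u hu hsu (⟨h, -⟩ | ⟨-, x, hx, hux, -⟩)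
          · exact (mem_core.1 h).2.1 hsu
          · exact (mem_core.1 hx).2.1 (hsu.adj hu (core_subset hx) hux.adj)
        exact iff_of_false (h0 a ha hs) (h0 b hb (hs.adj ha hb hab))
      · have he : Extra G S a := by
          by_contra he
          exact hac (mem_core.2 ⟨ha, hs, he⟩)
        obtain ⟨x, hx, hax⟩ := he.hang ha
        obtain rfl := hax.eq_of_adj hb hab
        rw [hB b hx]
        constructor
        · rintro (⟨h, -⟩ | ⟨-, y, hy, hay, hyA⟩)
          · exact absurd h hac
          · exact hax.unique hay ▸ hyA
        · exact fun h => Or.inr ⟨hac, b, hx, hax, h⟩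
    refine ⟨B, ⟨⟨a, core_subset ha, (hB a ha).2 haA⟩, b, core_subset hb,
      fun h => hbA ((hB b hb).1 h)⟩, sym2_ext fun x y => ?_⟩
    simp only [mem_cut, Set.mem_empty_iff_false, iff_false]
    rintro ⟨hx, hy, hxy, hne⟩
    by_cases hxc : x ∈ core G S
    · by_cases hyc : y ∈ core G S
      · rw [hB x hxc, hB y hyc] at hne
        exact Set.notMem_empty _ (hA ▸ mem_cut.2 ⟨hxc, hyc, hxy, hne⟩)
      · exact hne (key y hy x hx hxy.symm hyc).symm
    · exact hne (key x hx y hy hxy hxc)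
  · rintro ⟨A, ⟨⟨a, ha, haA⟩, b, hb, hbA⟩, hA⟩
    by_cases hs : ∃ v, Superfluous G S v
    · obtain ⟨v, hv⟩ := hs
      exact hv.disc.1
    push Not at hs
    have key : ∀ u ∈ S, ∃ x ∈ core G S, (u ∈ A ↔ x ∈ A) := by
      intro u hu
      by_cases huc : u ∈ core G S
      · exact ⟨u, huc, Iff.rfl⟩
      have he : Extra G S u := by
        by_contra he
        exact huc (mem_core.2 ⟨hu, hs u, he⟩)
      obtain ⟨x, hx, hux⟩ := he.hang hu
      refine ⟨x, hx, ?_⟩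
      by_contra hne
      exact Set.notMem_empty _ (hA ▸ mem_cut.2 ⟨hu, core_subset hx, hux.adj, hne⟩)
    obtain ⟨x, hx, hx'⟩ := key a ha
    obtain ⟨y, hy, hy'⟩ := key b hb
    refine ⟨A, ⟨⟨x, hx, hx'.1 haA⟩, y, hy, fun h => hbA (hy'.2 h)⟩, sym2_ext fun c d => ?_⟩
    simp only [Set.mem_empty_iff_false, iff_false]
    intro h
    obtain ⟨h1, h2, h3⟩ := mem_cut.1 h
    exact Set.notMem_empty _ (hA ▸ mem_cut.2 ⟨core_subset h1, core_subset h2, h3⟩)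

end Core

/-! ## Lifting matching cuts from the core -/

/-- The three enumeration problems. -/
inductive Mode where
  | all
  | min
  | max

/-- The matching cuts of `G[S]` to be enumerated. -/
def Sol (m : Mode) (G : SimpleGraph ℕ) (S : Finset ℕ) (M : Set (Sym2 ℕ)) : Prop :=
  match m with
  | .all => MC G S M
  | .min => Minimal (MC G S) M
  | .max => Maximal (MC G S) M

/-- The free edges of `M`, and for each edge of `M` at a hung leaf the edge at the corresponding leaf of
the core. -/
def proj (G : SimpleGraph ℕ) (S : Finset ℕ) (M : Set (Sym2 ℕ)) : Set (Sym2 ℕ) :=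
  Free G S M ∪ {e | ∃ x p v, p ∈ core G S ∧ Hang G S p x ∧ Hang G S v x ∧ s(x, v) ∈ M ∧ e = s(x, p)}

/-- `M` projects to `N`, and its edges in deleted components are as required by the problem. -/
def Lifts (m : Mode) (G : SimpleGraph ℕ) (S : Finset ℕ) (N M : Set (Sym2 ℕ)) : Prop :=
  M ⊆ Edges G S ∧ Mat M ∧ proj G S M = N ∧
    (m = .min → ∀ x v, Hang G S v x → x ∉ core G S → s(x, v) ∉ M) ∧
    (m = .max → ∀ x v, Hang G S v x → x ∉ core G S → s(x, v) ∈ M)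

section Lift

variable {G : SimpleGraph ℕ} {S : Finset ℕ}

theorem Hang.mem_proj {M : Set (Sym2 ℕ)} {x p : ℕ} (h : Hang G S p x) :
    s(x, p) ∈ proj G S M ↔ p ∈ core G S ∧ ∃ v, Hang G S v x ∧ s(x, v) ∈ M := by
  constructor
  · rintro (he | ⟨x', p', v, hp, hpx, hv, hM, he⟩)
    · exact absurd he h.not_free
    · obtain ⟨rfl, rfl⟩ := h.eq_of_edge hpx he
      exact ⟨hp, v, hv, hM⟩
  · rintro ⟨hp, v, hv, hM⟩
    exact Or.inr ⟨x, p, v, hp, h, hv, hM, rfl⟩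

theorem free_proj (M : Set (Sym2 ℕ)) : Free G S (proj G S M) = Free G S M := by
  ext e
  constructor
  · rintro ⟨he | ⟨x, p, v, -, hp, -, -, rfl⟩, h⟩
    · exact he
    · exact absurd hp (h p (by simp) x)
  · exact fun h => ⟨Or.inl h, h.2⟩

theorem proj_mono {M N : Set (Sym2 ℕ)} (h : M ⊆ N) : proj G S M ⊆ proj G S N := by
  rintro e (he | ⟨x, p, v, h1, h2, h3, h4, rfl⟩)
  · exact Or.inl (free_mono h he)
  · exact Or.inr ⟨x, p, v, h1, h2, h3, h h4, rfl⟩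

theorem edges_mono {S' : Finset ℕ} (h : S' ⊆ S) : Edges G S' ⊆ Edges G S := by
  rintro _ ⟨a, ha, b, hb, hab⟩
  exact ⟨a, h ha, b, h hb, hab⟩

theorem CM.edges {M : Set (Sym2 ℕ)} (h : CM G S M) : M ⊆ Edges G S := by
  obtain ⟨⟨A, rfl⟩, -⟩ := h
  exact cut_subset_edges G S A

/-- The free edges stay in the core by `free_cut_core`. A leaf edge only exchanges its leaf, so the
matching condition at its other end is unaffected. -/
theorem CM.proj {M : Set (Sym2 ℕ)} (h : CM G S M) : CM G (core G S) (proj G S M) := by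
  obtain ⟨hM, hE, A, hA⟩ := (cm_iff_free subset_rfl).1 h
  obtain ⟨m1, m2, m3⟩ := (mat_iff hE).1 hM
  have hcut : Free G S M = Free G S (Cut G (core G S) A) := by
    rw [hA, free_cut_core (hA ▸ m1)]
  have hPE : MCKernel.proj G S M ⊆ Edges G (core G S) := by
    rintro e (he | ⟨x, p, v, hp, hpx, -, -, rfl⟩)
    · rw [hcut] at he
      exact cut_subset_edges G _ A he.1
    · exact mem_edges.2 ⟨hpx.mem_core hp, hp, hpx.adj.symm⟩
  refine (cm_iff_free core_subset).2
    ⟨(mat_iff (hPE.trans (edges_mono core_subset))).2 ⟨?_, ?_, ?_⟩, hPE, A, ?_⟩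
  · rwa [free_proj]
  · intro x v w hv hw h1 h2
    exact Hang.core_unique (hv.mem_proj.1 h1).1 (hw.mem_proj.1 h2).1 hv hw
  · intro x v a hv h1 h2
    rw [free_proj] at h2
    obtain ⟨-, w, hw, hwM⟩ := hv.mem_proj.1 h1
    exact m3 x w a hw hwM h2
  · rw [free_proj, hcut]

/-- Only edges of deleted two-vertex components are lost without trace in the projection. -/
theorem eq_empty_of_proj {M : Set (Sym2 ℕ)} (hE : M ⊆ Edges G S) (h : proj G S M = ∅) :
    M = ∅ ∨ ∃ x v, Hang G S v x ∧ x ∉ core G S ∧ s(x, v) ∈ M := by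
  by_contra! hcon
  obtain ⟨⟨e, he⟩, hcon⟩ := hcon
  rcases free_or_hang hE he with hf | ⟨x, v, hv, rfl⟩
  · exact Set.notMem_empty _ (h ▸ Or.inl hf : e ∈ (∅ : Set (Sym2 ℕ)))
  · by_cases hx : x ∈ core G S
    · obtain ⟨p, hp, hpx⟩ := hv.exists_core hx
      exact Set.notMem_empty _ (h ▸ hpx.mem_proj.2 ⟨hp, v, hv, he⟩)
    · exact hcon x v hv hx he

/-- If a nonempty cut projects to the empty set, a complete component was deleted; two others remain
in the core, which is therefore disconnected. -/
theorem MC.proj {M : Set (Sym2 ℕ)} (h : MC G S M) : MC G (core G S) (proj G S M) := by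
  obtain ⟨h1, h2⟩ := mc_iff.1 h
  refine mc_iff.2 ⟨h1.proj, fun h0 => ?_⟩
  rcases eq_empty_of_proj h1.edges h0 with hM | ⟨x, v, hv, hx, -⟩
  · exact disc_core.2 (h2 hM)
  · exact (hv.superfluous hx).disc.1

theorem proj_empty : proj G S ∅ = ∅ := by
  rw [Set.eq_empty_iff_forall_notMem]
  rintro e (he | ⟨x, p, v, -, -, -, h, -⟩)
  exacts [he.1, h]

theorem Lifts.mc {m : Mode} {M N : Set (Sym2 ℕ)} (h : Lifts m G S N M) (hN : MC G (core G S) N) :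
    MC G S M := by
  obtain ⟨hE, hM, rfl, -⟩ := h
  obtain ⟨h1, h2⟩ := mc_iff.1 hN
  refine mc_iff.2 ⟨cm_of_core hE hM h1 (free_proj M).symm, ?_⟩
  rintro rfl
  exact disc_core.1 (h2 proj_empty)

/-! ### Maximal and minimal matching cuts under projection -/

theorem maximal_mc_iff {M : Set (Sym2 ℕ)} :
    Maximal (MC G S) M ↔ MC G S M ∧ ∀ M', CM G S M' → M ⊆ M' → M' ⊆ M := by
  constructor
  · refine fun h => ⟨h.1, fun M' hM' hsub => ?_⟩
    by_cases h0 : M' = ∅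
    · rw [h0]
      exact Set.empty_subset M
    · exact h.2 (mc_iff.2 ⟨hM', fun h => absurd h h0⟩) hsub
  · exact fun h => ⟨h.1, fun M' hM' hsub => h.2 M' (mc_iff.1 hM').1 hsub⟩

/-- If a cut `s` of the core contained the projection properly, its new edges could be added to `M`.
The edge of a deleted two-vertex component can always be added. -/
theorem Maximal.proj {M : Set (Sym2 ℕ)} (h : Maximal (MC G S) M) :
    Maximal (MC G (core G S)) (proj G S M) ∧
      ∀ x v, Hang G S v x → x ∉ core G S → s(x, v) ∈ M := by
  obtain ⟨hM, hmax⟩ := maximal_mc_iff.1 h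
  have hCM := (mc_iff.1 hM).1
  have hE := hCM.edges
  obtain ⟨m1, m2, m3⟩ := (mat_iff hE).1 hCM.2
  refine ⟨maximal_mc_iff.2 ⟨hM.proj, fun s hs hsub => ?_⟩, fun x v hv hx => ?_⟩
  · have hsE := hs.edges
    have hsE' := hsE.trans (edges_mono core_subset)
    obtain ⟨s1, s2, s3⟩ := (mat_iff hsE').1 hs.2
    let M' := M ∪ (s \ MCKernel.proj G S M)
    have hfree : Free G S M' = Free G S s := by
      refine Set.Subset.antisymm ?_ ?_
      · rintro e ⟨he | he, hf⟩
        · exact ⟨hsub (Or.inl ⟨he, hf⟩), hf⟩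
        · exact ⟨he.1, hf⟩
      · rintro e ⟨he, hf⟩
        by_cases hep : e ∈ MCKernel.proj G S M
        · have : e ∈ Free G S (MCKernel.proj G S M) := ⟨hep, hf⟩
          rw [free_proj] at this
          exact ⟨Or.inl this.1, hf⟩
        · exact ⟨Or.inr ⟨he, hep⟩, hf⟩
    have hEM' : M' ⊆ Edges G S := Set.union_subset hE (Set.sdiff_subset.trans hsE')
    -- A new leaf edge at `x` cannot join an old one there: the old one would already have put the
    -- core edge at `x` into the projection.
    have hmix : ∀ x v w, Hang G S v x → Hang G S w x → s(x, v) ∈ M →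
        s(x, w) ∈ s \ MCKernel.proj G S M → False := by
      intro x v w hv hw h1 h2
      exact h2.2 (hw.mem_proj.2 ⟨(mem_edges.1 (hsE h2.1)).2.1, v, hv, h1⟩)
    have hmat : Mat M' := by
      refine (mat_iff hEM').2 ⟨hfree ▸ s1, ?_, ?_⟩
      · rintro x v w hv hw (h1 | h1) (h2 | h2)
        · exact m2 x v w hv hw h1 h2
        · exact (hmix x v w hv hw h1 h2).elim
        · exact (hmix x w v hw hv h2 h1).elim
        · exact s2 x v w hv hw h1.1 h2.1
      · rintro x v a hv h1 h2
        rw [hfree] at h2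
        rcases h1 with h1 | h1
        · have hx := (mem_edges.1 (hsE h2.1)).1
          obtain ⟨p, hp, hpx⟩ := hv.exists_core hx
          exact s3 x p a hpx (hsub (hpx.mem_proj.2 ⟨hp, v, hv, h1⟩)) h2
        · exact s3 x v a hv h1.1 h2
    have hsubM := hmax M' (cm_of_core hEM' hmat hs hfree) Set.subset_union_left
    intro e he
    by_contra hep
    have heM : e ∈ M := hsubM (Or.inr ⟨he, hep⟩)
    rcases free_or_hang hE heM with hf | ⟨x, v, hv, rfl⟩
    · exact hep (Or.inl hf)
    · exact hep (hv.mem_proj.2 ⟨(mem_edges.1 (hsE he)).2.1, v, hv, heM⟩)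
  · have hl := hv.leaf_of_notMem hx
    let M' := insert s(x, v) M
    have hfree : Free G S M' = Free G S M := by
      refine Set.Subset.antisymm ?_ (free_mono (Set.subset_insert _ _))
      rintro e ⟨rfl | he, hf⟩
      · exact absurd hv (hf v (by simp) x)
      · exact ⟨he, hf⟩
    have hEM' : M' ⊆ Edges G S :=
      Set.insert_subset (mem_edges.2 ⟨hv.1.2, hv.1.1, hv.adj.symm⟩) hE
    have hmat : Mat M' := by
      refine (mat_iff hEM').2 ⟨hfree ▸ m1, ?_, ?_⟩
      · intro y u w hu hw h1 h2
        by_cases hy : y = x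
        · subst hy
          rw [hl.2 u hu.1.1 hu.adj.symm, hl.2 w hw.1.1 hw.adj.symm]
        · have hne : ∀ u, Hang G S u y → s(y, u) ∈ M' → s(y, u) ∈ M := by
            rintro u hu (h | h)
            · exact absurd (hu.eq_of_edge hv h).1 hy
            · exact h
          exact m2 y u w hu hw (hne u hu h1) (hne w hw h2)
      · rintro y u a hu (h1 | h1) h2
        · obtain ⟨rfl, rfl⟩ := hu.eq_of_edge hv h1
          rw [hfree] at h2
          obtain ⟨-, ha, hya⟩ := mem_edges.1 (hE h2.1)
          exact hu.not_free (hl.2 a ha hya ▸ h2)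
        · exact m3 y u a hu h1 (hfree ▸ h2)
    exact hmax M' (cm_of_core hEM' hmat hCM.proj (hfree.trans (free_proj M).symm))
      (Set.subset_insert _ _) (Set.mem_insert _ _)

/-- A larger cut has the same projection. At a vertex of the core it has room for a single leaf
edge, which `M` already uses, and `M` contains all edges of the deleted two-vertex components. -/
theorem Lifts.maximal {M N : Set (Sym2 ℕ)} (h : Lifts .max G S N M)
    (hN : Maximal (MC G (core G S)) N) : Maximal (MC G S) M := by
  obtain ⟨hNM, hmax⟩ := maximal_mc_iff.1 hN
  refine maximal_mc_iff.2 ⟨h.mc hNM, fun M' hM' hsub e he => ?_⟩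
  obtain ⟨hE, hM, rfl, -, hk⟩ := h
  have hP := hmax _ hM'.proj (proj_mono hsub)
  rcases free_or_hang hM'.edges he with hf | ⟨x, v, hv, rfl⟩
  · have : e ∈ Free G S (MCKernel.proj G S M) := ⟨hP (Or.inl hf), hf.2⟩
    rw [free_proj] at this
    exact this.1
  · by_cases hx : x ∈ core G S
    · obtain ⟨p, hp, hpx⟩ := hv.exists_core hx
      obtain ⟨-, w, hw, hwM⟩ := hpx.mem_proj.1 (hP (hpx.mem_proj.2 ⟨hp, v, hv, he⟩))
      obtain rfl := hM'.2 x v w he (hsub hwM)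
      exact hwM
    · exact hk rfl x v hv hx

theorem minimal_eq_empty {M : Set (Sym2 ℕ)} (h : Minimal (MC G S) M) (hd : Disc G S) :
    M = ∅ :=
  Set.subset_empty_iff.1 (h.2 (mc_iff.2 ⟨cm_empty G S, fun _ => hd⟩) (Set.empty_subset M))

/-- A smaller cut `s` of the core is lifted to a cut inside `M` from its free edges and the leaf
edges of `M` that project into `s`. If a component was deleted, the graph is disconnected and `M` is
empty. -/
theorem Minimal.proj {M : Set (Sym2 ℕ)} (h : Minimal (MC G S) M) :
    Minimal (MC G (core G S)) (proj G S M) ∧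
      ∀ x v, Hang G S v x → x ∉ core G S → s(x, v) ∉ M := by
  have hCM := (mc_iff.1 h.1).1
  have hE := hCM.edges
  refine ⟨⟨h.1.proj, fun s hs hsub => ?_⟩, fun x v hv hx hM => ?_⟩
  · obtain ⟨hsCM, hs0⟩ := mc_iff.1 hs
    -- This case is separate because an empty edge set is a matching cut only of a disconnected
    -- graph.
    by_cases hs0' : s = ∅
    · rw [minimal_eq_empty h (disc_core.1 (hs0 hs0')), proj_empty]
      exact Set.empty_subset s
    let M' := Free G S s ∪
      {e ∈ M | ∃ x v p, Hang G S v x ∧ Hang G S p x ∧ p ∈ core G S ∧ s(x, p) ∈ s ∧ e = s(x, v)}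
    have hsub' : M' ⊆ M := by
      refine Set.union_subset (fun e he => ?_) fun e he => he.1
      have := free_mono hsub he
      rw [free_proj] at this
      exact this.1
    have hfree : Free G S M' = Free G S s := by
      refine Set.Subset.antisymm ?_ fun e he => ⟨Or.inl he, he.2⟩
      rintro e ⟨he | ⟨-, x, v, p, hv, -, -, -, rfl⟩, hf⟩
      · exact he
      · exact absurd hv (hf v (by simp) x)
    have hM'0 : M' ≠ ∅ := by
      obtain ⟨e, he⟩ := Set.nonempty_iff_ne_empty.2 hs0'
      rcases free_or_hang (hsCM.edges.trans (edges_mono core_subset)) he with hf | ⟨x, p, hp, rfl⟩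
      · exact Set.nonempty_iff_ne_empty.1 ⟨e, Or.inl hf⟩
      · obtain ⟨hpc, v, hv, hvM⟩ := hp.mem_proj.1 (hsub he)
        exact Set.nonempty_iff_ne_empty.1 ⟨s(x, v), Or.inr ⟨hvM, x, v, p, hv, hp, hpc, he, rfl⟩⟩
    have hMC' : MC G S M' := mc_iff.2 ⟨cm_of_core (hsub'.trans hE) (hCM.2.mono hsub') hsCM hfree,
      fun h0 => absurd h0 hM'0⟩
    have hMM' := h.2 hMC' hsub'
    rintro e (he | ⟨x, p, v, hp, hpx, hv, hvM, rfl⟩)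
    · have : e ∈ Free G S M' := ⟨hMM' he.1, he.2⟩
      rw [hfree] at this
      exact this.1
    · rcases hMM' hvM with hf | ⟨-, x', v', p', hv', hp', hpc', hps, he⟩
      · exact absurd hf hv.not_free
      · obtain ⟨rfl, rfl⟩ := hv.eq_of_edge hv' he
        exact (Hang.core_unique hp hpc' hpx hp') ▸ hps
  · rw [minimal_eq_empty h (hv.superfluous hx).disc.2] at hM
    exact hM

theorem Lifts.minimal {M N : Set (Sym2 ℕ)} (h : Lifts .min G S N M)
    (hN : Minimal (MC G (core G S)) N) : Minimal (MC G S) M := by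
  refine ⟨h.mc hN.1, fun M' hM' hsub e he => ?_⟩
  obtain ⟨hE, hM, rfl, hk, -⟩ := h
  have hP := hN.2 hM'.proj (proj_mono hsub)
  rcases free_or_hang hE he with hf | ⟨x, v, hv, rfl⟩
  · have : e ∈ Free G S (MCKernel.proj G S M') := ⟨hP (Or.inl hf), hf.2⟩
    rw [free_proj] at this
    exact this.1
  · by_cases hx : x ∈ core G S
    · obtain ⟨p, hp, hpx⟩ := hv.exists_core hx
      obtain ⟨-, w, hw, hwM⟩ := hpx.mem_proj.1 (hP (hpx.mem_proj.2 ⟨hp, v, hv, he⟩))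
      obtain rfl := hM x v w he (hsub hwM)
      exact hwM
    · exact absurd he (hk rfl x v hv hx)

theorem Sol.mc {m : Mode} {M : Set (Sym2 ℕ)} (h : Sol m G S M) : MC G S M := by
  cases m
  exacts [h, h.1, h.1]

theorem Sol.proj {m : Mode} {M : Set (Sym2 ℕ)} (h : Sol m G S M) :
    Sol m G (core G S) (proj G S M) ∧ Lifts m G S (MCKernel.proj G S M) M := by
  have hCM := (mc_iff.1 h.mc).1
  cases m with
  | all => exact ⟨MC.proj h, hCM.edges, hCM.2, rfl, by simp, by simp⟩
  | min => exact ⟨(Minimal.proj h).1, hCM.edges, hCM.2, rfl, fun _ => (Minimal.proj h).2, by simp⟩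
  | max => exact ⟨(Maximal.proj h).1, hCM.edges, hCM.2, rfl, by simp, fun _ => (Maximal.proj h).2⟩

theorem Lifts.sol {m : Mode} {M N : Set (Sym2 ℕ)} (h : Lifts m G S N M)
    (hN : Sol m G (core G S) N) : Sol m G S M := by
  cases m with
  | all => exact h.mc hN
  | min => exact h.minimal hN
  | max => exact h.maximal hN

/-! ## Lifting by independent choices -/

/-- `N` contains an edge at a leaf hung on `x`. -/
def Sel (G : SimpleGraph ℕ) (S : Finset ℕ) (N : Set (Sym2 ℕ)) (x : ℕ) : Prop :=
  ∃ p ∈ core G S, Hang G S p x ∧ s(x, p) ∈ N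

/-- The options for the vertex `x`: a leaf `y` hung on `x` whose edge is put into the matching cut,
or `y = x` if there is no such leaf. -/
def Opt (m : Mode) (G : SimpleGraph ℕ) (S : Finset ℕ) (N : Set (Sym2 ℕ)) (x y : ℕ) : Prop :=
  (Sel G S N x ∧ Hang G S y x) ∨ ((x ∉ core G S ∧ m ≠ .min) ∧ Hang G S y x) ∨
    (y = x ∧ ¬ Sel G S N x ∧ ¬ ((x ∉ core G S ∧ m = .max) ∧ ∃ b ∈ S, Hang G S b x))

/-- The edge set given by a choice of options. -/
def build (G : SimpleGraph ℕ) (S : Finset ℕ) (n : ℕ) (N : Set (Sym2 ℕ)) (c : ℕ → ℕ) :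
    Set (Sym2 ℕ) :=
  Free G S N ∪ {e | ∃ x < n, c x ≠ x ∧ e = s(x, c x)}

theorem Opt.hang {m : Mode} {N : Set (Sym2 ℕ)} {x y : ℕ} (h : Opt m G S N x y) (hne : y ≠ x) :
    Hang G S y x ∧ (Sel G S N x ∨ x ∉ core G S ∧ m ≠ .min) := by
  rcases h with h | h | h
  · exact ⟨h.2, Or.inl h.1⟩
  · exact ⟨h.2, Or.inr h.1⟩
  · exact absurd h.1 hne

variable {m : Mode} {n : ℕ} {N : Set (Sym2 ℕ)} {c : ℕ → ℕ}

theorem mem_build_hang (hc : ∀ x < n, Opt m G S N x (c x)) {x v : ℕ} (hv : Hang G S v x) :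
    s(x, v) ∈ build G S n N c ↔ x < n ∧ c x = v := by
  constructor
  · rintro (h | ⟨y, hy, hne, he⟩)
    · exact absurd h hv.not_free
    · obtain ⟨rfl, rfl⟩ := hv.eq_of_edge ((hc y hy).hang hne).1 he
      exact ⟨hy, rfl⟩
  · rintro ⟨hx, rfl⟩
    exact Or.inr ⟨x, hx, hv.adj.ne, rfl⟩

theorem free_build (hc : ∀ x < n, Opt m G S N x (c x)) :
    Free G S (build G S n N c) = Free G S N := by
  refine Set.Subset.antisymm ?_ fun e he => ⟨Or.inl he, he.2⟩
  rintro e ⟨he | ⟨x, hx, hne, rfl⟩, hf⟩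
  · exact he
  · exact absurd ((hc x hx).hang hne).1 (hf (c x) (by simp) x)

/-- The options do not interfere: they concern leaf edges at distinct vertices, and a leaf edge at
`x` is offered only where `N` has one or in a deleted component, which `N` does not touch. -/
theorem lifts_build (hS : S ⊆ Finset.range n) (hN : CM G (core G S) N)
    (hc : ∀ x < n, Opt m G S N x (c x)) : Lifts m G S N (build G S n N c) := by
  have hNE := hN.edges
  have hNE' := hNE.trans (edges_mono core_subset)
  obtain ⟨m1, m2, m3⟩ := (mat_iff hNE').1 hN.2
  have hn : ∀ {v x}, Hang G S v x → x < n := fun h => Finset.mem_range.1 (hS h.1.2)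
  have hE : build G S n N c ⊆ Edges G S := by
    rintro e (he | ⟨x, hx, hne, rfl⟩)
    · exact hNE' he.1
    · have := ((hc x hx).hang hne).1
      exact mem_edges.2 ⟨this.1.2, this.1.1, this.adj.symm⟩
  refine ⟨hE, (mat_iff hE).2 ⟨?_, ?_, ?_⟩, ?_, ?_, ?_⟩
  · rwa [free_build hc]
  · intro x v w hv hw h1 h2
    rw [← ((mem_build_hang hc hv).1 h1).2, ← ((mem_build_hang hc hw).1 h2).2]
  · intro x v a hv h1 h2
    rw [free_build hc] at h2
    obtain ⟨hx, rfl⟩ := (mem_build_hang hc hv).1 h1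
    -- Either `N` has its own leaf edge at `x`, hence no free edge there, or `x` is not a vertex of
    -- the core.
    rcases ((hc x hx).hang hv.adj.ne).2 with ⟨p, hp, hpx, hpN⟩ | ⟨h, -⟩
    · exact m3 x p a hpx hpN h2
    · exact h (mem_edges.1 (hNE h2.1)).1
  · have hkey : ∀ x p, Hang G S p x → (s(x, p) ∈ proj G S (build G S n N c) ↔ s(x, p) ∈ N) := by
      intro x p hpx
      rw [hpx.mem_proj]
      constructor
      · rintro ⟨hp, v, hv, h⟩
        obtain ⟨hx, rfl⟩ := (mem_build_hang hc hv).1 h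
        rcases ((hc x hx).hang hv.adj.ne).2 with ⟨q, hq, hqx, hqN⟩ | ⟨h, -⟩
        · exact Hang.core_unique hq hp hqx hpx ▸ hqN
        · exact absurd (hpx.mem_core hp) h
      · intro h
        have hp := (mem_edges.1 (hNE h)).2.1
        have hsel : Sel G S N x := ⟨p, hp, hpx, h⟩
        have hcx : Hang G S (c x) x := by
          rcases hc x (hn hpx) with h | h | h
          exacts [h.2, h.2, absurd hsel h.2.1]
        exact ⟨hp, c x, hcx, (mem_build_hang hc hcx).2 ⟨hn hpx, rfl⟩⟩
    ext e
    constructor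
    · rintro (he | ⟨x, p, v, h1, h2, h3, h4, rfl⟩)
      · rw [free_build hc] at he
        exact he.1
      · exact (hkey x p h2).1 (h2.mem_proj.2 ⟨h1, v, h3, h4⟩)
    · intro he
      rcases free_or_hang hNE' he with hf | ⟨x, p, hp, rfl⟩
      · left
        rwa [free_build hc]
      · exact (hkey x p hp).2 he
  · rintro rfl x v hv hx h
    obtain ⟨hxn, rfl⟩ := (mem_build_hang hc hv).1 h
    rcases ((hc x hxn).hang hv.adj.ne).2 with ⟨p, hp, hpx, -⟩ | ⟨-, h⟩
    · exact hx (hpx.mem_core hp)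
    · exact h rfl
  · rintro rfl x v hv hx
    refine (mem_build_hang hc hv).2 ⟨hn hv, ?_⟩
    have hcx : Hang G S (c x) x := by
      rcases hc x (hn hv) with h | h | h
      exacts [h.2, h.2, absurd ⟨⟨hx, rfl⟩, v, hv.1.1, hv⟩ h.2.2]
    -- In a deleted two-vertex component there is only one leaf to choose.
    exact (hv.leaf_of_notMem hx).2 _ hcx.1.1 hcx.adj.symm

theorem Lifts.exists_build {M : Set (Sym2 ℕ)} (hS : S ⊆ Finset.range n)
    (h : Lifts m G S N M) : ∃ c, (∀ x < n, Opt m G S N x (c x)) ∧ M = build G S n N c := by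
  classical
  obtain ⟨hE, hM, rfl, hmin, hmax⟩ := h
  -- The choice is read off from `M`: the leaf matched to `x`, with `x` itself standing for none.
  let c : ℕ → ℕ := fun x => if h : ∃ v, Hang G S v x ∧ s(x, v) ∈ M then h.choose else x
  have hc1 : ∀ x v, Hang G S v x → s(x, v) ∈ M → c x = v := by
    intro x v hv hvM
    have hex : ∃ v, Hang G S v x ∧ s(x, v) ∈ M := ⟨v, hv, hvM⟩
    have : c x = hex.choose := dif_pos hex
    rw [this]
    exact hM x _ _ hex.choose_spec.2 hvM
  have hc2 : ∀ x, (¬ ∃ v, Hang G S v x ∧ s(x, v) ∈ M) → c x = x := fun x hx => dif_neg hx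
  have hc : ∀ x < n, Opt m G S (MCKernel.proj G S M) x (c x) := by
    intro x _
    by_cases hex : ∃ v, Hang G S v x ∧ s(x, v) ∈ M
    · obtain ⟨v, hv, hvM⟩ := hex
      rw [hc1 x v hv hvM]
      by_cases hx : x ∈ core G S
      · obtain ⟨p, hp, hpx⟩ := hv.exists_core hx
        exact Or.inl ⟨⟨p, hp, hpx, hpx.mem_proj.2 ⟨hp, v, hv, hvM⟩⟩, hv⟩
      · exact Or.inr (Or.inl ⟨⟨hx, fun hm => hmin hm x v hv hx hvM⟩, hv⟩)
    · rw [hc2 x hex]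
      refine Or.inr (Or.inr ⟨rfl, ?_, ?_⟩)
      · rintro ⟨p, -, hpx, hpM⟩
        exact hex (hpx.mem_proj.1 hpM).2
      · rintro ⟨⟨hx, hm⟩, b, -, hb⟩
        exact hex ⟨b, hb, hmax hm x b hb hx⟩
  refine ⟨c, hc, ?_⟩
  ext e
  constructor
  · intro he
    rcases free_or_hang hE he with hf | ⟨x, v, hv, rfl⟩
    · left
      rwa [free_proj]
    · exact (mem_build_hang hc hv).2 ⟨Finset.mem_range.1 (hS hv.1.2), hc1 x v hv he⟩
  · rintro (he | ⟨x, hx, hne, rfl⟩)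
    · rw [free_proj] at he
      exact he.1
    · by_contra hno
      refine hne (hc2 x ?_)
      rintro ⟨v, hv, hvM⟩
      exact hno (hc1 x v hv hvM ▸ hvM)

theorem build_injective {c' : ℕ → ℕ} (hc : ∀ x < n, Opt m G S N x (c x))
    (hc' : ∀ x < n, Opt m G S N x (c' x)) (h : build G S n N c = build G S n N c') :
    ∀ x < n, c x = c' x := by
  intro x hx
  by_cases h1 : c x = x
  · by_contra hne
    have hh := ((hc' x hx).hang (fun h => hne (h1.trans h.symm))).1
    have := (mem_build_hang hc' hh).2 ⟨hx, rfl⟩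
    exact hne ((mem_build_hang hc hh).1 (h ▸ this)).2
  · have hh := ((hc x hx).hang h1).1
    have := (mem_build_hang hc hh).2 ⟨hx, rfl⟩
    exact ((mem_build_hang hc' hh).1 (h ▸ this)).2.symm

/-- Ensures that the search for a least option never fails, so every solution of the kernel has a
lift. -/
theorem exists_opt (hx : ∀ p x, Hang G S p x → p < n) (x : ℕ) (hxn : x < n) :
    ∃ y < n, Opt m G S N x y := by
  by_cases h1 : Sel G S N x
  · have h1' := h1
    obtain ⟨p, hp, hpx, -⟩ := h1
    exact ⟨p, hx p x hpx, Or.inl ⟨h1', hpx⟩⟩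
  by_cases h2 : (x ∉ core G S ∧ m = .max) ∧ ∃ b ∈ S, Hang G S b x
  · obtain ⟨⟨h2, h3⟩, b, -, hb⟩ := h2
    exact ⟨b, hx b x hb, Or.inr (Or.inl ⟨⟨h2, by simp [h3]⟩, hb⟩)⟩
  · exact ⟨x, hxn, Or.inr (Or.inr ⟨rfl, h1, h2⟩)⟩

/-- For minimal matching cuts there is at most one vertex with a choice. -/
theorem exists_choice_vertex (hN : Minimal (MC G (core G S)) N) :
    ∃ x0, ∀ x y, Opt .min G S N x y → x ≠ x0 → y = x := by
  by_cases hsel : ∃ x, Sel G S N x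
  · obtain ⟨x0, p, hp, hpx, hpN⟩ := hsel
    refine ⟨x0, fun x y hxy hne => ?_⟩
    by_contra hyx
    rcases (hxy.hang hyx).2 with ⟨q, hq, hqx, hqN⟩ | ⟨-, h⟩
    -- The leaf edge at `x0` alone is a matching cut, so the minimal `N` has no other edge.
    · have hE := (mc_iff.1 hN.1).1.edges
      have hfree : Free G S {s(x0, p)} = ∅ := by
        rw [Set.eq_empty_iff_forall_notMem]
        rintro e ⟨rfl, hf⟩
        exact hpx.not_free ⟨rfl, hf⟩
      have hmat : Mat {s(x0, p)} := (mc_iff.1 hN.1).1.2.mono (by simpa using hpN)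
      have hsub : {s(x0, p)} ⊆ N := by simpa using hpN
      have hCM : CM G (core G S) {s(x0, p)} := (cm_iff_free core_subset).2
        ⟨hmat, hsub.trans hE, ∅, by
          rw [hfree, eq_comm, Set.eq_empty_iff_forall_notMem]
          rintro e ⟨⟨a, -, b, -, ha, -⟩, -⟩
          exact ha⟩
      have := hN.2 (mc_iff.2 ⟨hCM, by simp⟩) hsub hqN
      exact hne (hqx.eq_of_edge hpx this).1
    · exact h rfl
  · refine ⟨0, fun x y hxy _ => ?_⟩
    by_contra hyx
    rcases (hxy.hang hyx).2 with h | ⟨-, h⟩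
    · exact hsel ⟨x, h⟩
    · exact h rfl

end Lift

/-! ## The size of the core -/

section Bound

open Classical

variable {G : SimpleGraph ℕ} {n : ℕ}

/-- A survivor was present and kept at its own turn; the two properties are only known to fail for
the set of that moment. -/
theorem not_crowded_of_mem_pruned {v : ℕ} (hv : v ∈ pruned G n n) :
    ¬ Crowded G (pruned G n v) v ∧ ¬ Forced G (pruned G n v) v := by
  have hvn : v < n := Finset.mem_range.1 (pruned_subset G n n hv)
  have h1 : v ∈ pruned G n v \ removed G (pruned G n v) v :=
    pruned_anti G n (Nat.succ_le_of_lt hvn) hv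
  obtain ⟨h2, h3⟩ := Finset.mem_sdiff.1 h1
  have h4 : ¬ ((v = v ∧ Crowded G (pruned G n v) v) ∨
      (Twin G (pruned G n v) v v ∧ Forced G (pruned G n v) v)) :=
    fun h => h3 (Finset.mem_filter.2 ⟨h2, h2, h⟩)
  push Not at h4
  exact ⟨h4.1 rfl, h4.2 (Twin.refl G _ v)⟩

/-- The core splits into vertices in cover classes, other vertices of complete components, leaves,
and vertices charged to pairs of cover classes. Classes refer to the original graph because
neighbors used in the charging may be deleted later. -/
theorem card_core_le {β : Type*} (cls : ℕ → β) (Y : Finset β)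
    (h1 : ∀ u < n, ∀ v < n, cls u = cls v → Twin G (Finset.range n) u v)
    (h2 : ∀ u < n, ∀ v < n, G.Adj u v → cls u = cls v ∨ cls u ∈ Y ∨ cls v ∈ Y) :
    (core G (pruned G n n)).card ≤ 11 * (Y.card ^ 2 + 1) := by
  set S := pruned G n n with hS
  have hSn : ∀ v ∈ S, v < n := fun v hv => Finset.mem_range.1 (pruned_subset G n n hv)
  have hSv : ∀ v ∈ S, S ⊆ pruned G n v := fun v hv => pruned_anti G n (hSn v hv).le
  have htw : ∀ u ∈ S, ∀ v ∈ S, cls u = cls v → ∀ k, Twin G (pruned G n k) u v :=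
    fun u hu v hv h k => (h1 u (hSn u hu) v (hSn v hv) h).mono (pruned_subset G n k)
  -- Of four survivors in one class, any `v` had the other three as twins at its turn and was
  -- crowded.
  have hclass : ∀ b, (S.filter fun v => cls v = b).card ≤ 3 := by
    intro b
    by_contra! hcard
    obtain ⟨v, hv⟩ := Finset.card_pos.1 (by omega : 0 < (S.filter fun v => cls v = b).card)
    have h3 : 2 < ((S.filter fun v => cls v = b).erase v).card := by
      rw [Finset.card_erase_of_mem hv]
      omega
    obtain ⟨x, hx, y, hy, z, hz, hxy, hxz, hyz⟩ := Finset.two_lt_card.1 h3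
    simp only [Finset.mem_erase, Finset.mem_filter] at hx hy hz hv
    have key : ∀ x ∈ S, cls x = b → Twin G (pruned G n v) v x := fun x hx hb =>
      htw v hv.1 x hx (hv.2.trans hb.symm) v
    exact (not_crowded_of_mem_pruned hv.1).1 ⟨x, hSv v hv.1 hx.2.1, y, hSv v hv.1 hy.2.1, z,
      hSv v hv.1 hz.2.1, ⟨hxy, hxz, hyz⟩, ⟨hx.1.symm, hy.1.symm, hz.1.symm⟩,
      key x hx.2.1 hx.2.2, key y hy.2.1 hy.2.2, key z hz.2.1 hz.2.2⟩
  -- the vertices in cover classes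
  let Z1 := S.filter fun v => cls v ∈ Y
  have hZ1 : Z1.card ≤ 3 * Y.card := by
    refine Finset.card_le_mul_card_image_of_maps_to (f := cls)
      (fun v hv => (Finset.mem_filter.1 hv).2) 3 fun b _ => (Finset.card_le_card ?_).trans (hclass b)
    intro v hv
    simp only [Finset.mem_filter] at hv ⊢
    exact ⟨hv.1.1, hv.2⟩
  -- the other vertices of complete components
  let Z2 := (core G S).filter fun v => cls v ∉ Y ∧ Closed G S v
  have hZ2 : Z2.card ≤ 6 := by
    -- In a complete component the vertices outside cover classes are adjacent, hence in one class.
    have hcomp : ∀ u ∈ S, Closed G S u →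
        (Z2.filter fun v => v = u ∨ G.Adj u v).card ≤ 3 := by
      intro u hu hc
      rcases (Z2.filter fun v => v = u ∨ G.Adj u v).eq_empty_or_nonempty with h0 | ⟨v, hv⟩
      · simp [h0]
      refine (Finset.card_le_card fun w hw => ?_).trans (hclass (cls v))
      simp only [Z2, Finset.mem_filter] at hv hw ⊢
      have hvS := core_subset hv.1.1
      have hwS := core_subset hw.1.1
      refine ⟨hwS, ?_⟩
      by_cases hvw : w = v
      · rw [hvw]
      have hadj : G.Adj w v := by
        rcases hv.2 with rfl | h <;> rcases hw.2 with rfl | h'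
        · exact absurd rfl hvw
        · exact h'.symm
        · exact h
        · exact ((hc v hvS h).adj hwS hvw h').symm
      rcases h2 w (hSn w hwS) v (hSn v hvS) hadj with h | h | h
      · exact h
      · exact absurd h hw.1.2.1
      · exact absurd h hv.1.2.1
    by_cases hex : ∃ u, u ∈ S ∧ Closed G S u
    swap
    · have : Z2 = ∅ := by
        rw [Finset.eq_empty_iff_forall_notMem]
        intro v hv
        simp only [Z2, Finset.mem_filter] at hv
        exact hex ⟨v, core_subset hv.1, hv.2.2⟩
      simp [this]
    obtain ⟨hu, huc⟩ := Nat.find_spec hex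
    have humin : ∀ z ∈ S, Closed G S z → Nat.find hex ≤ z :=
      fun z hz hzc => Nat.find_min' hex ⟨hz, hzc⟩
    set u := Nat.find hex
    have hsplit : ∀ v ∈ Z2, ¬ (v = u ∨ G.Adj u v) →
        ∃ w ∈ S, (Closed G S w ∧ ¬ (w = u ∨ G.Adj u w)) ∧
        ∀ z ∈ S, Closed G S z → ¬ (z = u ∨ G.Adj u z) → w ≤ z := by
      intro v hv hvu
      simp only [Z2, Finset.mem_filter] at hv
      have hex' : ∃ w, w ∈ S ∧ Closed G S w ∧ ¬ (w = u ∨ G.Adj u w) :=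
        ⟨v, core_subset hv.1, hv.2.2, hvu⟩
      exact ⟨Nat.find hex', (Nat.find_spec hex').1, (Nat.find_spec hex').2,
        fun z hz hzc hzu => Nat.find_min' hex' ⟨hz, hzc, hzu⟩⟩
    by_cases hall : ∀ v ∈ Z2, v = u ∨ G.Adj u v
    · have := hcomp u hu huc
      rw [Finset.filter_true_of_mem hall] at this
      omega
    push Not at hall
    obtain ⟨v0, hv0, hv0u⟩ := hall
    obtain ⟨w, hw, ⟨hwc, hwu⟩, hwmin⟩ := hsplit v0 hv0 (by tauto)
    -- The vertices `u` and `w` are the smallest of two complete components; a further one has only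
    -- larger vertices and is superfluous.
    have hcover : Z2 ⊆ (Z2.filter fun v => v = u ∨ G.Adj u v) ∪
        (Z2.filter fun v => v = w ∨ G.Adj w v) := by
      intro v hv
      rw [Finset.mem_union]
      by_contra hcon
      have hvu : ¬ (v = u ∨ G.Adj u v) := fun h => hcon (Or.inl (Finset.mem_filter.2 ⟨hv, h⟩))
      have hvw : ¬ (v = w ∨ G.Adj w v) := fun h => hcon (Or.inr (Finset.mem_filter.2 ⟨hv, h⟩))
      simp only [Z2, Finset.mem_filter] at hv
      have hvS := core_subset hv.1
      refine (mem_core.1 hv.1).2.1 ⟨hv.2.2, u, hu, w, hw, ⟨huc, hwc⟩,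
        ⟨fun h => hwu (Or.inl h.symm), fun h => hwu (Or.inr h)⟩, ⟨?_, ?_⟩, ?_⟩
      · exact lt_of_le_of_ne (humin v hvS hv.2.2) fun h => hvu (Or.inl h.symm)
      · exact lt_of_le_of_ne (hwmin v hvS hv.2.2 hvu) fun h => hvw (Or.inl h.symm)
      · intro y hy hvy
        have hyc := hv.2.2.adj hvS hy hvy
        have hyu : ¬ (y = u ∨ G.Adj u y) := by
          rintro (rfl | h)
          · exact hvu (Or.inr hvy.symm)
          · by_cases hvu' : v = u
            · exact hvu (Or.inl hvu')
            · exact hvu (Or.inr ((huc y hy h).symm.adj hvS hvu' hvy.symm))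
        exact ⟨lt_of_le_of_ne (humin y hy hyc) fun h => hyu (Or.inl h.symm),
          lt_of_le_of_ne (hwmin y hy hyc hyu) (by
            rintro rfl
            exact hvw (Or.inr hvy.symm))⟩
    have := (Finset.card_le_card hcover).trans (Finset.card_union_le _ _)
    have h3 := hcomp u hu huc
    have h4 := hcomp w hw hwc
    omega
  have houter : ∀ v ∈ S, cls v ∉ Y → ∀ x ∈ S, G.Adj v x → ∀ k, ¬ Twin G (pruned G n k) v x →
      cls x ∈ Y := by
    intro v hv hvY x hx hvx k hk
    rcases h2 v (hSn v hv) x (hSn x hx) hvx with h | h | h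
    · exact absurd (htw v hv x hx h k) hk
    · exact absurd h hvY
    · exact h
  -- leaves
  let Z3 := (core G S).filter fun v => (cls v ∉ Y ∧ ¬ Closed G S v) ∧ ∃ x ∈ S, Leaf G S v x
  have hZ3 : Z3.card ≤ 3 * Y.card := by
    have hch : ∀ v, v ∈ Z3 → ∃ x ∈ Z1, Leaf G S v x := by
      intro v hv
      simp only [Z3, Finset.mem_filter] at hv
      obtain ⟨hvc, ⟨hvY, hcl⟩, x, hx, hvx⟩ := hv
      refine ⟨x, Finset.mem_filter.2 ⟨hx, ?_⟩, hvx⟩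
      refine houter v (core_subset hvc) hvY x hx hvx.1 n fun htw => hcl fun w hw hvw => ?_
      rw [hvx.2 w hw hvw]
      exact htw
    choose! f hf hleaf using hch
    refine (Finset.card_le_card_of_injOn f hf ?_).trans hZ1
    intro v hv w hw hvw
    have hvS := (mem_core.1 (Finset.mem_filter.1 hv).1)
    have hwS := (mem_core.1 (Finset.mem_filter.1 hw).1)
    have hx : f v ∈ S := (Finset.mem_filter.1 (hf v hv)).1
    have l1 := hleaf v hv
    have l2 := hleaf w hw
    rw [← hvw] at l2
    rcases lt_trichotomy v w with h | h | h
    · exact absurd ⟨f v, hx, l2, v, hvS.1, h, l1⟩ hwS.2.2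
    · exact h
    · exact absurd ⟨f v, hx, l1, w, hwS.1, h, l2⟩ hvS.2.2
  -- vertices adjacent to two cover classes with few common neighbors
  let Z4 := (core G S).filter fun v => (cls v ∉ Y ∧ ¬ Closed G S v) ∧ ¬ ∃ x ∈ S, Leaf G S v x
  have hZ4 : Z4.card ≤ 5 * (Y ×ˢ Y).card := by
    -- Since `v` was not forced, it has two outer neighbors that are not linked. They were present
    -- at the turn of `v` and lie in cover classes.
    have hch : ∀ v, v ∈ Z4 → ∃ q : ℕ × ℕ, (q.1 < n ∧ q.2 < n) ∧ (cls q.1 ∈ Y ∧ cls q.2 ∈ Y) ∧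
        (q.1 ∈ pruned G n v ∧ q.2 ∈ pruned G n v) ∧
        (G.Adj v q.1 ∧ G.Adj v q.2) ∧ ¬ Linked G (pruned G n v) v q.1 q.2 := by
      intro v hv
      simp only [Z4, Finset.mem_filter] at hv
      obtain ⟨hvc, ⟨hvY, hcl⟩, hl⟩ := hv
      have hvS := core_subset hvc
      have hnf := (not_crowded_of_mem_pruned hvS).2
      have hw : ∃ w ∈ S, G.Adj v w ∧ ¬ Twin G S v w := by
        simp only [Closed] at hcl
        push Not at hcl
        exact hcl
      obtain ⟨w, hw, hvw, htw'⟩ := hw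
      have hw2 : ∃ y ∈ S, G.Adj v y ∧ y ≠ w := by
        by_contra! hno
        exact hl ⟨w, hw, hvw, hno⟩
      obtain ⟨y, hy, hvy, hyw⟩ := hw2
      have hsub := hSv v hvS
      have hpair : ∃ x ∈ pruned G n v, ∃ y ∈ pruned G n v, x ≠ y ∧ Outer G (pruned G n v) v x ∧
          Outer G (pruned G n v) v y ∧ ¬ Linked G (pruned G n v) v x y := by
        by_contra! hno
        exact hnf ⟨⟨w, hsub hw, hvw, fun h => htw' (h.mono hsub)⟩,
          ⟨y, hsub hy, w, hsub hw, hyw, hvy, hvw⟩, hno⟩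
      obtain ⟨x, hx, y, hy, -, ⟨hvx, htx⟩, ⟨hvy, hty⟩, hlink⟩ := hpair
      have hin : ∀ x ∈ pruned G n v, G.Adj v x → ¬ Twin G (pruned G n v) v x →
          x < n ∧ cls x ∈ Y := by
        intro x hx hvx htx
        have hxn : x < n := Finset.mem_range.1 (pruned_subset G n v hx)
        refine ⟨hxn, ?_⟩
        rcases h2 v (hSn v hvS) x hxn hvx with h | h | h
        · exact absurd ((h1 v (hSn v hvS) x hxn h).mono (pruned_subset G n v)) htx
        · exact absurd h hvY
        · exact h
      obtain ⟨a1, a2⟩ := hin x hx hvx htx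
      obtain ⟨b1, b2⟩ := hin y hy hvy hty
      exact ⟨(x, y), ⟨a1, b1⟩, ⟨a2, b2⟩, ⟨hx, hy⟩, ⟨hvx, hvy⟩, hlink⟩
    choose! f hfn hfY hfp hfadj hflink using hch
    refine Finset.card_le_mul_card_image_of_maps_to (f := fun v => (cls (f v).1, cls (f v).2))
      (fun v hv => Finset.mem_product.2 (hfY v hv)) 5 fun b _ => ?_
    by_contra! hcard
    set T := Z4.filter fun v => (cls (f v).1, cls (f v).2) = b with hT
    obtain ⟨v, hvT⟩ := Finset.card_pos.1 (by omega : 0 < T.card)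
    obtain ⟨hv, hvb⟩ := Finset.mem_filter.1 hvT
    have hv4 := Finset.mem_filter.1 hv
    have hvS := core_subset hv4.1
    -- The fiber has at least six elements, and at most three of them are in the class of `v`.
    have h3 : 2 < (T.filter fun u => ¬ cls u = cls v).card := by
      have e1 := Finset.card_filter_add_card_filter_not (s := T) (fun u => cls u = cls v)
      have e2 : (T.filter fun u => cls u = cls v).card ≤ 3 := by
        refine (Finset.card_le_card fun u hu => ?_).trans (hclass (cls v))
        rw [Finset.mem_filter] at hu ⊢
        exact ⟨core_subset (Finset.mem_filter.1 (Finset.mem_filter.1 hu.1).1).1, hu.2⟩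
      omega
    obtain ⟨a, ha, a', ha', a'', ha'', n1, n2, n3⟩ := Finset.two_lt_card.1 h3
    have key : ∀ a ∈ T.filter fun u => ¬ cls u = cls v, a ∈ pruned G n v ∧
        G.Adj (f v).1 a ∧ G.Adj (f v).2 a ∧ ¬ Twin G (pruned G n v) v a := by
      intro a ha
      obtain ⟨haT, hav⟩ := Finset.mem_filter.1 ha
      obtain ⟨ha4, hab⟩ := Finset.mem_filter.1 haT
      have haZ := Finset.mem_filter.1 ha4
      have haS := core_subset haZ.1
      have hbb := Prod.mk.inj (hab.trans hvb.symm)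
      -- The vertex `a` is adjacent to its own pair, whose members are twins of those in the pair of
      -- `v`.
      have hadj : ∀ x y, x < n → y < n → cls x ∈ Y → cls x = cls y → G.Adj a y → G.Adj x a := by
        intro x y hx hy hxY hxy hay
        refine (h1 y hy x hx hxy.symm).adj (Finset.mem_range.2 (hSn a haS)) ?_ hay.symm
        rintro rfl
        exact haZ.2.1.1 hxY
      refine ⟨hSv v hvS haS, ?_, ?_, fun htw' => ?_⟩
      · exact hadj _ _ (hfn v hv).1 (hfn a ha4).1 (hfY v hv).1 hbb.1.symm (hfadj a ha4).1
      · exact hadj _ _ (hfn v hv).2 (hfn a ha4).2 (hfY v hv).2 hbb.2.symm (hfadj a ha4).2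
      · have hva : v ≠ a := by
          rintro rfl
          exact hav rfl
        rcases h2 v (hSn v hvS) a (hSn a haS) (htw'.1.resolve_left hva) with h | h | h
        · exact hav h.symm
        · exact hv4.2.1.1 h
        · exact haZ.2.1.1 h
    obtain ⟨k1, k2, k3, k4⟩ := key a ha
    obtain ⟨k1', k2', k3', k4'⟩ := key a' ha'
    obtain ⟨k1'', k2'', k3'', k4''⟩ := key a'' ha''
    exact hflink v hv ⟨a, k1, a', k1', a'', k1'', ⟨n1, n2, n3⟩, ⟨k2, k3, k4⟩, ⟨k2', k3', k4'⟩,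
      k2'', k3'', k4''⟩
  have hcover : core G S ⊆ Z1 ∪ (Z2 ∪ (Z3 ∪ Z4)) := by
    intro v hv
    simp only [Z1, Z2, Z3, Z4, Finset.mem_union, Finset.mem_filter]
    have := core_subset hv
    by_cases c1 : cls v ∈ Y
    · exact Or.inl ⟨this, c1⟩
    by_cases c2 : Closed G S v
    · exact Or.inr (Or.inl ⟨hv, c1, c2⟩)
    by_cases c3 : ∃ x ∈ S, Leaf G S v x
    · exact Or.inr (Or.inr (Or.inl ⟨hv, ⟨c1, c2⟩, c3⟩))
    · exact Or.inr (Or.inr (Or.inr ⟨hv, ⟨c1, c2⟩, c3⟩))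
  have := Finset.card_le_card hcover
  have e1 := Finset.card_union_le Z1 (Z2 ∪ (Z3 ∪ Z4))
  have e2 := Finset.card_union_le Z2 (Z3 ∪ Z4)
  have e3 := Finset.card_union_le Z3 Z4
  rw [Finset.card_product] at hZ4
  -- With `k = Y.card` the total is `5k² + 6k + 6`, and `k ≤ k²`.
  nlinarith [sq_nonneg ((Y.card : ℤ) - 1), Nat.le_self_pow (two_ne_zero) Y.card]

end Bound

/-! ## Formulas for the graph-theoretic notions -/

/-- Equality of two variables. -/
def eqF (u v : ℕ) : Fm :=
  .atom (.sub (.const 1) (.add (.sub (.var u) (.var v)) (.sub (.var v) (.var u))))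

/-- Comparison of two variables. -/
def ltF (u v : ℕ) : Fm := .atom (.sub (.var v) (.var u))

/-- The cell of array `a` given by a variable is nonzero. -/
def inF (a u : ℕ) : Fm := .atom (.get a (.var u))

/-- The entry of a matrix stored row by row in array `a`. -/
def matF (a u v : ℕ) : Fm := .atom (.get a (.add (.get 3 (.var u)) (.var v)))

/-- Quantification over the set stored in array `a`. -/
def exS (a i : ℕ) (φ : Fm) : Fm := .ex i (.and (inF a i) φ)

/-- Quantification over the set stored in array `a`. -/
def allS (a i : ℕ) (φ : Fm) : Fm := .not (exS a i (.not φ))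

/-- Implication. -/
def impF (φ ψ : Fm) : Fm := .or (.not φ) ψ

/-- The arrays store the graph `G` and the set `S`, the latter in array `a`. -/
structure Env (G : SimpleGraph ℕ) (n : ℕ) (S : Finset ℕ) (a : ℕ) (A : ℕ → ℕ → ℕ) : Prop where
  row : ∀ i < n, A 3 i = i * n
  adj : ∀ i < n, ∀ j < n, (A 0 (i * n + j) ≠ 0 ↔ G.Adj i j)
  mem : ∀ v < n, (A a v ≠ 0 ↔ v ∈ S)
  sub : S ⊆ Finset.range n

section Sat

variable {G : SimpleGraph ℕ} {n : ℕ} {S : Finset ℕ} {a : ℕ} {A : ℕ → ℕ → ℕ} {σ : State}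
  {u v w x y z d i : ℕ}

theorem sat_and {φ ψ : Fm} {p q : Prop} (h : φ.sat σ ↔ p) (h' : ψ.sat σ ↔ q) :
    (Fm.and φ ψ).sat σ ↔ p ∧ q := and_congr h h'

theorem sat_or {φ ψ : Fm} {p q : Prop} (h : φ.sat σ ↔ p) (h' : ψ.sat σ ↔ q) :
    (Fm.or φ ψ).sat σ ↔ p ∨ q := or_congr h h'

theorem sat_not {φ : Fm} {p : Prop} (h : φ.sat σ ↔ p) : (Fm.not φ).sat σ ↔ ¬ p := not_congr h

theorem sat_imp {φ ψ : Fm} {p q : Prop} (h : φ.sat σ ↔ p) (h' : ψ.sat σ ↔ q) :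
    (impF φ ψ).sat σ ↔ (p → q) := by
  simp only [impF, Fm.sat, h, h', imp_iff_not_or]

/-- The values of variables are supplied by automatic arguments, so that the correctness proofs
below copy the shape of the formulas. -/
theorem sat_eq
    (hu : σ.var u = x := by first | assumption | simp (disch := omega) only [State.setv_ne, State.setv_self, *])
    (hv : σ.var v = y := by first | assumption | simp (disch := omega) only [State.setv_ne, State.setv_self, *]) :
    (eqF u v).sat σ ↔ x = y := by
  simp only [eqF, Fm.sat, Expr.eval, hu, hv]
  omega

theorem sat_lt
    (hu : σ.var u = x := by first | assumption | simp (disch := omega) only [State.setv_ne, State.setv_self, *])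
    (hv : σ.var v = y := by first | assumption | simp (disch := omega) only [State.setv_ne, State.setv_self, *]) :
    (ltF u v).sat σ ↔ x < y := by
  simp only [ltF, Fm.sat, Expr.eval, hu, hv]
  omega

theorem sat_in (h : Env G n S a A) (hx : x < n)
    (hA : σ.arr = A := by assumption)
    (hu : σ.var u = x := by first | assumption | simp (disch := omega) only [State.setv_ne, State.setv_self, *]) :
    (inF a u).sat σ ↔ x ∈ S := by
  simp only [inF, Fm.sat, Expr.eval, hu, hA]
  exact h.mem x hx

theorem sat_adj (h : Env G n S a A) (hx : x < n) (hy : y < n)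
    (hA : σ.arr = A := by assumption)
    (hu : σ.var u = x := by first | assumption | simp (disch := omega) only [State.setv_ne, State.setv_self, *])
    (hv : σ.var v = y := by first | assumption | simp (disch := omega) only [State.setv_ne, State.setv_self, *]) :
    (matF 0 u v).sat σ ↔ G.Adj x y := by
  simp only [matF, Fm.sat, Expr.eval, hu, hv, hA, h.row x hx]
  exact h.adj x hx y hy

theorem Env.lt (h : Env G n S a A) (hx : x ∈ S) : x < n := Finset.mem_range.1 (h.sub hx)

theorem sat_exS (h : Env G n S a A) {φ : Fm} {p : ℕ → Prop}
    (hφ : ∀ k ∈ S, k < n → (φ.sat (σ.setv i k) ↔ p k))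
    (hA : σ.arr = A := by assumption)
    (h3 : σ.var 3 = n := by first | assumption | simp (disch := omega) only [State.setv_ne, *]) :
    (exS a i φ).sat σ ↔ ∃ k ∈ S, p k := by
  simp only [exS, Fm.sat, h3]
  constructor
  · rintro ⟨k, hk, h1, h2⟩
    have hkS := (sat_in (σ := σ.setv i k) h hk hA (σ.setv_self i k)).1 h1
    exact ⟨k, hkS, (hφ k hkS hk).1 h2⟩
  · rintro ⟨k, hkS, h2⟩
    have hk := h.lt hkS
    exact ⟨k, hk, (sat_in (σ := σ.setv i k) h hk hA (σ.setv_self i k)).2 hkS, (hφ k hkS hk).2 h2⟩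

theorem sat_allS (h : Env G n S a A) {φ : Fm} {p : ℕ → Prop}
    (hφ : ∀ k ∈ S, k < n → (φ.sat (σ.setv i k) ↔ p k))
    (hA : σ.arr = A := by assumption)
    (h3 : σ.var 3 = n := by first | assumption | simp (disch := omega) only [State.setv_ne, *]) :
    (allS a i φ).sat σ ↔ ∀ k ∈ S, p k := by
  rw [allS, Fm.sat, sat_exS h (fun k hk hkn => sat_not (hφ k hk hkn)) hA h3]
  push Not
  rfl

/-- `u` and `v` are true twins. -/
def twinF (a u v d : ℕ) : Fm :=
  .and (.or (eqF u v) (matF 0 u v)) (allS a d (impF (.not (eqF d u)) (impF (.not (eqF d v))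
    (.and (impF (matF 0 u d) (matF 0 v d)) (impF (matF 0 v d) (matF 0 u d))))))

theorem sat_twin (h : Env G n S a A) (hx : x < n) (hy : y < n)
    (hA : σ.arr = A := by assumption)
    (h3 : σ.var 3 = n := by first | assumption | simp (disch := omega) only [State.setv_ne, *])
    (hu : σ.var u = x := by first | assumption | simp (disch := omega) only [State.setv_ne, State.setv_self, *])
    (hv : σ.var v = y := by first | assumption | simp (disch := omega) only [State.setv_ne, State.setv_self, *])
    (_hd : 3 < d := by omega) (hud : u < d := by omega) (hvd : v < d := by omega) :
    (twinF a u v d).sat σ ↔ Twin G S x y := by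
  refine sat_and (sat_or sat_eq (sat_adj h hx hy)) (sat_allS h fun k hk hkn =>
    sat_imp (sat_not sat_eq) (sat_imp (sat_not sat_eq)
      (Iff.trans (sat_and (sat_imp (sat_adj h hx hkn) (sat_adj h hy hkn))
        (sat_imp (sat_adj h hy hkn) (sat_adj h hx hkn))) iff_def.symm)))

/-- The three variables are distinct. -/
def distinctF (u v w : ℕ) : Fm :=
  .and (.not (eqF u v)) (.and (.not (eqF u w)) (.not (eqF v w)))

/-- `v` has three further true twins. -/
def crowdedF (a v d : ℕ) : Fm :=
  exS a d (exS a (d + 2) (exS a (d + 4) (.and (distinctF d (d + 2) (d + 4))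
    (.and (.and (.not (eqF v d)) (.and (.not (eqF v (d + 2))) (.not (eqF v (d + 4)))))
      (.and (twinF a v d (d + 6)) (.and (twinF a v (d + 2) (d + 6)) (twinF a v (d + 4) (d + 6))))))))

theorem sat_crowded (h : Env G n S a A) (hx : x < n)
    (hA : σ.arr = A := by assumption)
    (h3 : σ.var 3 = n := by first | assumption | simp (disch := omega) only [State.setv_ne, *])
    (hv : σ.var v = x := by first | assumption | simp (disch := omega) only [State.setv_ne, State.setv_self, *])
    (hd : 3 < d := by omega) (hvd : v < d := by omega) :
    (crowdedF a v d).sat σ ↔ Crowded G S x :=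
  sat_exS h fun _ _ hp => sat_exS h fun _ _ hq => sat_exS h fun _ _ hr =>
    sat_and (sat_and (sat_not sat_eq) (sat_and (sat_not sat_eq) (sat_not sat_eq)))
      (sat_and (sat_and (sat_not sat_eq) (sat_and (sat_not sat_eq) (sat_not sat_eq)))
        (sat_and (sat_twin h hx hp) (sat_and (sat_twin h hx hq) (sat_twin h hx hr))))

/-- `w` is a neighbor of `v` but not a true twin. -/
def outerF (a v w d : ℕ) : Fm := .and (matF 0 v w) (.not (twinF a v w d))

theorem sat_outer (h : Env G n S a A) (hx : x < n) (hy : y < n)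
    (hA : σ.arr = A := by assumption)
    (h3 : σ.var 3 = n := by first | assumption | simp (disch := omega) only [State.setv_ne, *])
    (hu : σ.var u = x := by first | assumption | simp (disch := omega) only [State.setv_ne, State.setv_self, *])
    (hv : σ.var v = y := by first | assumption | simp (disch := omega) only [State.setv_ne, State.setv_self, *])
    (hd : 3 < d := by omega) (hud : u < d := by omega) (hvd : v < d := by omega) :
    (outerF a u v d).sat σ ↔ Outer G S x y :=
  sat_and (sat_adj h hx hy) (sat_not (sat_twin h hx hy))

/-- `c` is a common neighbor of `x` and `y` that is not a true twin of `v`. -/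
def commonF (a v x y c d : ℕ) : Fm :=
  .and (matF 0 x c) (.and (matF 0 y c) (.not (twinF a v c d)))

/-- Some three common neighbors of `x` and `y` are not true twins of `v`. -/
def linkedF (a v x y d : ℕ) : Fm :=
  exS a d (exS a (d + 2) (exS a (d + 4) (.and (distinctF d (d + 2) (d + 4))
    (.and (commonF a v x y d (d + 6)) (.and (commonF a v x y (d + 2) (d + 6))
      (commonF a v x y (d + 4) (d + 6)))))))

theorem sat_linked (h : Env G n S a A) (hx : x < n) (hy : y < n) (hz : z < n)
    (hA : σ.arr = A := by assumption)
    (h3 : σ.var 3 = n := by first | assumption | simp (disch := omega) only [State.setv_ne, *])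
    (hu : σ.var u = x := by first | assumption | simp (disch := omega) only [State.setv_ne, State.setv_self, *])
    (hv : σ.var v = y := by first | assumption | simp (disch := omega) only [State.setv_ne, State.setv_self, *])
    (hw : σ.var w = z := by first | assumption | simp (disch := omega) only [State.setv_ne, State.setv_self, *])
    (hd : 3 < d := by omega) (hud : u < d := by omega) (hvd : v < d := by omega)
    (hwd : w < d := by omega) :
    (linkedF a u v w d).sat σ ↔ Linked G S x y z :=
  sat_exS h fun _ _ hp => sat_exS h fun _ _ hq => sat_exS h fun _ _ hr =>
    sat_and (sat_and (sat_not sat_eq) (sat_and (sat_not sat_eq) (sat_not sat_eq)))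
      (sat_and (sat_and (sat_adj h hy hp) (sat_and (sat_adj h hz hp) (sat_not (sat_twin h hx hp))))
        (sat_and (sat_and (sat_adj h hy hq) (sat_and (sat_adj h hz hq) (sat_not (sat_twin h hx hq))))
          (sat_and (sat_adj h hy hr) (sat_and (sat_adj h hz hr) (sat_not (sat_twin h hx hr))))))

/-- The vertex `v` is forced. -/
def forcedF (a v d : ℕ) : Fm :=
  .and (exS a d (outerF a v d (d + 2)))
    (.and (exS a d (exS a (d + 2) (.and (.not (eqF d (d + 2)))
        (.and (matF 0 v d) (matF 0 v (d + 2))))))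
      (allS a d (allS a (d + 2) (impF (.not (eqF d (d + 2))) (impF (outerF a v d (d + 4))
        (impF (outerF a v (d + 2) (d + 4)) (linkedF a v d (d + 2) (d + 4))))))))

theorem sat_forced (h : Env G n S a A) (hx : x < n)
    (hA : σ.arr = A := by assumption)
    (h3 : σ.var 3 = n := by first | assumption | simp (disch := omega) only [State.setv_ne, *])
    (hv : σ.var v = x := by first | assumption | simp (disch := omega) only [State.setv_ne, State.setv_self, *])
    (hd : 3 < d := by omega) (hvd : v < d := by omega) :
    (forcedF a v d).sat σ ↔ Forced G S x :=
  sat_and (sat_exS h fun _ _ hp => sat_outer h hx hp)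
    (sat_and (sat_exS h fun _ _ hp => sat_exS h fun _ _ hq => sat_and (sat_not sat_eq)
        (sat_and (sat_adj h hx hp) (sat_adj h hx hq)))
      (sat_allS h fun _ _ hp => sat_allS h fun _ _ hq => sat_imp (sat_not sat_eq)
        (sat_imp (sat_outer h hx hp) (sat_imp (sat_outer h hx hq) (sat_linked h hx hp hq)))))

/-- The vertex `u` remains when `v` is processed. -/
def remainsF (a u v d : ℕ) : Fm :=
  .and (inF a u) (.not (.and (inF a v) (.or (.and (eqF u v) (crowdedF a v d))
    (.and (twinF a v u d) (forcedF a v d)))))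

theorem sat_remains (h : Env G n S a A) (hx : x < n) (hy : y < n)
    (hA : σ.arr = A := by assumption)
    (h3 : σ.var 3 = n := by first | assumption | simp (disch := omega) only [State.setv_ne, *])
    (hu : σ.var u = x := by first | assumption | simp (disch := omega) only [State.setv_ne, State.setv_self, *])
    (hv : σ.var v = y := by first | assumption | simp (disch := omega) only [State.setv_ne, State.setv_self, *])
    (hd : 3 < d := by omega) (hud : u < d := by omega) (hvd : v < d := by omega) :
    (remainsF a u v d).sat σ ↔ x ∈ S \ removed G S y := by
  have h1 := sat_and (sat_in h hx hA hu) (sat_not (sat_and (sat_in h hy hA hv) (sat_or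
    (sat_and (sat_eq hu hv) (sat_crowded h hy (v := v) (d := d)))
    (sat_and (sat_twin h hy hx (u := v) (v := u) (d := d)) (sat_forced h hy (v := v) (d := d))))))
  refine h1.trans ?_
  simp only [removed, Finset.mem_sdiff, Finset.mem_filter]
  tauto

/-- `x` is the only neighbor of `v`. -/
def leafF (a v x d : ℕ) : Fm :=
  .and (matF 0 v x) (allS a d (impF (matF 0 v d) (eqF d x)))

theorem sat_leaf (h : Env G n S a A) (hx : x < n) (hy : y < n)
    (hA : σ.arr = A := by assumption)
    (h3 : σ.var 3 = n := by first | assumption | simp (disch := omega) only [State.setv_ne, *])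
    (hu : σ.var u = x := by first | assumption | simp (disch := omega) only [State.setv_ne, State.setv_self, *])
    (hv : σ.var v = y := by first | assumption | simp (disch := omega) only [State.setv_ne, State.setv_self, *])
    (_hd : 3 < d := by omega) (hud : u < d := by omega) (hvd : v < d := by omega) :
    (leafF a u v d).sat σ ↔ Leaf G S x y :=
  sat_and (sat_adj h hx hy) (sat_allS h fun _ _ hk => sat_imp (sat_adj h hx hk) sat_eq)

/-- `v` is a leaf hung on `x`. -/
def hangF (a v x d : ℕ) : Fm :=
  .and (.and (inF a v) (inF a x)) (.and (leafF a v x d) (impF (leafF a x v d) (ltF x v)))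

theorem sat_hang (h : Env G n S a A) (hx : x < n) (hy : y < n)
    (hA : σ.arr = A := by assumption)
    (h3 : σ.var 3 = n := by first | assumption | simp (disch := omega) only [State.setv_ne, *])
    (hu : σ.var u = x := by first | assumption | simp (disch := omega) only [State.setv_ne, State.setv_self, *])
    (hv : σ.var v = y := by first | assumption | simp (disch := omega) only [State.setv_ne, State.setv_self, *])
    (hd : 3 < d := by omega) (hud : u < d := by omega) (hvd : v < d := by omega) :
    (hangF a u v d).sat σ ↔ Hang G S x y :=
  sat_and (sat_and (sat_in h hx) (sat_in h hy))
    (sat_and (sat_leaf h hx hy) (sat_imp (sat_leaf h hy hx) sat_lt))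

/-- The component of `v` is a complete graph. -/
def closedF (a v d : ℕ) : Fm := allS a d (impF (matF 0 v d) (twinF a v d (d + 2)))

theorem sat_closed (h : Env G n S a A) (hx : x < n)
    (hA : σ.arr = A := by assumption)
    (h3 : σ.var 3 = n := by first | assumption | simp (disch := omega) only [State.setv_ne, *])
    (hv : σ.var v = x := by first | assumption | simp (disch := omega) only [State.setv_ne, State.setv_self, *])
    (hd : 3 < d := by omega) (hvd : v < d := by omega) :
    (closedF a v d).sat σ ↔ Closed G S x :=
  sat_allS h fun _ _ hk => sat_imp (sat_adj h hx hk) (sat_twin h hx hk)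

/-- The component of `v` is superfluous. -/
def superfluousF (a v d : ℕ) : Fm :=
  .and (closedF a v d) (exS a d (exS a (d + 2)
    (.and (.and (closedF a d (d + 4)) (closedF a (d + 2) (d + 4)))
      (.and (.and (.not (eqF d (d + 2))) (.not (matF 0 d (d + 2))))
        (.and (.and (ltF d v) (ltF (d + 2) v))
          (allS a (d + 4) (impF (matF 0 v (d + 4)) (.and (ltF d (d + 4)) (ltF (d + 2) (d + 4))))))))))

theorem sat_superfluous (h : Env G n S a A) (hx : x < n)
    (hA : σ.arr = A := by assumption)
    (h3 : σ.var 3 = n := by first | assumption | simp (disch := omega) only [State.setv_ne, *])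
    (hv : σ.var v = x := by first | assumption | simp (disch := omega) only [State.setv_ne, State.setv_self, *])
    (hd : 3 < d := by omega) (hvd : v < d := by omega) :
    (superfluousF a v d).sat σ ↔ Superfluous G S x :=
  sat_and (sat_closed h hx) (sat_exS h fun _ _ hp => sat_exS h fun _ _ hq =>
    sat_and (sat_and (sat_closed h hp) (sat_closed h hq))
      (sat_and (sat_and (sat_not sat_eq) (sat_not (sat_adj h hp hq)))
        (sat_and (sat_and sat_lt sat_lt)
          (sat_allS h fun _ _ hk => sat_imp (sat_adj h hx hk) (sat_and sat_lt sat_lt)))))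

/-- The vertex `v` is a leaf at a vertex with a smaller leaf. -/
def extraF (a v d : ℕ) : Fm :=
  exS a d (.and (leafF a v d (d + 2)) (exS a (d + 2) (.and (ltF (d + 2) v)
    (leafF a (d + 2) d (d + 4)))))

theorem sat_extra (h : Env G n S a A) (hx : x < n)
    (hA : σ.arr = A := by assumption)
    (h3 : σ.var 3 = n := by first | assumption | simp (disch := omega) only [State.setv_ne, *])
    (hv : σ.var v = x := by first | assumption | simp (disch := omega) only [State.setv_ne, State.setv_self, *])
    (hd : 3 < d := by omega) (hvd : v < d := by omega) :
    (extraF a v d).sat σ ↔ Extra G S x :=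
  sat_exS h fun _ _ hp => sat_and (sat_leaf h hx hp)
    (sat_exS h fun _ _ hq => sat_and sat_lt (sat_leaf h hq hp))

/-- The vertex `v` belongs to the core. -/
def coreF (a v d : ℕ) : Fm :=
  .and (inF a v) (.and (.not (superfluousF a v d)) (.not (extraF a v d)))

theorem sat_core (h : Env G n S a A) (hx : x < n)
    (hA : σ.arr = A := by assumption)
    (h3 : σ.var 3 = n := by first | assumption | simp (disch := omega) only [State.setv_ne, *])
    (hv : σ.var v = x := by first | assumption | simp (disch := omega) only [State.setv_ne, State.setv_self, *])
    (hd : 3 < d := by omega) (hvd : v < d := by omega) :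
    (coreF a v d).sat σ ↔ x ∈ core G S :=
  (sat_and (sat_in h hx) (sat_and (sat_not (sat_superfluous h hx))
    (sat_not (sat_extra h hx)))).trans mem_core.symm

end Sat

/-! ## The kernelization program -/

/-- Store the set of all `u` that satisfy a formula in array `a`. -/
def setArr (a u : ℕ) (φ : Fm) : BProg := .iter u (.seq φ.comp (.store a (.var u) (.var 4)))

/-- The effect of storing the set of all `u` with `p u` in array `a`. -/
structure SetArr (a u : ℕ) (p : ℕ → Prop) (σ τ : State) : Prop where
  mem : ∀ k < σ.var 3, (τ.arr a k ≠ 0 ↔ p k)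
  arr : ∀ b, b ≠ a → τ.arr b = σ.arr b
  var : ∀ i < u, i ≠ 4 → τ.var i = σ.var i
  buf : τ.buf = σ.buf

/-- The formula must not read array `a`, which is overwritten while the loop is still evaluating it.
-/
theorem setArr_run {a u : ℕ} {φ : Fm} {l : List ℕ}
    (h : φ.wf (fun b => !(b == a)) (u :: l) (u + 2) = true) (hu : 5 ≤ u)
    (hl : ∀ i ∈ l, i < u ∧ i ≠ 4) (σ : State) :
    SetArr a u (fun k => φ.sat (σ.setv u k)) σ ((setArr a u φ).run σ) := by
  have hl' : ∀ i ∈ u :: l, i < u + 2 ∧ i ≠ 4 := by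
    intro i hi
    rcases List.mem_cons.1 hi with rfl | hi
    · omega
    · have := hl i hi
      omega
  obtain ⟨h1, h2, h3, h4⟩ := loopRun_induction (f := (BProg.seq φ.comp (.store a (.var u) (.var 4))).run)
    (i := u) (σ := σ)
    (fun k ρ => (∀ j < k, (ρ.arr a j ≠ 0 ↔ φ.sat (σ.setv u j))) ∧ (∀ b, b ≠ a → ρ.arr b = σ.arr b) ∧
      (∀ i < u, i ≠ 4 → ρ.var i = σ.var i) ∧ ρ.buf = σ.buf)
    ⟨by simp, fun _ _ => rfl, fun i hi _ => σ.setv_ne _ hi.ne, rfl⟩ (σ.var 3) (by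
      rintro k ρ hk hρu ⟨i1, i2, i3, i4⟩
      have hag := φ.comp_agree h ρ
      have hsat := φ.comp_sat h (by omega) hl' ρ
      have hcong : φ.sat ρ ↔ φ.sat (σ.setv u k) := by
        refine Fm.sat_congr h ?_ (fun i hi => ?_) fun b hb => ?_
        · rw [State.setv_ne _ _ (by omega)]
          exact i3 3 (by omega) (by omega)
        · rw [State.setv_var]
          split_ifs with hiu
          · rw [hiu, hρu]
          · have := hl i ((List.mem_cons.1 hi).resolve_left hiu)
            exact i3 i this.1 this.2
        · exact i2 b (by simpa using hb)
      simp only [BProg.run, Expr.eval]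
      refine ⟨fun j hj => ?_, fun b hb => ?_, fun i hi h4 => ?_, ?_⟩
      · rw [State.setv_arr, State.seta_arr, hag.var u (by omega) (by omega), hρu]
        by_cases hjk : j = k
        · rw [if_pos ⟨rfl, hjk⟩, hjk, hsat, hcong]
        · rw [if_neg (by tauto), hag.arr]
          exact i1 j (by omega)
      · rw [State.setv_arr, State.seta_arr_ne _ _ _ hb, hag.arr, i2 b hb]
      · rw [State.setv_ne _ _ hi.ne, State.seta_var, hag.var i (by omega) h4, i3 i hi h4]
      · rw [State.setv_buf, State.seta_buf, hag.buf, i4])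
  exact ⟨h1, h2, h3, h4⟩

/-- Store the offsets of the rows of the adjacency matrix in array `3`. -/
def rowProg : BProg :=
  .iter 8 (.seq (.store 3 (.var 8) (.var 5)) (.assign 5 (.add (.var 5) (.var 3))))

/-- In the absence of multiplication the offsets are accumulated in variable `5`, which has to start
at zero. -/
theorem rowProg_run {n : ℕ} {σ : State} (h3 : σ.var 3 = n) (h5 : σ.var 5 = 0) :
    (∀ i < n, (rowProg.run σ).arr 3 i = i * n) ∧
      (∀ b, b ≠ 3 → (rowProg.run σ).arr b = σ.arr b) ∧ (rowProg.run σ).buf = σ.buf ∧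
      ((rowProg.run σ).var 3 = n) := by
  have := loopRun_induction (f := (BProg.seq (.store 3 (.var 8) (.var 5))
      (.assign 5 (.add (.var 5) (.var 3)))).run) (i := 8) (σ := σ)
    (fun k ρ => ((∀ i < k, ρ.arr 3 i = i * n) ∧ (∀ b, b ≠ 3 → ρ.arr b = σ.arr b) ∧
      ρ.buf = σ.buf ∧ ρ.var 3 = n) ∧ ρ.var 5 = k * n)
    (by simp [State.setv_var, h3, h5]) n (by
      rintro k ρ hk hρ ⟨⟨i1, i2, i3, i4⟩, i5⟩
      simp only [BProg.run, Expr.eval]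
      refine ⟨⟨fun i hi => ?_, fun b hb => ?_, ?_, ?_⟩, ?_⟩
      · rw [State.setv_arr, State.setv_arr, State.seta_arr, hρ]
        by_cases hik : i = k
        · rw [if_pos ⟨rfl, hik⟩, i5, hik]
        · rw [if_neg (by tauto), i1 i (by omega)]
      · rw [State.setv_arr, State.setv_arr, State.seta_arr_ne _ _ _ hb, i2 b hb]
      · simpa using i3
      · simpa [State.setv_var] using i4
      · simp [State.setv_var, i5, i4]
        ring)
  rw [← h3] at this ⊢
  exact this.1

/-- Store the vertices that remain after pruning in array `4`. -/
def pruneProg : BProg :=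
  .seq (setArr 4 10 (.atom (.const 1)))
    (.iter 8 (.seq (setArr 5 10 (remainsF 4 10 8 12)) (setArr 4 10 (inF 5 10))))

/-- The new set is collected in array `5` and only then copied to array `4`, because the formula
refers to the old set throughout. -/
theorem pruneProg_run {G : SimpleGraph ℕ} {n : ℕ} {σ : State} (h3 : σ.var 3 = n)
    (hrow : ∀ i < n, σ.arr 3 i = i * n)
    (hadj : ∀ i < n, ∀ j < n, (σ.arr 0 (i * n + j) ≠ 0 ↔ G.Adj i j)) :
    Env G n (pruned G n n) 4 (pruneProg.run σ).arr ∧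
      (∀ b, b ≠ 4 → b ≠ 5 → (pruneProg.run σ).arr b = σ.arr b) ∧
      (pruneProg.run σ).buf = σ.buf ∧ (pruneProg.run σ).var 3 = n := by
  obtain ⟨s1, s2, s3, s4⟩ := setArr_run (a := 4) (u := 10) (φ := .atom (.const 1)) (l := [])
    (by decide) (by omega) (by simp) σ
  have := loopRun_induction
    (f := (BProg.seq (setArr 5 10 (remainsF 4 10 8 12)) (setArr 4 10 (inF 5 10))).run)
    (i := 8) (σ := (setArr 4 10 (.atom (.const 1))).run σ)
    (fun k ρ => Env G n (pruned G n k) 4 ρ.arr ∧ (∀ b, b ≠ 4 → b ≠ 5 → ρ.arr b = σ.arr b) ∧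
      ρ.buf = σ.buf ∧ ρ.var 3 = n)
    ⟨⟨fun i hi => by rw [State.setv_arr, s2 3 (by omega)]; exact hrow i hi,
      fun i hi j hj => by rw [State.setv_arr, s2 0 (by omega)]; exact hadj i hi j hj,
      fun v hv => by simpa [Fm.sat, Expr.eval, pruned, hv] using s1 v (h3 ▸ hv),
      pruned_subset G n 0⟩,
      fun b hb _ => s2 b hb, s4, by
        rw [State.setv_ne _ _ (by omega), s3 3 (by omega) (by omega), h3]⟩ n (by
      rintro k ρ hk hρ ⟨henv, i2, i3, i4⟩
      simp only [BProg.run]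
      obtain ⟨a1, a2, a3, a4⟩ := setArr_run (a := 5) (u := 10) (φ := remainsF 4 10 8 12)
        (l := [8]) (by decide) (by omega) (by simp) ρ
      set ρ' := (setArr 5 10 (remainsF 4 10 8 12)).run ρ
      obtain ⟨b1, b2, b3, b4⟩ := setArr_run (a := 4) (u := 10) (φ := inF 5 10) (l := [])
        (by decide) (by omega) (by simp) ρ'
      have h3' : ρ'.var 3 = n := (a3 3 (by omega) (by omega)).trans i4
      rw [i4] at a1
      rw [h3'] at b1
      refine ⟨⟨fun i hi => ?_, fun i hi j hj => ?_, fun v hv => ?_, pruned_subset G n (k + 1)⟩,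
        fun b hb hb' => ?_, ?_, ?_⟩
      · rw [State.setv_arr, b2 3 (by omega), a2 3 (by omega)]
        exact henv.row i hi
      · rw [State.setv_arr, b2 0 (by omega), a2 0 (by omega)]
        exact henv.adj i hi j hj
      · rw [State.setv_arr, b1 v hv]
        have e1 : (inF 5 10).sat (ρ'.setv 10 v) ↔ ρ'.arr 5 v ≠ 0 := by
          simp [inF, Fm.sat, Expr.eval]
        rw [e1, a1 v hv]
        exact sat_remains henv hv hk rfl
      · rw [State.setv_arr, b2 b hb, a2 b hb', i2 b hb hb']
      · rw [State.setv_buf, b4, a4, i3]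
      · rw [State.setv_ne _ _ (by omega), b3 3 (by omega) (by omega), h3'])
  have e3 : ((setArr 4 10 (.atom (.const 1))).run σ).var 3 = n :=
    (s3 3 (by omega) (by omega)).trans h3
  simp only [pruneProg, BProg.run] at this ⊢
  rw [e3]
  exact this

/-- Compute the vertices of the kernel. -/
def kernelProg : BProg := .seq rowProg (.seq pruneProg (setArr 5 10 (coreF 4 10 12)))

theorem kernelProg_run {G : SimpleGraph ℕ} {n : ℕ} {σ : State} (h3 : σ.var 3 = n)
    (h5 : σ.var 5 = 0) (hadj : ∀ i < n, ∀ j < n, (σ.arr 0 (i * n + j) ≠ 0 ↔ G.Adj i j)) :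
    Env G n (pruned G n n) 4 (kernelProg.run σ).arr ∧
      Env G n (core G (pruned G n n)) 5 (kernelProg.run σ).arr ∧
      (∀ b, b ≠ 3 → b ≠ 4 → b ≠ 5 → (kernelProg.run σ).arr b = σ.arr b) ∧
      (kernelProg.run σ).buf = σ.buf ∧ (kernelProg.run σ).var 3 = n := by
  obtain ⟨r1, r2, r3, r4⟩ := rowProg_run h3 h5
  obtain ⟨p1, p2, p3, p4⟩ := pruneProg_run (G := G) r4 r1 (by
    rw [r2 0 (by omega)]
    exact hadj)
  set ρ := pruneProg.run (rowProg.run σ) with hρ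
  obtain ⟨s1, s2, s3, s4⟩ := setArr_run (a := 5) (u := 10) (φ := coreF 4 10 12) (l := [])
    (by decide) (by omega) (by simp) ρ
  have e : kernelProg.run σ = (setArr 5 10 (coreF 4 10 12)).run ρ := rfl
  rw [e]
  rw [p4] at s1
  refine ⟨⟨?_, ?_, fun v hv => ?_, p1.sub⟩, ⟨?_, ?_, fun v hv => ?_, core_subset.trans p1.sub⟩,
    fun b h3 h4 h5 => ?_, ?_, ?_⟩
  · rw [s2 3 (by omega)]
    exact p1.row
  · rw [s2 0 (by omega)]
    exact p1.adj
  · rw [s2 4 (by omega)]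
    exact p1.mem v hv
  · rw [s2 3 (by omega)]
    exact p1.row
  · rw [s2 0 (by omega)]
    exact p1.adj
  · rw [s1 v hv]
    exact sat_core p1 hv rfl
  · rw [s2 b h5, p2 b h4 h5, r2 b h3]
  · rw [s4, p3, r3]
  · rw [s3 3 (by omega) (by omega), p4]

/-! ## Reading and writing matrices -/

open Classical in
/-- The entries of row `i` of the matrix `R` in the first `m` columns, restricted to the positions
with property `p`. -/
noncomputable def rowBits (p R : ℕ → ℕ → Prop) (i m : ℕ) : Word :=
  (List.range m).flatMap fun j => if p i j then [decide (R i j)] else []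

/-- The entries in the first `m` rows and `n` columns of the matrix `R`, row by row, restricted to the
positions with property `p`. -/
noncomputable def matBits (p R : ℕ → ℕ → Prop) (m n : ℕ) : Word :=
  (List.range m).flatMap fun i => rowBits p R i n

open Classical in
theorem rowBits_succ (p R : ℕ → ℕ → Prop) (i m : ℕ) :
    rowBits p R i (m + 1) = rowBits p R i m ++ if p i m then [decide (R i m)] else [] := by
  simp [rowBits, List.range_succ]

theorem matBits_succ (p R : ℕ → ℕ → Prop) (m n : ℕ) :
    matBits p R (m + 1) n = matBits p R m n ++ rowBits p R m n := by
  simp [matBits, List.range_succ]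

theorem matBits_congr {p p' R R' : ℕ → ℕ → Prop} {n : ℕ}
    (hp : ∀ i < n, ∀ j < n, (p i j ↔ p' i j)) (hR : ∀ i < n, ∀ j < n, p i j → (R i j ↔ R' i j)) :
    matBits p R n n = matBits p' R' n n := by
  have h1 : ∀ k ≤ n, ∀ i < n, rowBits p R i k = rowBits p' R' i k := by
    intro k
    induction k with
    | zero => intros; rfl
    | succ k ih =>
      intro hk i hi
      rw [rowBits_succ, rowBits_succ, ih (by omega) i hi]
      by_cases hpk : p i k
      · rw [if_pos hpk, if_pos ((hp i hi k (by omega)).1 hpk)]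
        rw [decide_eq_decide.2 (hR i hi k (by omega) hpk)]
      · rw [if_neg hpk, if_neg (fun h => hpk ((hp i hi k (by omega)).2 h))]
  have h2 : ∀ k ≤ n, matBits p R k n = matBits p' R' k n := by
    intro k
    induction k with
    | zero => intros; rfl
    | succ k ih =>
      intro hk
      rw [matBits_succ, matBits_succ, ih (by omega), h1 n le_rfl k (by omega)]
  exact h2 n le_rfl

/-- Write the truth values of `ψ` at the positions given by `φ`. -/
def writeProg (φ ψ : Fm) : BProg :=
  .iter 8 (.iter 10 (.seq φ.comp (.ite (.var 4) (.seq ψ.comp (.write (.var 4))) .skip)))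

/-- A nested loop over the positions of a matrix, with an invariant. -/
theorem nested_induction {f : State → State} {σ : State} {n : ℕ} (h3 : σ.var 3 = n)
    (Inv : ℕ → ℕ → State → Prop)
    (hf : ∀ ρ, (f ρ).var 3 = ρ.var 3) (hf8 : ∀ ρ, (f ρ).var 8 = ρ.var 8)
    (hset : ∀ i j ρ k v, k = 8 ∨ k = 10 → Inv i j ρ → Inv i j (ρ.setv k v))
    (h0 : Inv 0 0 σ) (hrow : ∀ i ρ, Inv i n ρ → Inv (i + 1) 0 ρ)
    (hs : ∀ i j ρ, i < n → j < n → ρ.var 8 = i → ρ.var 10 = j → ρ.var 3 = n → Inv i j ρ →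
      Inv i (j + 1) (f ρ)) :
    Inv n 0 (loopRun (fun ρ => loopRun f 10 (ρ.var 3) ρ) 8 n σ) := by
  refine (loopRun_induction (fun i ρ => Inv i 0 ρ ∧ ρ.var 3 = n) ⟨hset _ _ _ _ _ (Or.inl rfl) h0, by
    rw [State.setv_ne _ _ (by omega), h3]⟩ n ?_).1
  rintro i ρ hi hρ ⟨hI, hρ3⟩
  have key := loopRun_induction (f := f) (i := 10) (σ := ρ)
    (fun j ρ' => Inv i j ρ' ∧ ρ'.var 3 = n ∧ ρ'.var 8 = i)
    ⟨hset _ _ _ _ _ (Or.inr rfl) hI, by rw [State.setv_ne _ _ (by omega), hρ3], by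
      rw [State.setv_ne _ _ (by omega), hρ]⟩ n (by
      rintro j ρ' hj hρ' ⟨i1, i2, i3⟩
      refine ⟨hset _ _ _ _ _ (Or.inr rfl) (hs i j ρ' hi hj i3 hρ' i2 i1), ?_, ?_⟩
      · rw [State.setv_ne _ _ (by omega), hf, i2]
      · rw [State.setv_ne _ _ (by omega), hf8, i3])
  rw [hρ3]
  refine ⟨hset _ _ _ _ _ (Or.inl rfl) (hrow i _ key.1), ?_⟩
  rw [State.setv_ne _ _ (by omega), key.2.1]

theorem writeProg_run {φ ψ : Fm} (hφ : φ.wf (fun _ => true) [8, 10] 12 = true)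
    (hψ : ψ.wf (fun _ => true) [8, 10] 12 = true) {σ : State} {n : ℕ} (h3 : σ.var 3 = n)
    {p R : ℕ → ℕ → Prop}
    (hp : ∀ τ : State, τ.arr = σ.arr → τ.var 3 = n → ∀ i < n, ∀ j < n, τ.var 8 = i → τ.var 10 = j →
      (φ.sat τ ↔ p i j))
    (hR : ∀ τ : State, τ.arr = σ.arr → τ.var 3 = n → ∀ i < n, ∀ j < n, τ.var 8 = i → τ.var 10 = j →
      (ψ.sat τ ↔ R i j)) :
    ((writeProg φ ψ).run σ).arr = σ.arr ∧
      ((writeProg φ ψ).run σ).buf = σ.buf ++ matBits p R n n := by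
  classical
  set P : BProg := .seq φ.comp (.ite (.var 4) (.seq ψ.comp (.write (.var 4))) .skip) with hP
  have hsets : ∀ j < 12, j ≠ 4 → P.sets j = false := by
    intro j hj h4
    simp [P, BProg.sets, φ.comp_sets hφ hj h4, ψ.comp_sets hψ hj h4]
  have := nested_induction (f := P.run) h3
    (fun i j ρ => ρ.arr = σ.arr ∧ ρ.buf = σ.buf ++ matBits p R i n ++ rowBits p R i j)
    (fun ρ => P.run_var (hsets 3 (by omega) (by omega)) ρ)
    (fun ρ => P.run_var (hsets 8 (by omega) (by omega)) ρ)
    (fun i j ρ k v _ h => h) (by simp [matBits, rowBits])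
    (fun i ρ h => ⟨h.1, by rw [h.2, matBits_succ]; simp [rowBits]⟩) (by
      rintro i j ρ hi hj h8 h10 hρ3 ⟨ha, hb⟩
      have hag := φ.comp_agree hφ ρ
      have hsat := φ.comp_sat hφ (by omega) (by simp) ρ
      have hag' := ψ.comp_agree hψ (φ.comp.run ρ)
      have hsat' := ψ.comp_sat hψ (by omega) (by simp) (φ.comp.run ρ)
      rw [hp ρ ha hρ3 i hi j hj h8 h10] at hsat
      rw [hR (φ.comp.run ρ) (hag.arr.trans ha) ((hag.var 3 (by omega) (by omega)).trans hρ3) i hi j hj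
        ((hag.var 8 (by omega) (by omega)).trans h8)
        ((hag.var 10 (by omega) (by omega)).trans h10)] at hsat'
      rw [rowBits_succ]
      simp only [P, BProg.run, Expr.eval]
      rw [branch_eq]
      split_ifs with h1 h2 h2
      · exact absurd h1 (hsat.2 h2)
      · exact ⟨hag.arr.trans ha, by rw [hag.buf, hb, List.append_nil]⟩
      · refine ⟨hag'.arr.trans (hag.arr.trans ha), ?_⟩
        simp only [hag'.buf, hag.buf, hb, List.append_assoc, hsat']
      · exact absurd (hsat.1 h1) h2)
  have e : (writeProg φ ψ).run σ = loopRun (fun ρ => loopRun P.run 10 (ρ.var 3) ρ) 8 n σ := by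
    rw [← h3]
    rfl
  rw [e]
  refine ⟨this.1, this.2.trans ?_⟩
  simp [rowBits]

/-- Read a word into the matrix in array `6`, at the positions given by `φ`. -/
def readProg (φ : Fm) : BProg :=
  .iter 8 (.iter 10 (.seq φ.comp (.ite (.var 4)
    (.seq (.store 6 (.add (.get 3 (.var 8)) (.var 10)) (.get 2 (.var 5)))
      (.assign 5 (.add (.var 5) (.const 1)))) .skip)))

theorem rowBits_prefix (p R : ℕ → ℕ → Prop) (i : ℕ) {m m' : ℕ} (h : m ≤ m') :
    rowBits p R i m <+: rowBits p R i m' := by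
  induction m', h using Nat.le_induction with
  | base => exact List.prefix_rfl
  | succ k _ ih => exact ih.trans (rowBits_succ p R i k ▸ List.prefix_append _ _)

theorem matBits_prefix (p R : ℕ → ℕ → Prop) (n : ℕ) {m m' : ℕ} (h : m ≤ m') :
    matBits p R m n <+: matBits p R m' n := by
  induction m', h using Nat.le_induction with
  | base => exact List.prefix_rfl
  | succ k _ ih => exact ih.trans (matBits_succ p R k n ▸ List.prefix_append _ _)

theorem index_injective {n i j i' j' : ℕ} (hj : j < n) (hj' : j' < n)
    (h : i * n + j = i' * n + j') : i = i' ∧ j = j' := by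
  have h1 : (i * n + j) / n = i := by
    rw [mul_comm, Nat.mul_add_div (by omega), Nat.div_eq_of_lt hj, add_zero]
  have h2 : (i' * n + j') / n = i' := by
    rw [mul_comm, Nat.mul_add_div (by omega), Nat.div_eq_of_lt hj', add_zero]
  have h3 : i = i' := by rw [← h1, ← h2, h]
  subst h3
  omega

/-- Variable `5` counts the selected positions passed so far, which is the index of the next bit of
the word. -/
theorem readProg_run {φ : Fm} (hφ : φ.wf (fun b => !(b == 6)) [8, 10] 12 = true)
    {σ : State} {n : ℕ} (h3 : σ.var 3 = n) (hrow : ∀ i < n, σ.arr 3 i = i * n) (h5 : σ.var 5 = 0)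
    (h6 : ∀ t, σ.arr 6 t = 0) {p R : ℕ → ℕ → Prop}
    (hw : ∀ t, σ.arr 2 t = ((matBits p R n n).getD t false).toNat)
    (hp : ∀ i < n, ∀ j < n, (φ.sat ((σ.setv 8 i).setv 10 j) ↔ p i j)) :
    (∀ b, b ≠ 6 → ((readProg φ).run σ).arr b = σ.arr b) ∧
      (∀ i < n, ∀ j < n, (((readProg φ).run σ).arr 6 (i * n + j) ≠ 0 ↔ p i j ∧ R i j)) ∧
      ((readProg φ).run σ).buf = σ.buf := by
  classical
  set P : BProg := .seq φ.comp (.ite (.var 4)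
    (.seq (.store 6 (.add (.get 3 (.var 8)) (.var 10)) (.get 2 (.var 5)))
      (.assign 5 (.add (.var 5) (.const 1)))) .skip) with hP
  have hsets : ∀ j < 12, j ≠ 4 → j ≠ 5 → P.sets j = false := by
    intro j hj h4 h5
    simp [P, BProg.sets, φ.comp_sets hφ hj h4, h5.symm]
  have := nested_induction (f := P.run) h3
    (fun i j ρ => (∀ b, b ≠ 6 → ρ.arr b = σ.arr b) ∧ ρ.buf = σ.buf ∧
      ρ.var 5 = (matBits p R i n ++ rowBits p R i j).length ∧
      ∀ i' < n, ∀ j' < n, (ρ.arr 6 (i' * n + j') ≠ 0 ↔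
        (i' < i ∨ i' = i ∧ j' < j) ∧ p i' j' ∧ R i' j'))
    (fun ρ => P.run_var (hsets 3 (by omega) (by omega) (by omega)) ρ)
    (fun ρ => P.run_var (hsets 8 (by omega) (by omega) (by omega)) ρ)
    (fun i j ρ k v hk h => ⟨h.1, h.2.1, by rw [State.setv_ne _ _ (by omega)]; exact h.2.2.1, h.2.2.2⟩)
    ⟨fun _ _ => rfl, rfl, by simp [matBits, rowBits, h5], fun i' _ j' _ => by simp [h6]⟩
    (fun i ρ h => ⟨h.1, h.2.1, by rw [h.2.2.1, matBits_succ]; simp [rowBits], fun i' hi' j' hj' => by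
      rw [h.2.2.2 i' hi' j' hj']
      refine and_congr_left fun _ => ?_
      omega⟩) (by
      rintro i j ρ hi hj h8 h10 hρ3 ⟨ha, hb, hpos, hm⟩
      have hag := φ.comp_agree hφ ρ
      have hsat := φ.comp_sat hφ (by omega) (by simp) ρ
      have hcong : φ.sat ρ ↔ p i j := by
        rw [← hp i hi j hj]
        refine Fm.sat_congr hφ ?_ ?_ fun b hb => ha b (by simpa using hb)
        · rw [State.setv_ne _ _ (by omega), State.setv_ne _ _ (by omega), hρ3, h3]
        · intro k hk
          simp only [List.mem_cons, List.not_mem_nil, or_false] at hk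
          rcases hk with rfl | rfl
          · rw [State.setv_ne _ _ (by omega), State.setv_self, h8]
          · rw [State.setv_self, h10]
      rw [hcong] at hsat
      have v5 := (hag.var 5 (by omega) (by omega)).trans hpos
      simp only [P, BProg.run, Expr.eval]
      rw [branch_eq]
      split_ifs with h1
      · have hnp : ¬ p i j := fun h => hsat.2 h h1
        refine ⟨by rwa [hag.arr], hag.buf.trans hb, ?_, fun i' hi' j' hj' => ?_⟩
        · rw [v5, rowBits_succ, if_neg hnp, List.append_nil]
        · rw [hag.arr, hm i' hi' j' hj']
          constructor
          · exact fun h => ⟨by omega, h.2⟩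
          · rintro ⟨h, h'⟩
            refine ⟨?_, h'⟩
            by_contra hcon
            obtain rfl : i' = i := by omega
            obtain rfl : j' = j := by omega
            exact hnp h'.1
      · have hpij : p i j := hsat.1 h1
        have e3 : (φ.comp.run ρ).arr 3 ((φ.comp.run ρ).var 8) = i * n := by
          rw [hag.arr, hag.var 8 (by omega) (by omega), h8, ha 3 (by omega), hrow i hi]
        have e10 : (φ.comp.run ρ).var 10 = j := (hag.var 10 (by omega) (by omega)).trans h10
        -- The bits consumed so far, followed by entry `(i, j)`, form a prefix of the word; so the
        -- next bit is that entry.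
        have hpre : matBits p R i n ++ rowBits p R i (j + 1) <+: matBits p R n n := by
          refine List.IsPrefix.trans ?_ (matBits_prefix p R n (by omega : i + 1 ≤ n))
          rw [matBits_succ]
          exact (List.prefix_append_right_inj _).2 (rowBits_prefix p R i (by omega))
        have ebit : (φ.comp.run ρ).arr 2 ((φ.comp.run ρ).var 5) = (decide (R i j)).toNat := by
          rw [hag.arr, v5, ha 2 (by omega), hw]
          obtain ⟨s, hs⟩ := hpre
          rw [← hs, rowBits_succ, if_pos hpij]
          simp
        refine ⟨fun b hb6 => ?_, ?_, ?_, fun i' hi' j' hj' => ?_⟩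
        · rw [State.setv_arr, State.seta_arr_ne _ _ _ hb6, hag.arr, ha b hb6]
        · exact hag.buf.trans hb
        · rw [State.setv_self, State.seta_var, v5, rowBits_succ, if_pos hpij]
          simp
          omega
        · rw [State.setv_arr, State.seta_arr, e3, e10, ebit]
          by_cases heq : i' * n + j' = i * n + j
          · obtain ⟨rfl, rfl⟩ := index_injective hj' hj heq
            simp [hpij]
          · rw [if_neg (by tauto), hag.arr, hm i' hi' j' hj']
            refine and_congr_left fun _ => ?_
            have : ¬ (i' = i ∧ j' = j) := by
              rintro ⟨rfl, rfl⟩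
              exact heq rfl
            omega)
  have e : (readProg φ).run σ = loopRun (fun ρ => loopRun P.run 10 (ρ.var 3) ρ) 8 n σ := by
    rw [← h3]
    rfl
  rw [e]
  refine ⟨this.1, fun i hi j hj => ?_, this.2.1⟩
  rw [this.2.2.2 i hi j hj]
  exact and_iff_right (Or.inl hi)

/-! ## Enumeration of a product of finite sets -/

/-- Order of choices by the largest position below `n` at which they differ. -/
def ChoiceLt (n : ℕ) (c c' : ℕ → ℕ) : Prop :=
  ∃ x < n, c x < c' x ∧ ∀ z < n, x < z → c z = c' z

/-- Equality of choices below `n`. -/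
def ChoiceEq (n : ℕ) (c c' : ℕ → ℕ) : Prop := ∀ x < n, c x = c' x

/-- `y` is the least number with `p y`. -/
def LeastWith (p : ℕ → Prop) (y : ℕ) : Prop := p y ∧ ∀ z < y, ¬ p z

/-- `c'` is the successor of `c` among the choices of options with `P x (c x)`. -/
def IsNext (n : ℕ) (P : ℕ → ℕ → Prop) (c c' : ℕ → ℕ) : Prop :=
  ∃ x < n, (∀ z < x, ∀ y, c z < y → ¬ P z y) ∧ LeastWith (fun y => c x < y ∧ P x y) (c' x) ∧
    (∀ z < x, LeastWith (P z) (c' z)) ∧ ∀ z < n, x < z → c' z = c z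

theorem choice_trichotomy (n : ℕ) (c c' : ℕ → ℕ) :
    ChoiceEq n c c' ∨ ChoiceLt n c c' ∨ ChoiceLt n c' c := by
  induction n with
  | zero => exact Or.inl fun x hx => absurd hx (by omega)
  | succ n ih =>
    rcases lt_trichotomy (c n) (c' n) with h | h | h
    · exact Or.inr (Or.inl ⟨n, by omega, h, fun z hz hz' => by omega⟩)
    · have hext : ∀ z, z < n + 1 → z ≠ n → z < n := fun z h1 h2 => by omega
      rcases ih with h1 | ⟨x, hx, h1, h2⟩ | ⟨x, hx, h1, h2⟩
      · refine Or.inl fun x hx => ?_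
        by_cases hxn : x = n
        · rw [hxn, h]
        · exact h1 x (hext x hx hxn)
      · refine Or.inr (Or.inl ⟨x, by omega, h1, fun z hz hxz => ?_⟩)
        by_cases hzn : z = n
        · rw [hzn, h]
        · exact h2 z (hext z hz hzn) hxz
      · refine Or.inr (Or.inr ⟨x, by omega, h1, fun z hz hxz => ?_⟩)
        by_cases hzn : z = n
        · rw [hzn, h]
        · exact h2 z (hext z hz hzn) hxz
    · exact Or.inr (Or.inr ⟨n, by omega, h, fun z hz hz' => by omega⟩)

theorem ChoiceLt.trans {n : ℕ} {a b c : ℕ → ℕ} (h : ChoiceLt n a b) (h' : ChoiceLt n b c) :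
    ChoiceLt n a c := by
  obtain ⟨x, hx, h1, h2⟩ := h
  obtain ⟨y, hy, h3, h4⟩ := h'
  rcases lt_trichotomy x y with hxy | rfl | hxy
  · exact ⟨y, hy, by rw [h2 y hy hxy]; exact h3,
      fun z hz hyz => (h2 z hz (by omega)).trans (h4 z hz hyz)⟩
  · exact ⟨x, hx, h1.trans h3, fun z hz hyz => (h2 z hz hyz).trans (h4 z hz hyz)⟩
  · exact ⟨x, hx, by rw [← h4 x hx hxy]; exact h1,
      fun z hz hyz => (h2 z hz hyz).trans (h4 z hz (by omega))⟩

theorem ChoiceLt.not_eq {n : ℕ} {a b : ℕ → ℕ} (h : ChoiceLt n a b) : ¬ ChoiceEq n a b := by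
  obtain ⟨x, hx, h1, -⟩ := h
  exact fun h => h1.ne (h x hx)

/-- A numerical value that is monotone for the order of choices. -/
def choiceValue (B : ℕ) (c : ℕ → ℕ) : ℕ → ℕ
  | 0 => 0
  | n + 1 => choiceValue B c n + c n * B ^ n

theorem choiceValue_lt {B n : ℕ} {c : ℕ → ℕ} (h : ∀ x < n, c x < B) : choiceValue B c n < B ^ n := by
  induction n with
  | zero => simp [choiceValue]
  | succ n ih =>
    have h1 := ih fun x hx => h x (by omega)
    have h2 : (c n + 1) * B ^ n ≤ B * B ^ n := Nat.mul_le_mul_right _ (h n (by omega))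
    rw [choiceValue, pow_succ']
    linarith

/-- Choices are read as base `B` numerals whose leading digit is at the largest position. This
yields the termination measure of the enumeration. -/
theorem ChoiceLt.value_lt {B n : ℕ} {c c' : ℕ → ℕ} (h : ∀ x < n, c x < B)
    (hlt : ChoiceLt n c c') : choiceValue B c n < choiceValue B c' n := by
  induction n with
  | zero =>
    obtain ⟨x, hx, -⟩ := hlt
    omega
  | succ n ih =>
    obtain ⟨x, hx, h1, h2⟩ := hlt
    rw [choiceValue, choiceValue]
    by_cases hxn : x = n
    · subst hxn
      have h3 := choiceValue_lt (B := B) (n := x) (c := c) fun y hy => h y (by omega)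
      have h4 : (c x + 1) * B ^ x ≤ c' x * B ^ x := Nat.mul_le_mul_right _ h1
      linarith
    · rw [h2 n (by omega) (by omega)]
      have := ih (fun y hy => h y (by omega)) ⟨x, by omega, h1, fun z hz => h2 z (by omega)⟩
      omega

section Next

variable {n : ℕ} {P : ℕ → ℕ → Prop} {c c' : ℕ → ℕ}

theorem IsNext.lt (h : IsNext n P c c') : ChoiceLt n c c' := by
  obtain ⟨x, hx, -, h1, -, h2⟩ := h
  exact ⟨x, hx, h1.1.1, fun z hz hxz => (h2 z hz hxz).symm⟩

theorem IsNext.valid (h : IsNext n P c c') (hc : ∀ x < n, P x (c x)) : ∀ x < n, P x (c' x) := by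
  obtain ⟨x, hx, -, h1, h2, h3⟩ := h
  intro z hz
  rcases lt_trichotomy z x with hzx | rfl | hzx
  · exact (h2 z hzx).1
  · exact h1.1.2
  · rw [h3 z hz hzx]
    exact hc z hz

/-- Nothing lies strictly between `c` and `c'`. Compare the top position `y` where `b` exceeds `c`
with the position `x` that was increased: below `x` no larger option exists, above `x` also `c'` is
exceeded, and at `x` the values of `c'` are least possible. -/
theorem IsNext.eq_or_lt (h : IsNext n P c c') {b : ℕ → ℕ} (hb : ∀ x < n, P x (b x))
    (hlt : ChoiceLt n c b) : ChoiceEq n c' b ∨ ChoiceLt n c' b := by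
  obtain ⟨x, hx, h0, h1, h2, h3⟩ := h
  obtain ⟨y, hy, h4, h5⟩ := hlt
  rcases lt_trichotomy y x with hyx | rfl | hyx
  · exact absurd (hb y hy) (h0 y hyx _ h4)
  · rcases choice_trichotomy n c' b with h | h | ⟨z, hz, h6, h7⟩
    · exact Or.inl h
    · exact Or.inr h
    · exfalso
      rcases lt_trichotomy z y with hzy | rfl | hzy
      · exact (h2 z hzy).2 _ h6 (hb z hz)
      · exact h1.2 _ h6 ⟨h4, hb z hz⟩
      · rw [h3 z hz hzy, h5 z hz hzy] at h6
        exact lt_irrefl _ h6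
  · refine Or.inr ⟨y, hy, by rw [h3 y hy hyx]; exact h4, fun z hz hyz => ?_⟩
    rw [h3 z hz (by omega), h5 z hz hyz]

theorem least_eq_or_lt (h : ∀ x < n, LeastWith (P x) (c x)) {b : ℕ → ℕ}
    (hb : ∀ x < n, P x (b x)) : ChoiceEq n c b ∨ ChoiceLt n c b := by
  rcases choice_trichotomy n c b with h1 | h1 | ⟨x, hx, h1, -⟩
  · exact Or.inl h1
  · exact Or.inr h1
  · exact absurd (hb x hx) ((h x hx).2 _ h1)

end Next

/-! ## Delays -/

/-- Consecutive outputs of the trace are separated by at most `d` steps, and the first output comes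
after at most `a` steps. -/
inductive Gaps (d : ℕ) : ℕ → Trace → Prop
  | nil {a : ℕ} {t : Trace} : Silent t → t.length ≤ a → Gaps d a t
  | cons {a : ℕ} {u t : Trace} {w : Word} :
      Silent u → u.length ≤ a → Gaps d d t → Gaps d a (u ++ some w :: t)

theorem Silent.append {t u : Trace} (ht : Silent t) (hu : Silent u) : Silent (t ++ u) := by
  intro o ho
  rcases List.mem_append.1 ho with h | h
  exacts [ht o h, hu o h]

theorem Silent.outputs {t : Trace} (ht : Silent t) : outputs t = [] := by
  induction t with
  | nil => rfl
  | cons o t ih =>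
    rw [ht o (by simp), MCKernel.outputs, List.reduceOption_cons_of_none]
    exact ih fun o ho => ht o (List.mem_cons_of_mem _ ho)

theorem outputs_append (t u : Trace) : outputs (t ++ u) = outputs t ++ outputs u :=
  List.reduceOption_append _ _

theorem Gaps.mono {d a a' : ℕ} {t : Trace} (h : Gaps d a t) (ha : a ≤ a') : Gaps d a' t := by
  cases h with
  | nil h1 h2 => exact .nil h1 (h2.trans ha)
  | cons h1 h2 h3 => exact .cons h1 (h2.trans ha) h3

theorem Gaps.prefix {d a e : ℕ} {t u : Trace} (h : Gaps d a t) (hu : Silent u)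
    (he : u.length ≤ e) : Gaps d (e + a) (u ++ t) := by
  cases h with
  | nil h1 h2 => exact .nil (hu.append h1) (by simp; omega)
  | cons h1 h2 h3 =>
    rw [← List.append_assoc]
    exact .cons (hu.append h1) (by simp; omega) h3

/-- A block that does not contain `x` cannot straddle it. -/
theorem infix_append_cons {α : Type*} {b u t : List α} {x : α} (hx : x ∉ b)
    (h : b <:+: u ++ x :: t) : b <:+: u ∨ b <:+: t := by
  obtain ⟨l, r, h⟩ := h
  rw [List.append_assoc] at h
  rcases List.append_eq_append_iff.1 h with ⟨s, rfl, h1⟩ | ⟨s, rfl, h1⟩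
  · rcases List.append_eq_append_iff.1 h1 with ⟨s', rfl, -⟩ | ⟨s', rfl, h2⟩
    · exact Or.inl ⟨l, s', by simp⟩
    · cases s' with
      | nil => exact Or.inl ⟨l, [], by simp⟩
      | cons y s' =>
        rw [List.cons_append, List.cons.injEq] at h2
        exact absurd (by simp [h2.1]) hx
  · cases s with
    | nil =>
      cases b with
      | nil => exact Or.inl (List.nil_infix)
      | cons y b =>
        simp only [List.nil_append, List.cons_append, List.cons.injEq] at h1
        exact absurd (by simp [h1.1]) hx
    | cons y s =>
      rw [List.cons_append, List.cons.injEq] at h1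
      exact Or.inr ⟨s, r, by rw [h1.2, List.append_assoc]⟩

theorem Gaps.delay {d a D : ℕ} {t : Trace} (h : Gaps d a t) (ha : a ≤ D) (hd : d ≤ D) :
    DelayAtMost t D := by
  induction h with
  | nil _ h2 => exact fun b hb _ => hb.length_le.trans (h2.trans ha)
  | cons _ h2 _ ih =>
    intro b hb hs
    rcases infix_append_cons (fun h => by simpa using hs _ h) hb with h | h
    · exact h.length_le.trans (h2.trans ha)
    · exact ih hd b h hs

/-! ## The enumeration loop -/

/-- A loop that outputs `word c` for the current choice `c` and goes to the next choice outputs this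
for all choices from the initial one on. -/
theorem enumeration_loop {n D : ℕ} {P : ℕ → ℕ → Prop} (hP : ∀ x < n, ∀ y, P x y → y < n)
    {W N : Prog} (word : (ℕ → ℕ) → Word) (Inv : (ℕ → ℕ) → State → Prop)
    (hstep : ∀ c σ, (∀ x < n, P x (c x)) → Inv c σ → σ.var 6 ≠ 0 ∧ ∃ τ₁, Runs W σ τ₁ D ∧
      τ₁.buf = word c ∧ ∃ τ₂, Runs N { τ₁ with buf := [] } τ₂ D ∧
        ((τ₂.var 6 = 0 ∧ ∀ x < n, ∀ y, c x < y → ¬ P x y) ∨ ∃ c', IsNext n P c c' ∧ Inv c' τ₂))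
    {c : ℕ → ℕ} {σ : State} (hc : ∀ x < n, P x (c x)) (hσ : Inv c σ) :
    ∃ t τ, ∃ cs : List (ℕ → ℕ), Exec (.loop (.var 6) (.seq W (.seq .emit N))) σ t τ ∧
      outputs t = cs.map word ∧ t.length ≤ cs.length * (2 * D + 2) + 1 ∧
      Gaps (2 * D + 1) (D + 1) t ∧ (∀ b ∈ cs, ∀ x < n, P x (b x)) ∧
      cs.Pairwise (ChoiceLt n) ∧ (∀ b ∈ cs, ChoiceEq n c b ∨ ChoiceLt n c b) ∧
      ∀ b, (∀ x < n, P x (b x)) → ChoiceEq n c b ∨ ChoiceLt n c b → ∃ b' ∈ cs, ChoiceEq n b' b := by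
  have hval : ∀ b : ℕ → ℕ, (∀ x < n, P x (b x)) → ∀ x < n, b x < n :=
    fun b hb x hx => hP x hx _ (hb x hx)
  -- The value increases from choice to choice and stays below `n ^ n`.
  induction hk : n ^ n - choiceValue n c n using Nat.strong_induction_on generalizing c σ with
  | _ k ih =>
  obtain ⟨h6, τ₁, ⟨u, hu1, hu2, hu3⟩, hbuf, τ₂, ⟨v, hv1, hv2, hv3⟩, hend⟩ := hstep c σ hc hσ
  have hexec : Exec (.seq W (.seq .emit N)) σ (u ++ ([some τ₁.buf] ++ v)) τ₂ :=
    .seq hu1 (.seq (.emit τ₁) hv1)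
  have hu4 : Silent (none :: u) := fun o ho => by
    rcases List.mem_cons.1 ho with rfl | h
    exacts [rfl, hu2 o h]
  have hsplit : ∀ t : Trace, none :: (u ++ ([some τ₁.buf] ++ v) ++ t) =
      (none :: u) ++ some τ₁.buf :: (v ++ t) := by simp
  have hout : ∀ t : Trace, outputs (none :: (u ++ ([some τ₁.buf] ++ v) ++ t)) =
      word c :: outputs t := by
    intro t
    rw [hsplit, outputs_append, hu4.outputs, List.nil_append, outputs,
      List.reduceOption_cons_of_some, hbuf]
    have := outputs_append v t
    rw [hv2.outputs, List.nil_append] at this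
    rw [← this]
    rfl
  have hgaps : ∀ t : Trace, Gaps (2 * D + 1) (D + 1) t →
      Gaps (2 * D + 1) (D + 1) (none :: (u ++ ([some τ₁.buf] ++ v) ++ t)) := by
    intro t ht
    rw [hsplit]
    -- The silent end of a round and the silent start of the next add up to `D + (D + 1)` steps.
    exact .cons hu4 (by simpa using hu3) ((ht.prefix hv2 hv3).mono (by omega))
  rcases hend with ⟨h0, hlast⟩ | ⟨c', hnext, hInv⟩
  · refine ⟨_, τ₂, [c], .loop_true h6 hexec (.loop_false h0), ?_, ?_, ?_, ?_, ?_, ?_, ?_⟩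
    · rw [hout]
      rfl
    · simp
      omega
    · exact hgaps _ (.nil (by simp [Silent]) (by simp))
    · simpa using hc
    · simp
    · intro b hb
      rw [List.mem_singleton.1 hb]
      exact Or.inl fun _ _ => rfl
    · rintro b hb (h | ⟨x, hx, h, -⟩)
      · exact ⟨c, by simp, h⟩
      · exact absurd (hb x hx) (hlast x hx _ h)
  · have hc' := hnext.valid hc
    have hlt := hnext.lt.value_lt (hval c hc)
    have hb := choiceValue_lt (hval c' hc')
    obtain ⟨t, τ, cs, h1, h2, h3, h4, h5, h7, h8, h9⟩ := ih _ (by omega) hc' hInv rfl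
    have hlt' : ∀ b ∈ cs, ChoiceLt n c b := by
      intro b hb
      rcases h8 b hb with h | h
      · obtain ⟨x, hx, h10, h11⟩ := hnext.lt
        exact ⟨x, hx, by rw [← h x hx]; exact h10, fun z hz hxz => by
          rw [← h z hz]; exact h11 z hz hxz⟩
      · exact hnext.lt.trans h
    refine ⟨_, τ, c :: cs, .loop_true h6 hexec h1, ?_, ?_, hgaps t h4, ?_, ?_, ?_, ?_⟩
    · rw [hout, h2]
      rfl
    · simp only [List.length_cons, List.length_append, List.length_nil]
      ring_nf at h3 ⊢
      omega
    · simpa using ⟨hc, h5⟩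
    · exact List.pairwise_cons.2 ⟨hlt', h7⟩
    · intro b hb
      rcases List.mem_cons.1 hb with rfl | hb
      · exact Or.inl fun _ _ => rfl
      · exact Or.inr (hlt' b hb)
    · rintro b hb (h | h)
      · exact ⟨c, by simp, h⟩
      · obtain ⟨b', hb', hbb'⟩ := h9 b hb (hnext.eq_or_lt hb h)
        exact ⟨b', List.mem_cons_of_mem _ hb', hbb'⟩

/-! ## The lifting program -/

/-- Truth of a proposition as a formula. -/
def constF (b : Bool) : Fm := .atom (.const b.toNat)

/-- `N` contains an edge at a leaf hung on the vertex in variable `8`. -/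
def selF : Fm := exS 5 12 (.and (hangF 4 12 8 14) (matF 6 8 12))

/-- The vertex in variable `8` is not in the core, and `b` holds. -/
def offF (b : Bool) : Fm := .and (.not (inF 5 8)) (constF b)

/-- Is the problem that of minimal matching cuts? -/
def Mode.isMin : Mode → Bool
  | .min => true
  | _ => false

/-- Is the problem that of maximal matching cuts? -/
def Mode.isMax : Mode → Bool
  | .max => true
  | _ => false

/-- Variable `10` is an option for the vertex in variable `8`. -/
def optF (m : Mode) : Fm :=
  .or (.and selF (hangF 4 10 8 12)) (.or (.and (offF !m.isMin) (hangF 4 10 8 12))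
    (.and (eqF 10 8) (.and (.not selF) (.not (.and (offF m.isMax) (exS 4 12 (hangF 4 12 8 14)))))))

/-- Variable `10` is larger than the current choice for the vertex in variable `8`. -/
def gtF : Fm := .atom (.sub (.var 10) (.get 9 (.var 8)))

/-- The entry of the matrix of free edges. -/
def freeF : Fm :=
  .and (matF 6 8 10) (.and (allS 4 12 (.not (hangF 4 8 12 14))) (allS 4 12 (.not (hangF 4 10 12 14))))

/-- The current choice for the vertex in variable `u` is the vertex in variable `v`. -/
def choiceF (u v : ℕ) : Fm :=
  .atom (.sub (.const 1) (.add (.sub (.get 9 (.var u)) (.var v)) (.sub (.var v) (.get 9 (.var u)))))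

/-- The entry of the matrix of the edge set given by the current choice. -/
def bitF : Fm :=
  .or freeF (.and (.or (choiceF 8 10) (choiceF 10 8)) (.not (eqF 8 10)))

/-- The arrays store the data for the lifting of the matching cut `N` of the core. -/
structure LiftEnv (G : SimpleGraph ℕ) (n : ℕ) (S : Finset ℕ) (N : Set (Sym2 ℕ))
    (A : ℕ → ℕ → ℕ) : Prop where
  vertices : Env G n S 4 A
  core : Env G n (core G S) 5 A
  mat : ∀ i < n, ∀ j < n, (A 6 (i * n + j) ≠ 0 ↔ s(i, j) ∈ N)

section Lift

variable {G : SimpleGraph ℕ} {n : ℕ} {S : Finset ℕ} {N : Set (Sym2 ℕ)} {A : ℕ → ℕ → ℕ}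
  {σ : State} {m : Mode} {x y : ℕ}

theorem LiftEnv.congr {B : ℕ → ℕ → ℕ} (h : LiftEnv G n S N A) (hB : ∀ b, b ≠ 9 → B b = A b) :
    LiftEnv G n S N B := by
  obtain ⟨h1, h2, h3⟩ := h
  refine ⟨⟨?_, ?_, ?_, h1.sub⟩, ⟨?_, ?_, ?_, h2.sub⟩, ?_⟩ <;> rw [hB _ (by omega)]
  exacts [h1.row, h1.adj, h1.mem, h2.row, h2.adj, h2.mem, h3]

theorem sat_const (b : Bool) : (constF b).sat σ ↔ b = true := by
  cases b <;> simp [constF, Fm.sat, Expr.eval]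

theorem sat_mat (h : LiftEnv G n S N A) {u v : ℕ} (hx : x < n) (hy : y < n)
    (hA : σ.arr = A := by assumption)
    (hu : σ.var u = x := by first | assumption | simp (disch := omega) only [State.setv_ne, State.setv_self, *])
    (hv : σ.var v = y := by first | assumption | simp (disch := omega) only [State.setv_ne, State.setv_self, *]) :
    (matF 6 u v).sat σ ↔ s(x, y) ∈ N := by
  simp only [matF, Fm.sat, Expr.eval, hu, hv, hA, h.vertices.row x hx]
  exact h.mat x hx y hy

theorem sat_sel (h : LiftEnv G n S N A) (hx : x < n) (hA : σ.arr = A) (h3 : σ.var 3 = n)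
    (h8 : σ.var 8 = x) : selF.sat σ ↔ Sel G S N x :=
  sat_exS h.core fun _ _ hp => sat_and (sat_hang h.vertices hp hx) (sat_mat h hx hp)

theorem sat_off (h : LiftEnv G n S N A) (hx : x < n) (hA : σ.arr = A) (h8 : σ.var 8 = x) (b : Bool) :
    (offF b).sat σ ↔ x ∉ MCKernel.core G S ∧ b = true :=
  sat_and (sat_not (sat_in h.core hx)) (sat_const b)

theorem sat_opt (h : LiftEnv G n S N A) (hx : x < n) (hy : y < n) (hA : σ.arr = A)
    (h3 : σ.var 3 = n) (h8 : σ.var 8 = x) (h10 : σ.var 10 = y) :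
    (optF m).sat σ ↔ Opt m G S N x y := by
  have e1 : (!m.isMin) = true ↔ m ≠ .min := by cases m <;> simp [Mode.isMin]
  have e2 : m.isMax = true ↔ m = .max := by cases m <;> simp [Mode.isMax]
  refine sat_or (sat_and (sat_sel h hx hA h3 h8) (sat_hang h.vertices hy hx))
    (sat_or (sat_and ((sat_off h hx hA h8 _).trans (and_congr_right fun _ => e1))
      (sat_hang h.vertices hy hx))
    (sat_and sat_eq (sat_and (sat_not (sat_sel h hx hA h3 h8))
      (sat_not (sat_and ((sat_off h hx hA h8 _).trans (and_congr_right fun _ => e2))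
        (sat_exS h.vertices fun _ _ hk => sat_hang h.vertices hk hx))))))

theorem sat_gt {c : ℕ → ℕ} (hc : σ.arr 9 x = c x) (h8 : σ.var 8 = x) (h10 : σ.var 10 = y) :
    gtF.sat σ ↔ c x < y := by
  simp only [gtF, Fm.sat, Expr.eval, h8, h10, hc]
  omega

theorem sat_choice {c : ℕ → ℕ} {u v : ℕ} (hc : σ.arr 9 x = c x) (hu : σ.var u = x)
    (hv : σ.var v = y) : (choiceF u v).sat σ ↔ c x = y := by
  simp only [choiceF, Fm.sat, Expr.eval, hu, hv, hc]
  omega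

theorem sat_free (h : LiftEnv G n S N A) (hx : x < n) (hy : y < n) (hA : σ.arr = A)
    (h3 : σ.var 3 = n) (h8 : σ.var 8 = x) (h10 : σ.var 10 = y) :
    freeF.sat σ ↔ s(x, y) ∈ Free G S N := by
  refine (sat_and (sat_mat h hx hy) (sat_and
    (sat_allS h.vertices fun _ _ hk => sat_not (sat_hang h.vertices hx hk))
    (sat_allS h.vertices fun _ _ hk => sat_not (sat_hang h.vertices hy hk)))).trans ?_
  rw [mem_free]
  have key : ∀ z, (∀ k ∈ S, ¬ Hang G S z k) ↔ ∀ k, ¬ Hang G S z k :=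
    fun z => ⟨fun h k hk => h k hk.1.2 hk, fun h k _ => h k⟩
  rw [key, key]

/-- Both orders are tested since the matrix is symmetric; `x ≠ y` discards the option of choosing no
leaf. -/
theorem sat_bit {c : ℕ → ℕ} (h : LiftEnv G n S N A) (hx : x < n) (hy : y < n) (hA : σ.arr = A)
    (hc : ∀ x < n, A 9 x = c x) (h3 : σ.var 3 = n) (h8 : σ.var 8 = x) (h10 : σ.var 10 = y) :
    bitF.sat σ ↔ s(x, y) ∈ build G S n N c := by
  refine (sat_or (sat_free h hx hy hA h3 h8 h10) (sat_and
    (sat_or (sat_choice (c := c) (hA ▸ hc x hx) h8 h10) (sat_choice (c := c) (hA ▸ hc y hy) h10 h8))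
    (sat_not sat_eq))).trans (or_congr Iff.rfl ?_)
  constructor
  · rintro ⟨h | h, hne⟩
    · exact ⟨x, hx, fun h' => hne (h' ▸ h), by rw [h]⟩
    · exact ⟨y, hy, fun h' => hne (h' ▸ h).symm, by rw [h, Sym2.eq_swap]⟩
  · rintro ⟨z, hz, hne, he⟩
    rcases Sym2.eq_iff.1 he with ⟨rfl, rfl⟩ | ⟨rfl, rfl⟩
    · exact ⟨Or.inl rfl, Ne.symm hne⟩
    · exact ⟨Or.inr rfl, hne⟩

theorem Opt.lt (hS : S ⊆ Finset.range n) (hx : x < n) (h : Opt m G S N x y) : y < n := by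
  by_cases hxy : y = x
  · exact hxy ▸ hx
  · exact Finset.mem_range.1 (hS (h.hang hxy).1.1.1)

/-- Choose the least option for all vertices below variable `7`. -/
def resetProg (m : Mode) : BProg :=
  .iter 8 (.ite (.sub (.var 7) (.var 8))
    (.seq (Fm.ex 10 (optF m)).comp (.store 9 (.var 8) (.sub (.var 4) (.const 1)))) .skip)

theorem optF_wf (m : Mode) : (Fm.ex 10 (optF m)).wf (fun _ => true) [8] 10 = true := by
  cases m <;> decide

theorem search_opt (h : LiftEnv G n S N σ.arr) (hS : S ⊆ Finset.range n) (h3 : σ.var 3 = n)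
    (hx : x < n) (h8 : σ.var 8 = x) :
    ∃ y, ((Fm.ex 10 (optF m)).comp.run σ).var 4 = y + 1 ∧ LeastWith (Opt m G S N x) y := by
  have hs := (optF m).comp_search (optF_wf m) (by omega) (by simp) σ
  rw [h3] at hs
  have hk : ∀ k < n, ((optF m).sat (σ.setv 10 k) ↔ Opt m G S N x k) := fun k hk =>
    sat_opt h hx hk rfl (by rw [State.setv_ne _ _ (by omega), h3])
      (by rw [State.setv_ne _ _ (by omega), h8]) (σ.setv_self _ _)
  rcases hs with ⟨-, h0⟩ | ⟨k, hkn, h1, h2, h4⟩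
  · obtain ⟨y, hy, hopt⟩ := exists_opt (m := m) (N := N)
      (fun p x (hp : Hang G S p x) => Finset.mem_range.1 (hS hp.1.1)) x hx
    exact absurd ((hk y hy).2 hopt) (h0 y hy)
  · exact ⟨k, h1, (hk k hkn).1 h2, fun z hz hzo => h4 z hz ((hk z (by omega)).2 hzo)⟩

/-- All loops run up to variable `3`, so the restriction to vertices below variable `7` is a test in
the body. -/
theorem resetProg_run (h : LiftEnv G n S N σ.arr) (hS : S ⊆ Finset.range n) (h3 : σ.var 3 = n) :
    (∀ b, b ≠ 9 → ((resetProg m).run σ).arr b = σ.arr b) ∧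
      (∀ z < n, z < σ.var 7 → LeastWith (Opt m G S N z) (((resetProg m).run σ).arr 9 z)) ∧
      (∀ z, σ.var 7 ≤ z → ((resetProg m).run σ).arr 9 z = σ.arr 9 z) ∧
      (∀ i < 8, i ≠ 4 → ((resetProg m).run σ).var i = σ.var i) ∧
      ((resetProg m).run σ).buf = σ.buf := by
  have := loopRun_induction (f := (BProg.ite (.sub (.var 7) (.var 8)) (.seq (Fm.ex 10 (optF m)).comp
      (.store 9 (.var 8) (.sub (.var 4) (.const 1)))) .skip).run) (i := 8) (σ := σ)
    (fun k ρ => (∀ b, b ≠ 9 → ρ.arr b = σ.arr b) ∧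
      (∀ z < k, z < σ.var 7 → LeastWith (Opt m G S N z) (ρ.arr 9 z)) ∧
      (∀ z, σ.var 7 ≤ z → ρ.arr 9 z = σ.arr 9 z) ∧ (∀ i < 8, i ≠ 4 → ρ.var i = σ.var i) ∧
      ρ.buf = σ.buf)
    ⟨fun _ _ => rfl, by simp, fun _ _ => rfl, fun i hi _ => σ.setv_ne _ hi.ne, rfl⟩ n (by
      rintro k ρ hk hρ ⟨i1, i2, i3, i4, i5⟩
      simp only [BProg.run, Expr.eval]
      rw [branch_eq, i4 7 (by omega) (by omega), hρ]
      split_ifs with hc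
      · refine ⟨i1, fun z hz hz7 => i2 z (by omega) hz7, i3,
          fun i hi h4 => ?_, i5⟩
        rw [State.setv_ne _ _ hi.ne, i4 i hi h4]
      · obtain ⟨y, hy, hleast⟩ := search_opt (m := m) (h.congr i1) hS
          ((i4 3 (by omega) (by omega)).trans h3) hk hρ
        have hag := (Fm.ex 10 (optF m)).comp_agree (optF_wf m) ρ
        have e8 := (hag.var 8 (by omega) (by omega)).trans hρ
        rw [e8, hy]
        refine ⟨fun b hb => ?_, fun z hz hz7 => ?_, fun z hz => ?_, fun i hi h4 => ?_, ?_⟩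
        · rw [State.setv_arr, State.seta_arr_ne _ _ _ hb, hag.arr, i1 b hb]
        · rw [State.setv_arr, State.seta_arr]
          by_cases hzk : z = k
          · rw [if_pos ⟨rfl, hzk⟩, hzk]
            exact hleast
          · rw [if_neg (by tauto), hag.arr]
            exact i2 z (by omega) hz7
        · rw [State.setv_arr, State.seta_arr, if_neg (by omega), hag.arr, i3 z hz]
        · rw [State.setv_ne _ _ hi.ne, State.seta_var, hag.var i (by omega) h4, i4 i hi h4]
        · rw [State.setv_buf, State.seta_buf, hag.buf, i5])
  rw [← h3] at this ⊢
  exact this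

/-- Go to the next choice, or set variable `6` to zero if there is none. -/
def nextProg (m : Mode) : BProg :=
  .seq (Fm.ex 8 (.ex 10 (.and gtF (optF m)))).comp (.ite (.var 4)
    (.seq (.assign 7 (.sub (.var 4) (.const 1))) (.seq (.assign 8 (.var 7))
      (.seq (Fm.ex 10 (.and gtF (optF m))).comp
        (.seq (.store 9 (.var 8) (.sub (.var 4) (.const 1))) (resetProg m)))))
    (.assign 6 (.const 0)))

theorem nextF_wf (m : Mode) :
    (Fm.ex 8 (.ex 10 (.and gtF (optF m)))).wf (fun _ => true) [] 8 = true := by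
  cases m <;> decide

theorem nextF_wf' (m : Mode) :
    (Fm.ex 10 (.and gtF (optF m))).wf (fun _ => true) [8] 10 = true := by
  cases m <;> decide

/-- The successor increases the least vertex that has a larger option to the least such option and
resets the vertices below it. Searches return the successor of the witness, hence the subtractions
of one. -/
theorem nextProg_run (h : LiftEnv G n S N σ.arr) (hS : S ⊆ Finset.range n) (h3 : σ.var 3 = n)
    (h6 : σ.var 6 ≠ 0) {c : ℕ → ℕ} (hc : ∀ x < n, σ.arr 9 x = c x) :
    (((nextProg m).run σ).var 6 = 0 ∧ ∀ x < n, ∀ y, c x < y → ¬ Opt m G S N x y) ∨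
      (((nextProg m).run σ).var 6 ≠ 0 ∧ IsNext n (Opt m G S N) c (((nextProg m).run σ).arr 9) ∧
        LiftEnv G n S N ((nextProg m).run σ).arr ∧ ((nextProg m).run σ).var 3 = n ∧
        ((nextProg m).run σ).buf = σ.buf) := by
  have hag := (Fm.ex 8 (.ex 10 (.and gtF (optF m)))).comp_agree (nextF_wf m) σ
  have hs := (Fm.ex 10 (.and gtF (optF m))).comp_search (nextF_wf m) (by omega) (by simp) σ
  set ρ := (Fm.ex 8 (.ex 10 (.and gtF (optF m)))).comp.run σ with hρ
  rw [h3] at hs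
  have hsat : ∀ τ : State, τ.arr = σ.arr → τ.var 3 = n → ∀ x < n, τ.var 8 = x → ∀ y < n,
      ((Fm.and gtF (optF m)).sat (τ.setv 10 y) ↔ c x < y ∧ Opt m G S N x y) := by
    intro τ hτ hτ3 x hx hτ8 y hy
    have e8 : (τ.setv 10 y).var 8 = x := by rw [State.setv_ne _ _ (by omega), hτ8]
    refine sat_and (sat_gt ?_ e8 (τ.setv_self _ _)) (sat_opt h hx hy hτ ?_ e8 (τ.setv_self _ _))
    · rw [State.setv_arr, hτ]
      exact hc x hx
    · rw [State.setv_ne _ _ (by omega), hτ3]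
  have hk : ∀ x < n, ((Fm.ex 10 (.and gtF (optF m))).sat (σ.setv 8 x) ↔
      ∃ y, c x < y ∧ Opt m G S N x y) := by
    intro x hx
    have e3 : (σ.setv 8 x).var 3 = n := by rw [State.setv_ne _ _ (by omega), h3]
    rw [Fm.sat, e3]
    constructor
    · rintro ⟨y, hy, h⟩
      exact ⟨y, (hsat (σ.setv 8 x) rfl e3 x hx (σ.setv_self 8 x) y hy).1 h⟩
    · rintro ⟨y, hy⟩
      have hyn := hy.2.lt hS hx
      exact ⟨y, hyn, (hsat (σ.setv 8 x) rfl e3 x hx (σ.setv_self _ _) y hyn).2 hy⟩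
  simp only [nextProg, BProg.run, Expr.eval]
  rw [← hρ, branch_eq]
  rcases hs with ⟨h4, h0⟩ | ⟨x, hx, h4, h1, h2⟩
  · left
    rw [if_pos h4]
    exact ⟨State.setv_self _ _ _, fun x hx y hxy ho => h0 x hx ((hk x hx).2 ⟨y, hxy, ho⟩)⟩
  · right
    rw [if_neg (by omega), h4, Nat.add_sub_cancel, State.setv_self]
    set ρ1 := (ρ.setv 7 x).setv 8 x with hρ1
    have r3 : ρ1.var 3 = n := by
      rw [State.setv_ne _ _ (by omega), State.setv_ne _ _ (by omega), hag.var 3 (by omega) (by omega),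
        h3]
    have r6 : ρ1.var 6 = σ.var 6 := by
      rw [State.setv_ne _ _ (by omega), State.setv_ne _ _ (by omega), hag.var 6 (by omega) (by omega)]
    have r7 : ρ1.var 7 = x := by rw [State.setv_ne _ _ (by omega), State.setv_self]
    have r8 : ρ1.var 8 = x := State.setv_self _ _ _
    have ra : ρ1.arr = σ.arr := hag.arr
    have hs' := (Fm.and gtF (optF m)).comp_search (nextF_wf' m) (by omega) (by simp) ρ1
    have hag' := (Fm.ex 10 (.and gtF (optF m))).comp_agree (nextF_wf' m) ρ1
    set ρ2 := (Fm.ex 10 (.and gtF (optF m))).comp.run ρ1 with hρ2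
    rw [r3] at hs'
    rcases hs' with ⟨-, h0⟩ | ⟨y, hy, h5, h7, h8⟩
    · obtain ⟨y, hy⟩ := (hk x hx).1 h1
      exact absurd ((hsat ρ1 ra r3 x hx r8 y (hy.2.lt hS hx)).2 hy) (h0 y (hy.2.lt hS hx))
    · have hy' := (hsat ρ1 ra r3 x hx r8 y hy).1 h7
      rw [h5, Nat.add_sub_cancel, hag'.var 8 (by omega) (by omega), r8]
      have q3 : (ρ2.seta 9 x y).var 3 = n := (hag'.var 3 (by omega) (by omega)).trans r3
      have q7 : (ρ2.seta 9 x y).var 7 = x := (hag'.var 7 (by omega) (by omega)).trans r7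
      have qa : ∀ b, b ≠ 9 → (ρ2.seta 9 x y).arr b = σ.arr b := fun b hb => by
        rw [State.seta_arr_ne _ _ _ hb, hag'.arr, ra]
      obtain ⟨s1, s2, s3, s4, s5⟩ := resetProg_run (m := m) (h.congr qa) hS q3
      rw [q7] at s2 s3
      have t9 : ∀ z, x ≤ z → z < n → ((resetProg m).run (ρ2.seta 9 x y)).arr 9 z =
          if z = x then y else c z := by
        intro z hz hzn
        rw [s3 z hz, State.seta_arr]
        by_cases hzx : z = x
        · rw [if_pos ⟨rfl, hzx⟩, if_pos hzx]
        · rw [if_neg (by tauto), if_neg hzx, hag'.arr, ra, hc z hzn]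
      refine ⟨?_, ⟨x, hx, fun z hz w hw ho => h2 z hz ((hk z (by omega)).2 ⟨w, hw, ho⟩), ?_,
        fun z hz => s2 z (by omega) hz, fun z hz hxz => ?_⟩,
        (h.congr qa).congr s1, ?_, ?_⟩
      · rw [s4 6 (by omega) (by omega), State.seta_var, hag'.var 6 (by omega) (by omega), r6]
        exact h6
      · rw [t9 x le_rfl hx, if_pos rfl]
        exact ⟨hy', fun z hz hzo => h8 z hz ((hsat ρ1 ra r3 x hx r8 z (by omega)).2 hzo)⟩
      · rw [t9 z hxz.le hz, if_neg (by omega)]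
      · rw [s4 3 (by omega) (by omega), q3]
      · rw [s5, State.seta_buf, hag'.buf]
        exact hag.buf

end Lift

/-! ## The two algorithms -/

/-- Compute the number of vertices from the length of the adjacency matrix. -/
def sizeProg : Prog :=
  .seq (.loop (.sub (.var 0) (.var 5))
    (.seq (.assign 5 (.add (.var 5) (.add (.add (.var 3) (.var 3)) (.const 1))))
      (.assign 3 (.add (.var 3) (.const 1))))) (.assign 5 (.const 0))

/-- Variable `5` runs through the squares as sums of odd numbers until it reaches `n * n`. The loop
cannot be a bounded one, as its result is what becomes the loop bound. -/
theorem sizeProg_runs {n : ℕ} {σ : State} (h0 : σ.var 0 = n * n) (h3 : σ.var 3 = 0)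
    (h5 : σ.var 5 = 0) : ∃ τ, Runs sizeProg σ τ (3 * n + 2) ∧ τ.var 3 = n ∧ τ.var 5 = 0 ∧
      τ.arr = σ.arr ∧ τ.buf = σ.buf := by
  suffices key : ∀ j k ρ, j + k = n → ρ.var 0 = n * n → ρ.var 3 = k → ρ.var 5 = k * k →
      ρ.arr = σ.arr → ρ.buf = σ.buf → ∃ τ, Runs sizeProg ρ τ (3 * j + 2) ∧ τ.var 3 = n ∧
        τ.var 5 = 0 ∧ τ.arr = σ.arr ∧ τ.buf = σ.buf by
    exact key n 0 σ rfl h0 h3 (by simpa using h5) rfl rfl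
  intro j
  induction j with
  | zero =>
    intro k ρ hk h0 h3 h5 ha hb
    obtain rfl : k = n := by omega
    refine ⟨_, (Runs.seq (Runs.loop_false ?_) (Runs.assign 5 (.const 0) ρ)).mono (by omega),
      ?_, State.setv_self _ _ _, ha, hb⟩
    · simp [Expr.eval, h0, h5]
    · rw [State.setv_ne _ _ (by omega), h3]
  | succ j ih =>
    intro k ρ hk h0 h3 h5 ha hb
    have hlt : (k + 1) * (k + 1) ≤ n * n := Nat.mul_self_le_mul_self (by omega)
    set ρ1 := ρ.setv 5 ((k + 1) * (k + 1)) with hρ1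
    obtain ⟨τ, ⟨t, ht, hs, hl⟩, h⟩ := ih (k + 1) (ρ1.setv 3 (k + 1)) (by omega)
      (by rw [State.setv_ne _ _ (by omega), State.setv_ne _ _ (by omega), h0])
      (State.setv_self _ _ _) (by rw [State.setv_ne _ _ (by omega), State.setv_self]) ha hb
    refine ⟨τ, ?_, h⟩
    have s1 := Runs.assign 5 (.add (.var 5) (.add (.add (.var 3) (.var 3)) (.const 1))) ρ
    have e1 : (Expr.add (.var 5) (.add (.add (.var 3) (.var 3)) (.const 1))).eval ρ =
        (k + 1) * (k + 1) := by
      simp only [Expr.eval, h3, h5]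
      ring
    rw [e1] at s1
    have s2 := Runs.assign 3 (.add (.var 3) (.const 1)) ρ1
    have e2 : (Expr.add (.var 3) (.const 1)).eval ρ1 = k + 1 := by
      simp only [Expr.eval]
      rw [State.setv_ne _ _ (by omega), h3]
    rw [e2] at s2
    -- The run given by induction is split into its loop and the final assignment, so that one more
    -- round can be put in front of the loop.
    cases ht with
    | @seq _ _ _ τ' _ t1 t2 ht1 ht2 =>
      have hne : (Expr.sub (.var 0) (.var 5)).eval ρ ≠ 0 := by
        simp only [Expr.eval, h0, h5]
        have : (k + 1) * (k + 1) = k * k + 2 * k + 1 := by ring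
        omega
      simp only [List.length_append] at hl
      have r := (Runs.loop_true hne (s1.seq s2)
        ⟨t1, ht1, fun o ho => hs o (List.mem_append_left _ ho), le_rfl⟩).seq
        ⟨t2, ht2, fun o ho => hs o (List.mem_append_right _ ho), le_rfl⟩
      exact r.mono (by omega)

/-- Positions in the matrix of the core. -/
def coreCellF : Fm := .and (inF 5 8) (inF 5 10)

/-- Compute the core and write its adjacency matrix. -/
def corePart : BProg := .seq kernelProg (writeProg coreCellF (matF 0 8 10))

theorem corePart_wf : corePart.wf = true := by decide

theorem corePart_sets : corePart.sets 3 = false := by decide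

/-- The kernelization algorithm. -/
def kernelization : Prog := .seq sizeProg (.seq corePart.toProg .emit)

open Polynomial in
/-- Its running time. -/
noncomputable def kernelizationCost : Polynomial ℕ := 3 * X + 3 + corePart.cost

theorem eval_kernelizationCost (n : ℕ) :
    kernelizationCost.eval n = 3 * n + 3 + corePart.cost.eval n := by
  unfold kernelizationCost
  generalize corePart.cost = Q
  simp

theorem kernelization_run {G : SimpleGraph ℕ} {n : ℕ} {σ : State} (h0 : σ.var 0 = n * n)
    (h3 : σ.var 3 = 0) (h5 : σ.var 5 = 0) (hb : σ.buf = [])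
    (hadj : ∀ i < n, ∀ j < n, (σ.arr 0 (i * n + j) ≠ 0 ↔ G.Adj i j)) :
    ∃ t τ, Exec kernelization σ t τ ∧ t.length ≤ kernelizationCost.eval n ∧
      outputs t = [matBits (fun i j => i ∈ core G (pruned G n n) ∧ j ∈ core G (pruned G n n))
        G.Adj n n] := by
  obtain ⟨τ, ⟨t, t1, t2, t3⟩, hτ3, hτ5, hτa, hτb⟩ := sizeProg_runs h0 h3 h5
  obtain ⟨u, u1, u2, u3⟩ := corePart.runs corePart_wf corePart_sets τ
  obtain ⟨k1, k2, k3, k4, k5⟩ := kernelProg_run (G := G) hτ3 hτ5 (by rwa [hτa])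
  obtain ⟨-, w⟩ := writeProg_run (φ := coreCellF) (ψ := matF 0 8 10) (by decide) (by decide) k5
    (p := fun i j => i ∈ core G (pruned G n n) ∧ j ∈ core G (pruned G n n)) (R := G.Adj)
    (fun ρ hρ _ i hi j hj h8 h10 => sat_and (sat_in k2 hi hρ h8) (sat_in k2 hj hρ h10))
    (fun ρ hρ _ i hi j hj h8 h10 => sat_adj k2 hi hj hρ h8 h10)
  rw [k4, hτb, hb, List.nil_append] at w
  have hexec : Exec kernelization σ (t ++ (u ++ [some (corePart.run τ).buf])) _ :=
    .seq t1 (.seq u1 (.emit _))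
  refine ⟨_, _, hexec, ?_, ?_⟩
  · rw [hτ3] at u3
    rw [eval_kernelizationCost]
    simp only [List.length_append, List.length_cons, List.length_nil]
    omega
  · rw [outputs_append, outputs_append, t2.outputs, u2.outputs, ← w]
    rfl

/-! ### The lifting algorithm -/

/-- Prepare the enumeration. -/
def setupProg (m : Mode) : BProg :=
  .seq kernelProg (.seq (.assign 5 (.const 0)) (.seq (readProg coreCellF)
    (.seq (.assign 7 (.var 3)) (.seq (resetProg m) (.assign 6 (.const 1))))))

/-- Write the matrix of the edge set given by the current choice. -/
def outputProg : BProg := writeProg (constF true) bitF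

/-- The lifting algorithm. -/
def lifting (m : Mode) : Prog :=
  .seq sizeProg (.seq (setupProg m).toProg
    (.loop (.var 6) (.seq outputProg.toProg (.seq .emit (nextProg m).toProg))))

open Polynomial in
/-- A bound for its delay. -/
noncomputable def liftingCost (m : Mode) : Polynomial ℕ :=
  3 * X + 5 + (setupProg m).cost + 2 * (outputProg.cost + (nextProg m).cost)

theorem setupProg_run {G : SimpleGraph ℕ} {n : ℕ} {m : Mode} {N : Set (Sym2 ℕ)} {σ : State}
    (h3 : σ.var 3 = n) (h5 : σ.var 5 = 0)
    (hadj : ∀ i < n, ∀ j < n, (σ.arr 0 (i * n + j) ≠ 0 ↔ G.Adj i j)) (h6 : ∀ t, σ.arr 6 t = 0)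
    (hN : N ⊆ Edges G (core G (pruned G n n)))
    (hw : ∀ t, σ.arr 2 t = ((matBits (fun i j => i ∈ core G (pruned G n n) ∧
      j ∈ core G (pruned G n n)) (fun i j => s(i, j) ∈ N) n n).getD t false).toNat) :
    LiftEnv G n (pruned G n n) N ((setupProg m).run σ).arr ∧
      (∀ x < n, LeastWith (Opt m G (pruned G n n) N x) (((setupProg m).run σ).arr 9 x)) ∧
      ((setupProg m).run σ).var 3 = n ∧ ((setupProg m).run σ).var 6 = 1 ∧
      ((setupProg m).run σ).buf = σ.buf := by
  obtain ⟨k1, k2, k3, k4, k5⟩ := kernelProg_run (G := G) h3 h5 hadj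
  set ρ1 := (kernelProg.run σ).setv 5 0 with hρ1
  have r3 : ρ1.var 3 = n := by rw [State.setv_ne _ _ (by omega), k5]
  have ra : ρ1.arr = (kernelProg.run σ).arr := rfl
  obtain ⟨s1, s2, s3⟩ := readProg_run (φ := coreCellF) (by decide) r3 k1.row (State.setv_self _ _ _)
    (fun t => by rw [ra, k3 6 (by omega) (by omega) (by omega), h6])
    (p := fun i j => i ∈ core G (pruned G n n) ∧ j ∈ core G (pruned G n n))
    (R := fun i j => s(i, j) ∈ N)
    (fun t => by rw [ra, k3 2 (by omega) (by omega) (by omega), hw])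
    (fun i hi j hj => sat_and (sat_in k2 hi rfl (by
      rw [State.setv_ne _ _ (by omega), State.setv_self]))
      (sat_in k2 hj rfl (State.setv_self _ _ _)))
  set ρ2 := (readProg coreCellF).run ρ1 with hρ2
  have q3 : ρ2.var 3 = n := by
    rw [hρ2, (readProg coreCellF).run_var (by decide), r3]
  have henv : LiftEnv G n (pruned G n n) N (ρ2.setv 7 n).arr := by
    refine ⟨⟨?_, ?_, ?_, k1.sub⟩, ⟨?_, ?_, ?_, k2.sub⟩, fun i hi j hj => ?_⟩
    · rw [State.setv_arr, s1 _ (by omega)]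
      exact k1.row
    · rw [State.setv_arr, s1 _ (by omega)]
      exact k1.adj
    · rw [State.setv_arr, s1 _ (by omega)]
      exact k1.mem
    · rw [State.setv_arr, s1 _ (by omega)]
      exact k2.row
    · rw [State.setv_arr, s1 _ (by omega)]
      exact k2.adj
    · rw [State.setv_arr, s1 _ (by omega)]
      exact k2.mem
    · rw [State.setv_arr, s2 i hi j hj]
      refine and_iff_right_of_imp fun h => ?_
      exact ⟨(mem_edges.1 (hN h)).1, (mem_edges.1 (hN h)).2.1⟩
  have p3 : (ρ2.setv 7 n).var 3 = n := by rw [State.setv_ne _ _ (by omega), q3]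
  obtain ⟨t1, t2, -, t4, t5⟩ := resetProg_run (m := m) henv (pruned_subset G n n) p3
  have e : (setupProg m).run σ = ((resetProg m).run (ρ2.setv 7 n)).setv 6 1 := by
    simp only [setupProg, BProg.run, Expr.eval]
    rw [← hρ1, ← hρ2, q3]
  rw [e]
  refine ⟨henv.congr t1, fun x hx => ?_, ?_, State.setv_self _ _ _, ?_⟩
  · exact t2 x hx (by rwa [State.setv_self])
  · rw [State.setv_ne _ _ (by omega), t4 3 (by omega) (by omega), p3]
  · rw [State.setv_buf, t5, State.setv_buf, s3, hρ1, State.setv_buf, k4]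

theorem outputProg_run {G : SimpleGraph ℕ} {n : ℕ} {S : Finset ℕ} {N : Set (Sym2 ℕ)} {σ : State}
    (h : LiftEnv G n S N σ.arr) (h3 : σ.var 3 = n) {c : ℕ → ℕ} (hc : ∀ x < n, σ.arr 9 x = c x) :
    (outputProg.run σ).arr = σ.arr ∧ (outputProg.run σ).buf = σ.buf ++
      matBits (fun _ _ => True) (fun i j => s(i, j) ∈ build G S n N c) n n :=
  writeProg_run (φ := constF true) (ψ := bitF) (by decide) (by decide) h3
    (fun _ _ _ _ _ _ _ _ _ => by simp [sat_const])
    (fun ρ hρ hρ3 i hi j hj h8 h10 => sat_bit h hi hj hρ hc hρ3 h8 h10)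

theorem nextProg_wf (m : Mode) : (nextProg m).wf = true := by cases m <;> decide

theorem nextProg_sets (m : Mode) : (nextProg m).sets 3 = false := by cases m <;> decide

theorem setupProg_wf (m : Mode) : (setupProg m).wf = true := by cases m <;> decide

theorem setupProg_sets (m : Mode) : (setupProg m).sets 3 = false := by cases m <;> decide

theorem lifting_run {G : SimpleGraph ℕ} {n : ℕ} (m : Mode) {N : Set (Sym2 ℕ)} {σ : State}
    (h0 : σ.var 0 = n * n) (h3 : σ.var 3 = 0) (h5 : σ.var 5 = 0) (hb : σ.buf = [])
    (hadj : ∀ i < n, ∀ j < n, (σ.arr 0 (i * n + j) ≠ 0 ↔ G.Adj i j)) (h6 : ∀ t, σ.arr 6 t = 0)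
    (hN : N ⊆ Edges G (core G (pruned G n n)))
    (hw : ∀ t, σ.arr 2 t = ((matBits (fun i j => i ∈ core G (pruned G n n) ∧
      j ∈ core G (pruned G n n)) (fun i j => s(i, j) ∈ N) n n).getD t false).toNat) :
    ∃ t τ, ∃ cs : List (ℕ → ℕ), Exec (lifting m) σ t τ ∧
      outputs t = cs.map (fun c => matBits (fun _ _ => True)
        (fun i j => s(i, j) ∈ build G (pruned G n n) n N c) n n) ∧
      t.length ≤ (cs.length + 1) * (liftingCost m).eval n ∧
      DelayAtMost t ((liftingCost m).eval n) ∧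
      (∀ c ∈ cs, ∀ x < n, Opt m G (pruned G n n) N x (c x)) ∧ cs.Pairwise (ChoiceLt n) ∧ cs ≠ [] ∧
      ∀ b, (∀ x < n, Opt m G (pruned G n n) N x (b x)) → ∃ c ∈ cs, ChoiceEq n c b := by
  set S := pruned G n n with hS
  have hSn : S ⊆ Finset.range n := pruned_subset G n n
  obtain ⟨τ, ⟨t, t1, t2, t3⟩, hτ3, hτ5, hτa, hτb⟩ := sizeProg_runs h0 h3 h5
  obtain ⟨e1, e2, e3, e4, e5⟩ := setupProg_run (m := m) hτ3 hτ5 (by rwa [hτa]) (by rwa [hτa]) hN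
    (by rwa [hτa])
  obtain ⟨u, u1, u2, u3⟩ := (setupProg m).runs (setupProg_wf m) (setupProg_sets m) τ
  rw [hτ3] at u3
  have hleast := e2
  obtain ⟨v, ρ, cs, v1, v2, v3, v4, v5, v6, -, v7⟩ := enumeration_loop (n := n)
    (D := (outputProg.cost + (nextProg m).cost).eval n) (P := Opt m G S N)
    (fun x hx y h => h.lt hSn hx) (W := outputProg.toProg) (N := (nextProg m).toProg)
    (fun c => matBits (fun _ _ => True) (fun i j => s(i, j) ∈ build G S n N c) n n)
    (fun c σ => LiftEnv G n S N σ.arr ∧ (∀ x < n, σ.arr 9 x = c x) ∧ σ.var 3 = n ∧ σ.var 6 ≠ 0 ∧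
      σ.buf = []) (by
      rintro c σ - ⟨i1, i2, i3, i4, i5⟩
      obtain ⟨o1, o2⟩ := outputProg_run i1 i3 i2
      have hv3 : (outputProg.run σ).var 3 = n := by
        rw [outputProg.run_var (by decide), i3]
      have hv6 : (outputProg.run σ).var 6 ≠ 0 := by
        rw [outputProg.run_var (by decide)]
        exact i4
      have r1 := outputProg.runs (by decide) (by decide) σ
      rw [i3] at r1
      have r2 := (nextProg m).runs (nextProg_wf m) (nextProg_sets m)
        { outputProg.run σ with buf := [] }
      have hv3' : ({ outputProg.run σ with buf := [] } : State).var 3 = n := hv3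
      rw [hv3'] at r2
      refine ⟨i4, _, r1.mono (by simp), by rw [o2, i5, List.nil_append], _, r2.mono (by simp), ?_⟩
      rcases nextProg_run (m := m) (σ := { outputProg.run σ with buf := [] }) (c := c)
        (by rw [o1]; exact i1) hSn hv3 hv6 (by rw [o1]; exact i2) with h | ⟨h1, h2, h3, h4, h5⟩
      · exact Or.inl h
      · exact Or.inr ⟨_, h2, h3, fun _ _ => rfl, h4, h1, h5⟩)
    (c := ((setupProg m).run τ).arr 9) (σ := (setupProg m).run τ) (fun x hx => (hleast x hx).1)
    ⟨e1, fun _ _ => rfl, e3, by rw [e4]; omega, by rw [e5, hτb, hb]⟩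
  -- Size computation and setup are silent and only postpone the first output.
  have hgaps := (v4.prefix u2 u3).prefix t2 t3
  have hcost : (liftingCost m).eval n = 3 * n + 5 + (setupProg m).cost.eval n +
      2 * (outputProg.cost + (nextProg m).cost).eval n := by
    unfold liftingCost
    generalize (setupProg m).cost = Q
    generalize outputProg.cost + (nextProg m).cost = R
    simp
  have hexec : Exec (lifting m) σ (t ++ (u ++ v)) ρ := .seq t1 (.seq u1 v1)
  refine ⟨_, ρ, cs, hexec, ?_, ?_, ?_, v5, v6, ?_, fun b hb => ?_⟩
  · rw [outputs_append, outputs_append, t2.outputs, u2.outputs, v2]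
    rfl
  · simp only [List.length_append]
    rw [hcost]
    have : cs.length * (2 * (outputProg.cost + (nextProg m).cost).eval n + 2) ≤
        cs.length * (3 * n + 5 + (setupProg m).cost.eval n +
          2 * (outputProg.cost + (nextProg m).cost).eval n) := Nat.mul_le_mul_left _ (by omega)
    rw [add_mul, one_mul]
    omega
  · exact hgaps.delay (by omega) (by omega)
  · rintro rfl
    obtain ⟨c, hc, -⟩ := v7 _ (fun x hx => (hleast x hx).1) (Or.inl fun _ _ => rfl)
    simp at hc
  · exact v7 b hb (least_eq_or_lt hleast hb)

/-! ## Transfer between graphs on `Fin k` and induced subgraphs of graphs on the natural numbers -/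

/-- `φ` is an increasing isomorphism from `H` onto `G[S]`. -/
structure Realizes {k : ℕ} (H : SimpleGraph (Fin k)) (φ : Fin k → ℕ) (G : SimpleGraph ℕ)
    (S : Finset ℕ) : Prop where
  mono : StrictMono φ
  mem : ∀ x, x ∈ S ↔ ∃ i, φ i = x
  adj : ∀ i j, H.Adj i j ↔ G.Adj (φ i) (φ j)

/-- The solutions of the enumeration problems. -/
def IsSolution {V : Type*} (m : Mode) (G : SimpleGraph V) (M : Set (Sym2 V)) : Prop :=
  match m with
  | .all => IsMatchingCut G M
  | .min => Minimal (IsMatchingCut G) M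
  | .max => Maximal (IsMatchingCut G) M

section Transfer

variable {k : ℕ} {H : SimpleGraph (Fin k)} {φ : Fin k → ℕ} {G : SimpleGraph ℕ} {S : Finset ℕ}

theorem mem_image_map (hφ : φ.Injective) {M : Set (Sym2 (Fin k))} {a b : Fin k} :
    s(φ a, φ b) ∈ Sym2.map φ '' M ↔ s(a, b) ∈ M := by
  rw [← Sym2.map_mk]
  exact (Sym2.map.injective hφ).mem_set_image

theorem mem_cut_fin {A : Set (Fin k)} {a b : Fin k} :
    s(a, b) ∈ {e | ∃ a ∈ A, ∃ b ∈ Aᶜ, H.Adj a b ∧ e = s(a, b)} ↔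
      H.Adj a b ∧ ¬ (a ∈ A ↔ b ∈ A) := by
  constructor
  · rintro ⟨x, hx, y, hy, hxy, he⟩
    have hy' : y ∉ A := hy
    rcases Sym2.eq_iff.1 he with ⟨rfl, rfl⟩ | ⟨rfl, rfl⟩
    · exact ⟨hxy, by tauto⟩
    · exact ⟨hxy.symm, by tauto⟩
  · rintro ⟨hab, hne⟩
    by_cases ha : a ∈ A
    · exact ⟨a, ha, b, fun hb => hne (by tauto), hab, rfl⟩
    · exact ⟨b, by tauto, a, ha, hab.symm, Sym2.eq_swap⟩

theorem Realizes.image_eq_cut (h : Realizes H φ G S) {M : Set (Sym2 (Fin k))} {A : Set (Fin k)}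
    {B : Set ℕ} (hAB : ∀ i, i ∈ A ↔ φ i ∈ B) :
    Sym2.map φ '' M = Cut G S B ↔ M = {e | ∃ a ∈ A, ∃ b ∈ Aᶜ, H.Adj a b ∧ e = s(a, b)} := by
  have hinj := h.mono.injective
  have key : ∀ i j, s(φ i, φ j) ∈ Cut G S B ↔ H.Adj i j ∧ ¬ (i ∈ A ↔ j ∈ A) := by
    intro i j
    rw [mem_cut, h.adj, hAB, hAB]
    have hi := (h.mem (φ i)).2 ⟨i, rfl⟩
    have hj := (h.mem (φ j)).2 ⟨j, rfl⟩
    tauto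
  constructor
  · intro he
    ext e
    induction e with
    | _ i j => rw [mem_cut_fin, ← key, ← he, mem_image_map hinj]
  · rintro rfl
    refine sym2_ext fun x y => ⟨fun hxy => ?_, fun hxy => ?_⟩
    · obtain ⟨e, he, hexy⟩ := hxy
      induction e with
      | _ i j =>
        rw [← hexy, Sym2.map_mk]
        exact (key i j).2 (mem_cut_fin.1 he)
    · obtain ⟨hx, hy, -⟩ := mem_cut.1 hxy
      obtain ⟨i, rfl⟩ := (h.mem x).1 hx
      obtain ⟨j, rfl⟩ := (h.mem y).1 hy
      exact (mem_image_map hinj).2 (mem_cut_fin.2 ((key i j).1 hxy))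

theorem mat_image (hφ : φ.Injective) {M : Set (Sym2 (Fin k))} : Mat (Sym2.map φ '' M) ↔
    ∀ e ∈ M, ∀ e' ∈ M, ∀ v : Fin k, v ∈ e → v ∈ e' → e = e' := by
  constructor
  · rintro h e he e' he' v ⟨a, rfl⟩ ⟨b, rfl⟩
    rw [hφ (h (φ v) (φ a) (φ b) ((mem_image_map hφ).2 he) ((mem_image_map hφ).2 he'))]
  · rintro h v a b ⟨e, he, hea⟩ ⟨e', he', heb⟩
    obtain ⟨x, hx, hxv⟩ := Sym2.mem_map.1 (hea ▸ Sym2.mem_mk_left v a : v ∈ Sym2.map φ e)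
    obtain ⟨y, hy, hyv⟩ := Sym2.mem_map.1 (heb ▸ Sym2.mem_mk_left v b : v ∈ Sym2.map φ e')
    obtain rfl := hφ (hxv.trans hyv.symm)
    rw [h e he e' he' x hx hy, heb] at hea
    exact (Sym2.congr_right.1 hea).symm

theorem Realizes.mc_image (h : Realizes H φ G S) {M : Set (Sym2 (Fin k))} :
    IsMatchingCut H M ↔ MC G S (Sym2.map φ '' M) := by
  refine and_congr ?_ (mat_image h.mono.injective).symm
  constructor
  · rintro ⟨A, ⟨a, ha⟩, ⟨b, hb⟩, hM⟩
    have hAB : ∀ i, i ∈ A ↔ φ i ∈ φ '' A := fun i => (h.mono.injective.mem_set_image).symm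
    exact ⟨φ '' A, ⟨⟨φ a, (h.mem _).2 ⟨a, rfl⟩, (hAB a).1 ha⟩, φ b, (h.mem _).2 ⟨b, rfl⟩,
      fun h => hb ((hAB b).2 h)⟩, (h.image_eq_cut hAB).2 hM⟩
  · rintro ⟨B, ⟨⟨x, hx, hxB⟩, y, hy, hyB⟩, hM⟩
    obtain ⟨i, rfl⟩ := (h.mem x).1 hx
    obtain ⟨j, rfl⟩ := (h.mem y).1 hy
    exact ⟨φ ⁻¹' B, ⟨i, hxB⟩, ⟨j, hyB⟩, (h.image_eq_cut fun _ => Iff.rfl).1 hM⟩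

theorem Realizes.exists_image (h : Realizes H φ G S) {N : Set (Sym2 ℕ)} (hN : N ⊆ Edges G S) :
    ∃ M, N = Sym2.map φ '' M := by
  refine ⟨Sym2.map φ ⁻¹' N, (Set.image_preimage_eq_of_subset fun e he => ?_).symm⟩
  obtain ⟨x, hx, y, hy, -, rfl⟩ := hN he
  obtain ⟨i, rfl⟩ := (h.mem x).1 hx
  obtain ⟨j, rfl⟩ := (h.mem y).1 hy
  exact ⟨s(i, j), rfl⟩

/-- A competing cut of `G[S]` has all its edges inside `S`, hence is an image as well; so minimality
and maximality transfer. -/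
theorem Realizes.solution_image (h : Realizes H φ G S) {m : Mode} {M : Set (Sym2 (Fin k))} :
    IsSolution m H M ↔ Sol m G S (Sym2.map φ '' M) := by
  have hsub : ∀ {M M' : Set (Sym2 (Fin k))}, Sym2.map φ '' M ⊆ Sym2.map φ '' M' ↔ M ⊆ M' :=
    Set.image_subset_image_iff (Sym2.map.injective h.mono.injective)
  cases m with
  | all => exact h.mc_image
  | min =>
    refine and_congr h.mc_image ⟨fun hM N hN hle => ?_, fun hM M' hM' hle => ?_⟩
    · obtain ⟨M', rfl⟩ := h.exists_image (mc_iff.1 hN).1.edges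
      exact hsub.2 (hM (h.mc_image.2 hN) (hsub.1 hle))
    · exact hsub.1 (hM (h.mc_image.1 hM') (hsub.2 hle))
  | max =>
    refine and_congr h.mc_image ⟨fun hM N hN hle => ?_, fun hM M' hM' hle => ?_⟩
    · obtain ⟨M', rfl⟩ := h.exists_image (mc_iff.1 hN).1.edges
      exact hsub.2 (hM (h.mc_image.2 hN) (hsub.1 hle))
    · exact hsub.1 (hM (h.mc_image.1 hM') (hsub.2 hle))

theorem Sol.edges {m : Mode} {N : Set (Sym2 ℕ)} (h : Sol m G S N) : N ⊆ Edges G S :=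
  (mc_iff.1 h.mc).1.edges

theorem sol_pruned {n : ℕ} {m : Mode} {N : Set (Sym2 ℕ)} :
    Sol m G (pruned G n n) N ↔ Sol m G (Finset.range n) N := by
  have : MC G (Finset.range n) = MC G (pruned G n n) := funext fun M => propext (pruned_mc G n n M)
  cases m <;> simp only [Sol, this]

/-! ## Matrices as words -/

theorem filter_range_eq_ofFn {n : ℕ} (hφ : StrictMono φ) (hmem : ∀ x, x ∈ S ↔ ∃ i, φ i = x)
    (hS : S ⊆ Finset.range n) : (List.range n).filter (fun x => decide (x ∈ S)) = List.ofFn φ := by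
  refine List.Pairwise.eq_of_mem_iff (r := (· < ·)) (List.pairwise_lt_range.filter _)
    (List.pairwise_ofFn.2 fun i j hij => hφ hij) fun x => ?_
  simp only [List.mem_filter, List.mem_range, decide_eq_true_eq, List.mem_ofFn]
  rw [hmem]
  refine and_iff_right_of_imp fun h => ?_
  exact Finset.mem_range.1 (hS ((hmem x).2 h))

theorem flatMap_ite {α β : Type*} (l : List α) (p : α → Prop) [DecidablePred p] (f : α → List β) :
    (l.flatMap fun x => if p x then f x else []) = (l.filter fun x => decide (p x)).flatMap f := by
  induction l with
  | nil => rfl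
  | cons a l ih => by_cases h : p a <;> simp [h, ih]

/-- Since `φ` is increasing, listing the matrix of the induced subgraph row by row agrees with
scanning the large matrix and keeping the positions in `S × S`. -/
theorem matrixWord_eq {n : ℕ} (hφ : StrictMono φ) (hmem : ∀ x, x ∈ S ↔ ∃ i, φ i = x)
    (hS : S ⊆ Finset.range n) (R : ℕ → ℕ → Prop) :
    matrixWord (fun i j => R (φ i) (φ j)) =
      matBits (fun i j => i ∈ S ∧ j ∈ S) R n n := by
  classical
  have hrow : ∀ i, rowBits (fun i j => i ∈ S ∧ j ∈ S) R i n =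
      if i ∈ S then List.ofFn (fun j => decide (R i (φ j))) else [] := by
    intro i
    split_ifs with hi
    · simp only [rowBits, hi, true_and]
      rw [flatMap_ite, filter_range_eq_ofFn hφ hmem hS, ← List.map_eq_flatMap, List.map_ofFn]
      rfl
    · simp [rowBits, hi]
  simp only [matBits, hrow]
  rw [flatMap_ite, filter_range_eq_ofFn hφ hmem hS, matrixWord, List.ofFn_mul, List.flatMap,
    List.map_ofFn]
  congr 2
  funext i
  congr 1
  funext j
  have hk : 0 < k := i.pos
  have h1 : (⟨i * k + j, by
      calc (i : ℕ) * k + j < (i + 1) * k := by rw [add_mul, one_mul]; omega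
        _ ≤ k * k := Nat.mul_le_mul_right _ i.2⟩ : Fin (k * k)) = finProdFinEquiv (i, j) := by
    ext
    simp [finProdFinEquiv]
    ring
  have h2 : (finProdFinEquiv (i, j)).divNat = i :=
    congrArg Prod.fst (finProdFinEquiv.symm_apply_apply (i, j))
  have h3 : (finProdFinEquiv (i, j)).modNat = j :=
    congrArg Prod.snd (finProdFinEquiv.symm_apply_apply (i, j))
  rw [h1, h2, h3]

theorem Realizes.code_eq {n : ℕ} (h : Realizes H φ G S) (hS : S ⊆ Finset.range n) :
    matrixWord H.Adj = matBits (fun i j => i ∈ S ∧ j ∈ S) G.Adj n n := by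
  rw [← matrixWord_eq h.mono h.mem hS]
  congr 1
  funext i j
  exact propext (h.adj i j)

theorem Realizes.edgesCode_eq {n : ℕ} (h : Realizes H φ G S) (hS : S ⊆ Finset.range n)
    (M : Set (Sym2 (Fin k))) : edgesCode M =
      matBits (fun i j => i ∈ S ∧ j ∈ S) (fun i j => s(i, j) ∈ Sym2.map φ '' M) n n := by
  rw [← matrixWord_eq h.mono h.mem hS, edgesCode]
  congr 1
  funext i j
  exact propext (mem_image_map h.mono.injective).symm

theorem edgesCode_injective {k : ℕ} :
    Function.Injective (edgesCode : Set (Sym2 (Fin k)) → Word) := by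
  intro M M' h
  have := matrixWord_injective h
  ext e
  induction e with
  | _ i j => exact iff_of_eq (congrFun (congrFun this i) j)

end Transfer

/-! ## The graph and its kernel -/

/-- The graph, with isolated vertices added. -/
def natGraph (G : FinGraph) : SimpleGraph ℕ := G.graph.map Fin.valEmbedding

theorem realizes_natGraph (G : FinGraph) :
    Realizes G.graph Fin.val (natGraph G) (Finset.range G.n) := by
  refine ⟨Fin.val_strictMono, fun x => ?_, fun i j => ?_⟩
  · rw [Finset.mem_range]
    exact ⟨fun h => ⟨⟨x, h⟩, rfl⟩, by rintro ⟨i, rfl⟩; exact i.2⟩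
  · exact SimpleGraph.map_adj_apply.symm

/-- The vertices of the kernel. -/
noncomputable def kernelSet (G : FinGraph) : Finset ℕ :=
  core (natGraph G) (pruned (natGraph G) G.n G.n)

theorem kernelSet_subset (G : FinGraph) : kernelSet G ⊆ Finset.range G.n :=
  core_subset.trans (pruned_subset _ _ _)

/-- The kernel. -/
noncomputable def kernelGraph (G : FinGraph) : FinGraph where
  n := (kernelSet G).card
  graph := (natGraph G).comap ((kernelSet G).orderEmbOfFin rfl)

theorem realizes_kernelGraph (G : FinGraph) :
    Realizes (kernelGraph G).graph ((kernelSet G).orderEmbOfFin rfl) (natGraph G)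
      (kernelSet G) := by
  refine ⟨((kernelSet G).orderEmbOfFin rfl).strictMono, fun x => ?_, fun i j => Iff.rfl⟩
  rw [← Finset.mem_coe, ← Finset.range_orderEmbOfFin (kernelSet G) rfl, Set.mem_range]
  rfl

/-! ## The parameters -/

section Parameter

variable (G : FinGraph)

instance : Finite (Quotient (trueTwinSetoid G.graph)) := Quotient.finite _

theorem trueTwins_adj {V : Type*} {G : SimpleGraph V} {u v w : V} (h : TrueTwins G u v)
    (hw : w ≠ v) (ha : G.Adj u w) : G.Adj v w := by
  have h1 : w ∈ insert u (G.neighborSet u) := Or.inr ha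
  rw [h] at h1
  exact h1.resolve_left hw

theorem quotient_adj {V : Type*} {G : SimpleGraph V} {u v : V} (h : G.Adj u v)
    (hne : ¬ TrueTwins G u v) : (trueTwinQuotient G).Adj
      (Quotient.mk (trueTwinSetoid G) u) (Quotient.mk (trueTwinSetoid G) v) := by
  refine ⟨fun he => hne (Quotient.exact he), fun u' v' hu hv => ?_⟩
  have tu : TrueTwins G u u' := (Quotient.exact hu : TrueTwins G u' u).symm
  have tv : TrueTwins G v v' := (Quotient.exact hv : TrueTwins G v' v).symm
  have h1 : G.Adj u' v := by
    refine trueTwins_adj tu ?_ h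
    rintro rfl
    exact hne tu
  refine (trueTwins_adj tv ?_ h1.symm).symm
  rintro rfl
  exact hne (tu.trans tv.symm)

/-- The classes are the twin classes of the input, made total on the natural numbers by `none`; the
cover is an optimal one of the quotient. -/
theorem card_kernelSet_le :
    (kernelSet G).card ≤ 11 * (quotientVertexCoverNum G ^ 2 + 1) := by
  classical
  obtain ⟨Y, hY, hcov⟩ := (trueTwinQuotient G.graph).vertexCoverNum_exists
  have hfin : Y.Finite := Y.toFinite
  let cls : ℕ → Option (Quotient (trueTwinSetoid G.graph)) := fun u =>
    if h : u < G.n then some (Quotient.mk _ ⟨u, h⟩) else none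
  have hcls : ∀ u (h : u < G.n), cls u = some (Quotient.mk _ ⟨u, h⟩) := fun u h => dif_pos h
  have hcard : (hfin.toFinset.map .some).card = quotientVertexCoverNum G := by
    rw [Finset.card_map, quotientVertexCoverNum, ← hY, hfin.encard_eq_coe_toFinset_card]
    rfl
  have hadj : ∀ u v (hu : u < G.n) (hv : v < G.n),
      (natGraph G).Adj u v ↔ G.graph.Adj ⟨u, hu⟩ ⟨v, hv⟩ :=
    fun u v hu hv => ((realizes_natGraph G).adj ⟨u, hu⟩ ⟨v, hv⟩).symm
  rw [← hcard]
  refine card_core_le cls _ (fun u hu v hv h => ?_) fun u hu v hv h => ?_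
  · rw [hcls u hu, hcls v hv, Option.some_inj] at h
    have ht : TrueTwins G.graph ⟨u, hu⟩ ⟨v, hv⟩ := Quotient.exact h
    refine ⟨?_, fun w hw hwu hwv => ?_⟩
    · have h1 : (⟨u, hu⟩ : Fin G.n) ∈ insert ⟨v, hv⟩ (G.graph.neighborSet ⟨v, hv⟩) := by
        rw [← ht]
        exact Set.mem_insert _ _
      rcases h1 with h1 | h1
      · exact Or.inl (congrArg Fin.val h1)
      · exact Or.inr ((hadj u v hu hv).2 h1.symm)
    · have hwn := Finset.mem_range.1 hw
      rw [hadj u w hu hwn, hadj v w hv hwn]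
      exact ⟨trueTwins_adj ht fun h => hwv (congrArg Fin.val h),
        trueTwins_adj ht.symm fun h => hwu (congrArg Fin.val h)⟩
  · rw [hcls u hu, hcls v hv]
    by_cases ht : TrueTwins G.graph ⟨u, hu⟩ ⟨v, hv⟩
    · exact Or.inl (congrArg some (Quotient.sound ht))
    · right
      have := hcov (quotient_adj ((hadj u v hu hv).1 h) ht)
      simpa using this

/-- The classes met by a twin-cover form a vertex cover of the quotient, because vertices of
distinct classes are not twins. -/
theorem quotientVertexCoverNum_le_card {X : Finset (Fin G.n)} (hX : IsTwinCover G.graph X) :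
    quotientVertexCoverNum G ≤ X.card := by
  classical
  have hcov : (trueTwinQuotient G.graph).IsVertexCover
      (Quotient.mk (trueTwinSetoid G.graph) '' X) := by
    intro a b hab
    induction a using Quotient.inductionOn with
    | _ u =>
    induction b using Quotient.inductionOn with
    | _ v =>
    rcases hX u v (hab.2 u v rfl rfl) with h | h | h
    · exact Or.inl ⟨u, h, rfl⟩
    · exact Or.inr ⟨v, h, rfl⟩
    · exact absurd (Quotient.sound h) hab.1
  refine ENat.toNat_le_of_le_natCast (hcov.vertexCoverNum_le.trans ?_)
  exact (Set.encard_image_le _ _).trans (Set.encard_coe_eq_coe_finsetCard X).le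

theorem twinCoverNum_spec : ∃ X : Finset (Fin G.n), IsTwinCover G.graph X ∧
    X.card = twinCoverNum G :=
  Nat.sInf_mem (s := {k | ∃ X : Finset (Fin G.n), IsTwinCover G.graph X ∧ X.card = k})
    ⟨_, Finset.univ, fun u _ _ => Or.inl (Finset.mem_univ u), rfl⟩

theorem quotientVertexCoverNum_le_twinCoverNum :
    quotientVertexCoverNum G ≤ twinCoverNum G := by
  obtain ⟨X, hX, h⟩ := twinCoverNum_spec G
  exact h ▸ quotientVertexCoverNum_le_card G hX

/-- Bounds the parameter of the kernel itself by its number of vertices. -/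
theorem twinCoverNum_le : twinCoverNum G ≤ G.n := by
  refine Nat.sInf_le ⟨Finset.univ, fun u _ _ => Or.inl (Finset.mem_univ u), ?_⟩
  simp

end Parameter

/-! ## The algorithms on the codes of graphs -/

theorem eval_mono (p : Polynomial ℕ) {a b : ℕ} (h : a ≤ b) : p.eval a ≤ p.eval b := by
  rw [Polynomial.eval_eq_sum, Polynomial.eval_eq_sum]
  exact Finset.sum_le_sum fun i _ => Nat.mul_le_mul_left _ (Nat.pow_le_pow_left h i)

theorem getD_matrixWord {n : ℕ} (R : Fin n → Fin n → Prop) (i j : Fin n) :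
    (matrixWord R).getD (i * n + j) false = true ↔ R i j := by
  have hlt : (i : ℕ) * n + j < n * n :=
    calc (i : ℕ) * n + j < (i + 1) * n := by rw [add_mul, one_mul]; omega
      _ ≤ n * n := Nat.mul_le_mul_right _ i.2
  have h1 : (⟨i * n + j, hlt⟩ : Fin (n * n)) = finProdFinEquiv (i, j) := by
    ext
    simp [finProdFinEquiv]
    ring
  have h2 : (finProdFinEquiv (i, j)).divNat = i :=
    congrArg Prod.fst (finProdFinEquiv.symm_apply_apply (i, j))
  have h3 : (finProdFinEquiv (i, j)).modNat = j :=
    congrArg Prod.snd (finProdFinEquiv.symm_apply_apply (i, j))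
  have hlen : (i : ℕ) * n + j < (matrixWord R).length := by rwa [length_matrixWord]
  rw [List.getD_eq_getElem _ _ hlen]
  simp only [matrixWord, List.getElem_ofFn]
  rw [h1, h2, h3]
  exact @decide_eq_true_iff _ (Classical.propDecidable _)

section Code

variable (G : FinGraph)

theorem initState_adj (ws : List Word) : ∀ i < G.n, ∀ j < G.n,
    ((initState (G.code :: ws)).arr 0 (i * G.n + j) ≠ 0 ↔ (natGraph G).Adj i j) := by
  intro i hi j hj
  rw [← (realizes_natGraph G).adj ⟨i, hi⟩ ⟨j, hj⟩, ← getD_matrixWord G.graph.Adj]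
  simp only [initState, List.getD_cons_zero, FinGraph.code]
  cases (matrixWord G.graph.Adj).getD (i * G.n + j) false <;> simp

theorem initState_length (ws : List Word) : (initState (G.code :: ws)).var 0 = G.n * G.n := by
  simp [initState, FinGraph.code, length_matrixWord]

theorem kernelization_spec : ∃ t, Run kernelization [G.code] t ∧
    outputs t = [(kernelGraph G).code] ∧ TimeAtMost t (kernelizationCost.eval G.n) := by
  obtain ⟨t, τ, h1, h2, h3⟩ := kernelization_run (G := natGraph G) (initState_length G []) rfl rfl rfl
    (initState_adj G [])
  refine ⟨t, ⟨τ, h1⟩, h3.trans ?_, h2⟩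
  rw [FinGraph.code, (realizes_kernelGraph G).code_eq (kernelSet_subset G)]
  rfl

/-- The word for the projection of an edge set to the kernel. -/
noncomputable def projWord (M : Set (Sym2 (Fin G.n))) : Word :=
  matBits (fun i j => i ∈ kernelSet G ∧ j ∈ kernelSet G)
    (fun i j => s(i, j) ∈ proj (natGraph G) (pruned (natGraph G) G.n G.n) (Sym2.map Fin.val '' M))
    G.n G.n

variable {G} {m : Mode}

theorem solution_iff {M : Set (Sym2 (Fin G.n))} : IsSolution m G.graph M ↔
    Sol m (natGraph G) (pruned (natGraph G) G.n G.n) (Sym2.map Fin.val '' M) :=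
  (realizes_natGraph G).solution_image.trans sol_pruned.symm

theorem kernel_solution_iff {M : Set (Sym2 (Fin (kernelGraph G).n))} :
    IsSolution m (kernelGraph G).graph M ↔ Sol m (natGraph G)
      (core (natGraph G) (pruned (natGraph G) G.n G.n))
      (Sym2.map ((kernelSet G).orderEmbOfFin rfl) '' M) :=
  (realizes_kernelGraph G).solution_image

theorem kernel_edgesCode (M : Set (Sym2 (Fin (kernelGraph G).n))) : edgesCode M =
    matBits (fun i j => i ∈ kernelSet G ∧ j ∈ kernelSet G)
      (fun i j => s(i, j) ∈ Sym2.map ((kernelSet G).orderEmbOfFin rfl) '' M) G.n G.n :=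
  (realizes_kernelGraph G).edgesCode_eq (kernelSet_subset G) M

theorem projWord_eq {M : Set (Sym2 (Fin G.n))} (h : IsSolution m G.graph M) :
    ∃ N, IsSolution m (kernelGraph G).graph N ∧ projWord G M = edgesCode N ∧
      proj (natGraph G) (pruned (natGraph G) G.n G.n) (Sym2.map Fin.val '' M) =
        Sym2.map ((kernelSet G).orderEmbOfFin rfl) '' N := by
  have h1 := (solution_iff.1 h).proj.1
  obtain ⟨N, hN⟩ := (realizes_kernelGraph G).exists_image h1.edges
  exact ⟨N, kernel_solution_iff.2 (hN ▸ h1), by rw [projWord, hN, kernel_edgesCode]; rfl, hN⟩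

theorem build_congr {H : SimpleGraph ℕ} {S : Finset ℕ} {n : ℕ} {N : Set (Sym2 ℕ)} {c c' : ℕ → ℕ}
    (h : ChoiceEq n c c') : build H S n N c = build H S n N c' := by
  refine congrArg (Free H S N ∪ ·) (Set.ext fun e => exists_congr fun x => and_congr_right fun hx => ?_)
  rw [h x hx]

/-- The choices differ only at `x0`, where their values strictly increase along the list. The
default `0` covers the case that `x0` is not a vertex, and then there is at most one choice. -/
theorem length_choices_le {H : SimpleGraph ℕ} {S : Finset ℕ} {n : ℕ} {N : Set (Sym2 ℕ)}
    (hS : S ⊆ Finset.range n) (hN : Minimal (MC H (core H S)) N) {cs : List (ℕ → ℕ)}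
    (hcs : ∀ c ∈ cs, ∀ x < n, Opt .min H S N x (c x)) (hlt : cs.Pairwise (ChoiceLt n)) :
    cs.length ≤ n + 1 := by
  obtain ⟨x0, hx0⟩ := exists_choice_vertex hN
  have key : (cs.map fun c => if x0 < n then c x0 else 0).Pairwise (· < ·) := by
    rw [List.pairwise_map]
    refine hlt.imp_of_mem fun {c c'} hc hc' hcc' => ?_
    obtain ⟨x, hx, hxlt, -⟩ := hcc'
    by_cases hxx : x = x0
    · subst hxx
      simpa [hx] using hxlt
    · rw [hx0 x _ (hcs c hc x hx) hxx, hx0 x _ (hcs c' hc' x hx) hxx] at hxlt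
      exact absurd hxlt (lt_irrefl _)
  have hnd : (cs.map fun c => if x0 < n then c x0 else 0).Nodup := key.imp fun h => h.ne
  rw [← List.length_map (fun c : ℕ → ℕ => if x0 < n then c x0 else 0),
    ← List.toFinset_card_of_nodup hnd]
  refine (Finset.card_le_card fun y hy => ?_).trans_eq (Finset.card_range (n + 1))
  obtain ⟨c, hc, rfl⟩ := List.mem_map.1 (List.mem_toFinset.1 hy)
  rw [Finset.mem_range]
  split_ifs with h
  · exact Nat.lt_succ_of_lt ((hcs c hc x0 h).lt hS h)
  · omega

/-- The listed set is the fiber of `projWord` over `s`, which makes the disjointness and the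
covering property in `isLifting` immediate. -/
theorem lifting_spec {s : Word} (hs : s ∈ edgesCode '' {N | IsSolution m (kernelGraph G).graph N}) :
    ∃ t, Run (lifting m) [G.code, (kernelGraph G).code, s] t ∧
      DelayAtMost t ((liftingCost m).eval G.n) ∧
      (m = .min → TimeAtMost t ((G.n + 2) * (liftingCost m).eval G.n)) ∧
      (outputs t).Nodup ∧ outputs t ≠ [] ∧
      ∀ w, w ∈ outputs t ↔ ∃ M, IsSolution m G.graph M ∧ edgesCode M = w ∧ projWord G M = s := by
  obtain ⟨N₀, hN₀, rfl⟩ := hs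
  set N := Sym2.map ((kernelSet G).orderEmbOfFin rfl) '' N₀ with hN
  have hsol := kernel_solution_iff.1 hN₀
  rw [← hN] at hsol
  set S := pruned (natGraph G) G.n G.n with hS
  have hSn : S ⊆ Finset.range G.n := pruned_subset _ _ _
  have hcode := kernel_edgesCode N₀
  rw [← hN] at hcode
  obtain ⟨t, τ, cs, h1, h2, h3, h4, h5, h6, h7, h8⟩ := lifting_run (G := natGraph G) (n := G.n)
    (N := N) (σ := initState [G.code, (kernelGraph G).code, edgesCode N₀]) m (initState_length G _)
    rfl rfl rfl (initState_adj G _) (fun _ => rfl) hsol.edges (fun t => by rw [hcode]; rfl)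
  have hword : ∀ R : ℕ → ℕ → Prop, matBits (fun _ _ => True) R G.n G.n =
      matrixWord fun i j : Fin G.n => R i j := by
    intro R
    rw [matrixWord_eq (realizes_natGraph G).mono (realizes_natGraph G).mem subset_rfl]
    exact matBits_congr (fun i hi j hj => by simp [hi, hj]) fun _ _ _ _ _ => Iff.rfl
  have hlift : ∀ c ∈ cs, Lifts m (natGraph G) S N (build (natGraph G) S G.n N c) :=
    fun c hc => lifts_build hSn (mc_iff.1 hsol.mc).1 (h5 c hc)
  have himage : ∀ c ∈ cs, ∃ M, build (natGraph G) S G.n N c = Sym2.map Fin.val '' M :=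
    fun c hc => (realizes_natGraph G).exists_image ((hlift c hc).1.trans (edges_mono hSn))
  have hinj := (realizes_natGraph G).mono.injective
  have hbits : ∀ M : Set (Sym2 (Fin G.n)), matBits (fun _ _ => True)
      (fun i j => s(i, j) ∈ Sym2.map Fin.val '' M) G.n G.n = edgesCode M := by
    intro M
    rw [hword, edgesCode]
    congr 1
    funext i j
    exact propext (mem_image_map hinj)
  refine ⟨t, ⟨τ, h1⟩, h4, fun hm => ?_, ?_, ?_, fun w => ?_⟩
  · subst hm
    refine h3.trans (Nat.mul_le_mul_right _ ?_)
    have := length_choices_le hSn hsol h5 h6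
    omega
  · rw [h2, List.Nodup, List.pairwise_map]
    refine h6.imp_of_mem fun {c c'} hc hc' hlt heq => ?_
    obtain ⟨M, hM⟩ := himage c hc
    obtain ⟨M', hM'⟩ := himage c' hc'
    rw [hM, hM', hbits, hbits] at heq
    rw [edgesCode_injective heq, ← hM'] at hM
    exact hlt.not_eq (build_injective (h5 c hc) (h5 c' hc') hM)
  · rw [h2]
    simpa using h7
  · rw [h2, List.mem_map]
    constructor
    · rintro ⟨c, hc, rfl⟩
      obtain ⟨M, hM⟩ := himage c hc
      have hl := hlift c hc
      refine ⟨M, solution_iff.2 ?_, ?_, ?_⟩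
      · rw [← hM]
        exact hl.sol hsol
      · rw [hM, hbits]
      · rw [projWord, ← hM, hl.2.2.1, hcode]
    · rintro ⟨M, hM, rfl, hMs⟩
      obtain ⟨N', -, hN'1, hN'2⟩ := projWord_eq hM
      rw [hMs] at hN'1
      have hproj := (solution_iff.1 hM).proj.2
      rw [hN'2, ← edgesCode_injective hN'1, ← hN] at hproj
      obtain ⟨c, hc, hMc⟩ := hproj.exists_build hSn
      obtain ⟨c', hc', heq⟩ := h8 c hc
      refine ⟨c', hc', ?_⟩
      rw [build_congr heq, ← hMc, hbits]

end Code

/-! ## The kernels -/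

/-- The enumeration problem for a parameter. -/
noncomputable def problem (m : Mode) (κ : FinGraph → ℕ) : ParamEnumProblem :=
  enumEdgeSets (fun G M => IsSolution m G.graph M) κ

/-- The bound for the number of vertices. -/
def vertexBound (k : ℕ) : ℕ := 11 * (k ^ 2 + 1)

theorem computable_bound :
    Computable fun k => vertexBound k * vertexBound k + vertexBound k := by
  have h1 : Primrec vertexBound := by
    have : Primrec fun k : ℕ => 11 * (k * k + 1) :=
      Primrec.nat_mul.comp (Primrec.const 11)
        (Primrec.succ.comp (Primrec.nat_mul.comp Primrec.id Primrec.id))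
    exact this.of_eq fun k => by rw [vertexBound, sq]
  exact (Primrec.nat_add.comp (Primrec.nat_mul.comp h1 h1) h1).to_comp

section Kernel

variable {κ : FinGraph → ℕ}

theorem le_size (m : Mode) (κ : FinGraph → ℕ) (G : FinGraph) : G.n ≤ (problem m κ).size G := by
  change G.n ≤ G.code.length
  rw [FinGraph.code, length_matrixWord]
  exact Nat.le_mul_self _

theorem kernel_card_le (h1 : ∀ G, quotientVertexCoverNum G ≤ κ G) (G : FinGraph) :
    (kernelGraph G).n ≤ vertexBound (κ G) :=
  (card_kernelSet_le G).trans (Nat.mul_le_mul_left _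
    (Nat.succ_le_succ (Nat.pow_le_pow_left (h1 G) 2)))

/-- With at most `b` vertices the adjacency matrix has at most `b * b` bits, and by `h2` the
parameter of the kernel is at most `b`. -/
theorem isKernelization (h1 : ∀ G, quotientVertexCoverNum G ≤ κ G)
    (h2 : ∀ G, κ G ≤ G.n) (m : Mode) :
    IsKernelization (problem m κ) kernelization kernelGraph := by
  refine ⟨⟨kernelizationCost, fun G => ?_⟩, _, computable_bound, fun G => ?_⟩
  · obtain ⟨t, h3, h4, h5⟩ := kernelization_spec G
    exact ⟨t, h3, h4, h5.trans (eval_mono _ ((le_size m κ G).trans (Nat.le_add_right _ _)))⟩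
  · have h := kernel_card_le h1 G
    refine Nat.add_le_add ?_ ((h2 _).trans h)
    change (kernelGraph G).code.length ≤ _
    rw [FinGraph.code, length_matrixWord]
    exact Nat.mul_le_mul h h

/-- One polynomial serves both resources: the factor `n + 2` is needed only for the total time in
the minimal case, which has at most `n + 1` outputs. -/
theorem isLifting (m : Mode) (κ : FinGraph → ℕ) {Bound : Trace → ℕ → Prop}
    (hmono : ∀ t d d', d ≤ d' → Bound t d → Bound t d')
    (hB : ∀ t n, DelayAtMost t ((liftingCost m).eval n) →
      (m = .min → TimeAtMost t ((n + 2) * (liftingCost m).eval n)) →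
      Bound t ((n + 2) * (liftingCost m).eval n)) :
    IsLifting Bound (problem m κ) (lifting m) kernelGraph := by
  classical
  choose! T hT using fun (G : FinGraph) (s : Word)
    (hs : s ∈ edgesCode '' {N | IsSolution m (kernelGraph G).graph N}) => lifting_spec hs
  refine ⟨(Polynomial.X + 2) * liftingCost m, T, fun G => ⟨fun s hs => ?_, ?_, ?_⟩⟩
  · obtain ⟨h3, h4, h5, h6, h7, -⟩ := hT G s hs
    refine ⟨h3, hmono _ _ _ ?_ (hB _ _ h4 h5), h6, h7⟩
    have hle := le_size m κ G
    generalize liftingCost m = Q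
    rw [Polynomial.eval_mul]
    refine Nat.mul_le_mul ?_ (eval_mono _ (by omega))
    simp
    omega
  · intro s hs s' hs' hne
    refine Set.disjoint_left.2 fun w hw hw' => hne ?_
    obtain ⟨M, -, hM, rfl⟩ := ((hT G s hs).2.2.2.2.2 w).1 hw
    obtain ⟨M', -, hM', rfl⟩ := ((hT G s' hs').2.2.2.2.2 w).1 hw'
    rw [edgesCode_injective (hM.trans hM'.symm)]
  · ext w
    simp only [Set.mem_iUnion]
    constructor
    · rintro ⟨s, hs, hw⟩
      obtain ⟨M, hM, rfl, -⟩ := ((hT G s hs).2.2.2.2.2 w).1 hw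
      exact ⟨M, hM, rfl⟩
    · rintro ⟨M, hM, rfl⟩
      obtain ⟨N, hN, hN', -⟩ := projWord_eq hM
      have hs : projWord G M ∈ edgesCode '' {N | IsSolution m (kernelGraph G).graph N} :=
        ⟨N, hN, hN'.symm⟩
      exact ⟨_, hs, ((hT G _ hs).2.2.2.2.2 _).2 ⟨M, hM, rfl, rfl⟩⟩

theorem hasFullyPolynomialKernel (h1 : ∀ G, quotientVertexCoverNum G ≤ κ G)
    (h2 : ∀ G, κ G ≤ G.n) :
    HasFullyPolynomialKernel (problem .min κ) FinGraph.n (fun k => 11 * (k ^ 2 + 1)) :=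
  ⟨kernelization, lifting .min, kernelGraph, isKernelization h1 h2 .min,
    isLifting .min κ (fun _ _ _ h h' => le_trans h' h) fun _ _ _ h => h rfl, kernel_card_le h1⟩

theorem hasPolynomialDelayKernel (h1 : ∀ G, quotientVertexCoverNum G ≤ κ G)
    (h2 : ∀ G, κ G ≤ G.n) (m : Mode) :
    HasPolynomialDelayKernel (problem m κ) FinGraph.n (fun k => 11 * (k ^ 2 + 1)) :=
  ⟨kernelization, lifting m, kernelGraph, isKernelization h1 h2 m,
    isLifting m κ (fun _ _ _ h h' b hb hn => (h' b hb hn).trans h) fun _ _ h _ b hb hn =>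
      (h b hb hn).trans (Nat.le_mul_of_pos_left _ (by omega)), kernel_card_le h1⟩

end Kernel

end MCKernel

open MCKernel in
/-- Enumeration kernels with `O(k²)` vertices, where `k` is the vertex cover number of the
true-twin quotient graph, or the twin-cover number, of the input graph. -/
theorem theorem4p7 :
    (∃ c : ℕ,
      HasFullyPolynomialKernel (enumMinimalMC quotientVertexCoverNum) FinGraph.n
        (fun k => c * (k ^ 2 + 1)) ∧
      HasPolynomialDelayKernel (enumMC quotientVertexCoverNum) FinGraph.n
        (fun k => c * (k ^ 2 + 1)) ∧
      HasPolynomialDelayKernel (enumMaximalMC quotientVertexCoverNum) FinGraph.n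
        (fun k => c * (k ^ 2 + 1))) ∧
    (∃ c : ℕ,
      HasFullyPolynomialKernel (enumMinimalMC twinCoverNum) FinGraph.n
        (fun k => c * (k ^ 2 + 1)) ∧
      HasPolynomialDelayKernel (enumMC twinCoverNum) FinGraph.n
        (fun k => c * (k ^ 2 + 1)) ∧
      HasPolynomialDelayKernel (enumMaximalMC twinCoverNum) FinGraph.n
        (fun k => c * (k ^ 2 + 1))) := by
  have h1 := quotientVertexCoverNum_le_twinCoverNum
  have h2 := twinCoverNum_le
  have h3 : ∀ G, quotientVertexCoverNum G ≤ G.n := fun G => (h1 G).trans (h2 G)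
  exact ⟨⟨11, hasFullyPolynomialKernel (fun _ => le_rfl) h3,
    hasPolynomialDelayKernel (fun _ => le_rfl) h3 .all,
    hasPolynomialDelayKernel (fun _ => le_rfl) h3 .max⟩,
    11, hasFullyPolynomialKernel h1 h2, hasPolynomialDelayKernel h1 h2 .all,
    hasPolynomialDelayKernel h1 h2 .max⟩
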